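/- Let $d\ge 3$ and $\lambda>0$. Let $h\in C^3((0,\infty))$ with $h\ge 0$, $h''>0$, $h'''<0$ and $h(v)\to\infty$ both as $v\to 0^+$ and as $v\to\infty$. For $F\in\mathbb R^{d\times d}$ with $\det F>0$ let $$W(F)=\tfrac12\sum_{i=1}^d\lambda_i^2+h\Big(\prod_{i=1}^d\lambda_i\Big),\qquad S(F)=\frac{\partial W}{\partial F}(F),$$ where $\lambda_1,\dots,\lambda_d$ are the eigenvalues of $\sqrt{FF^{T}}$. *Cavitating solution.* Let $r:[0,\infty)\to\mathbb R$ be continuous with $r(0)>0$, and let $y(x,t)=w(|x|,t)\frac{x}{|x|}$, where $w(R,t)=t\,r(R/t)$ for $t>0$ and $w(R,t)=\lambda R$ for $t\le 0$. Assume that: * there is a smallest $\sigma>0$ such that $r(s)=\lambda s$ for all $s>\sigma$; * $r$ is $C^2$ with $r'>0$ on $(0,\sigma)$, and the limit $r'(\sigma-)$ exists and is positive; * the surface of the cavity is stress free: for every $t>0$ the Cauchy stress $T=(\det F)^{-1}S(F)F^{T}$, $F=\nabla y(x,t)$, satisfies $T\frac{x}{|x|}\to 0$ as $x\to 0$; *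 $y$ is a weak solution of $y_{tt}-\operatorname{div}S(\nabla y)=0$ with zero initial velocity: for all $\psi\in C_c^\infty(\mathbb R^d\times\mathbb R;\mathbb R^d)$ the function $\partial_t y\cdot\partial_t\psi-S(\nabla y):\nabla\psi$ is integrable on $\mathbb R^d\times(0,\infty)$ and $\int_0^\infty\!\int_{\mathbb R^d}\partial_t y\cdot\partial_t\psi-S(\nabla y):\nabla\psi\,dx\,dt=0$. *Slic-energy.* For a mollifier $\phi\in C_c^\infty(\mathbb R)$ with $\phi\ge 0$, $\int\phi=1$, $\operatorname{supp}\phi\subset[-1,1]$, $\phi(-x)=\phi(x)$ and $\phi(0)>0$, put $\phi_n(R)=n\phi(nR)$, and for a radial motion $y=w(|x|,t)\frac{x}{|x|}$ let $$w^n(R,t)=\int_0^\infty\phi_n(R-\tilde R)\,w(\tilde R,t)\,d\tilde R-\int_0^\infty\phi_n(R+\tilde R)\,w(\tilde R,t)\,d\tilde R,\qquad y^n(x,t)=w^n(|x|,t)\frac{x}{|x|}.$$ The slic-energy of $y$ in $B$ at time $t$ is $E[y,B](t)=\lim_{n\to\infty}\int_B\frac12|\partial_t y^n|^2+W(\nabla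 y^n)\,dx$, where it is required that the integrals are well defined for all $n\ge 1$ and that the limit exists and is the same for every such $\phi$. **Proposition.** Suppose that the limit $L=\lim_{v\to\infty}h(v)/v$ exists and is finite. Let $t>0$ and let $B=B_{\bar R}(0)$ contain a neighbourhood of the wave fan $\{|x|\le\sigma t\}$, i.e. $\bar R>\sigma t$. Then the slic-energies of $y$ and of $\lambda x$ in $B$ at time $t$ exist and are finite, and $$E[y,B](t)=E[\lambda x,B](t)+\frac{t^d\sigma^d\omega_d}{d}\,J+\frac{t^d\omega_d}{d}\,r(0)^d\,L,$$ where $\omega_d$ is the surface area of the unit sphere in $\mathbb R^d$ and, with $a=w_R(t\sigma-,t)$, $$J=\tfrac12a^2+h(a\lambda^{d-1})-\tfrac12\lambda^2-h(\lambda^d)+\tfrac12\big[a+h'(a\lambda^{d-1})\lambda^{d-1}+\lambda+h'(\lambda^d)\lambda^{d-1}\big](\lambda-a)$$ is the energy dissipation of the outgoing shock. -/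

import Mathlib

open Set Filter Topology MeasureTheory
open scoped Matrix ContDiff

noncomputable section

namespace SlicElasticity

/-- The Euclidean space `ℝ^d`. -/
abbrev Space (d : ℕ) : Type := EuclideanSpace ℝ (Fin d)

/-- The Jacobian matrix `(∇f)_{ij} = ∂f_i/∂x_j` at `x`. -/
def gradMatrix {d : ℕ} (f : Space d → Space d) (x : Space d) : Matrix (Fin d) (Fin d) ℝ :=
  Matrix.of fun i j => (fderiv ℝ f x (EuclideanSpace.single j (1 : ℝ))) i

/-- The principal stretches `λ_1, …, λ_d` of `F`: the eigenvalues of `√(F Fᵀ)`, i.e. the square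
roots of the eigenvalues of `F Fᵀ` (for real matrices `Fᴴ = Fᵀ`). -/
def stretch {d : ℕ} (F : Matrix (Fin d) (Fin d) ℝ) (i : Fin d) : ℝ :=
  √((Matrix.isHermitian_mul_conjTranspose_self F).eigenvalues i)

/-- The stored energy `W(F) = ½ ∑ λ_i² + h(∏ λ_i)`; it is meant for `det F > 0`. -/
def storedEnergy {d : ℕ} (h : ℝ → ℝ) (F : Matrix (Fin d) (Fin d) ℝ) : ℝ :=
  (1 / 2) * ∑ i, stretch F i ^ 2 + h (∏ i, stretch F i)

/-- The Piola–Kirchhoff stress `S = ∂W/∂F`, entrywise `S_{ij} = ∂W/∂F_{ij}`. -/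
def piolaStress {d : ℕ} (h : ℝ → ℝ) (F : Matrix (Fin d) (Fin d) ℝ) : Matrix (Fin d) (Fin d) ℝ :=
  Matrix.of fun i j => deriv (fun s : ℝ => storedEnergy h (F + s • Matrix.single i j (1 : ℝ))) 0

/-- The Cauchy stress `T = (det F)⁻¹ S(F) Fᵀ`. -/
def cauchyStress {d : ℕ} (h : ℝ → ℝ) (F : Matrix (Fin d) (Fin d) ℝ) : Matrix (Fin d) (Fin d) ℝ :=
  (F.det)⁻¹ • (piolaStress h F * Fᵀ)

/-- The Frobenius product `A : B = ∑ A_{ij} B_{ij}`. -/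
def frobeniusProduct {d : ℕ} (A B : Matrix (Fin d) (Fin d) ℝ) : ℝ :=
  ∑ i, ∑ j, A i j * B i j

/-- The structural hypotheses on `h : (0,∞) → [0,∞)` (only the values on `(0,∞)` matter):
`h'' > 0`, `h''' < 0`, and `h → ∞` at `0` and at `∞`. -/
structure IsEnergyFunction (h : ℝ → ℝ) : Prop where
  contDiffOn : ContDiffOn ℝ 3 h (Ioi 0)
  nonneg : ∀ v, 0 < v → 0 ≤ h v
  second_deriv_pos : ∀ v, 0 < v → 0 < iteratedDeriv 2 h v
  third_deriv_neg : ∀ v, 0 < v → iteratedDeriv 3 h v < 0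
  tendsto_zero : Tendsto h (𝓝[>] 0) atTop
  tendsto_top : Tendsto h atTop atTop

/-- The radial motion `y(x,t) = w(|x|,t) x/|x|` with amplitude `w`. Time is the second argument
of `w` and the first argument of the motion. -/
def radialMotion (d : ℕ) (w : ℝ → ℝ → ℝ) (t : ℝ) (x : Space d) : Space d :=
  (w ‖x‖ t / ‖x‖) • x

/-- The amplitude `w(R,t) = λ R` of the homogeneous deformation `λ x`. -/
def homogeneousAmplitude (lam : ℝ) (R _t : ℝ) : ℝ := lam * R

/-- The self-similar amplitude `w(R,t) = t r(R/t)` for `t > 0`, extended by `λ R` for `t ≤ 0`. -/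
def selfSimilarAmplitude (lam : ℝ) (r : ℝ → ℝ) (R t : ℝ) : ℝ :=
  if 0 < t then t * r (R / t) else lam * R

/-- The integrand `∂_t y · ∂_t ψ - S(∇y) : ∇ψ` of the weak form, at `p = (t, x)`. -/
def weakIntegrand {d : ℕ} (h : ℝ → ℝ) (y : ℝ → Space d → Space d) (ψ : ℝ × Space d → Space d)
    (p : ℝ × Space d) : ℝ :=
  inner ℝ (deriv (fun τ => y τ p.2) p.1) (deriv (fun τ => ψ (τ, p.2)) p.1)
    - frobeniusProduct (piolaStress h (gradMatrix (y p.1) p.2))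
        (gradMatrix (fun z => ψ (p.1, z)) p.2)

/-- `y` is a weak solution of `y_tt - div S(∇y) = 0` on `ℝ^d × [0,∞)` with zero initial velocity.
The test functions need not vanish at `t = 0`. -/
def IsWeakSolution {d : ℕ} (h : ℝ → ℝ) (y : ℝ → Space d → Space d) : Prop :=
  ∀ ψ : ℝ × Space d → Space d, ContDiff ℝ ∞ ψ → HasCompactSupport ψ →
    IntegrableOn (weakIntegrand h y ψ) (Ioi 0 ×ˢ univ) ∧
      ∫ p in Ioi 0 ×ˢ univ, weakIntegrand h y ψ p = 0

/-- `r` is the profile, and `σ` the front speed, of a self-similar cavitating weak solution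
`y(x,t) = t r(|x|/t) x/|x|` that emanates from the homogeneous deformation `λ x`: a cavity of
radius `t r(0) > 0` with stress-free surface opens at the origin, the motion is smooth and
orientation preserving between the cavity and the front `|x| = σ t`, and it is `λ x` ahead of the
front. -/
structure IsCavitatingSolution (d : ℕ) (h : ℝ → ℝ) (lam σ : ℝ) (r : ℝ → ℝ) : Prop where
  continuousOn : ContinuousOn r (Ici 0)
  /-- There is a cavity. -/
  cavity : 0 < r 0
  /-- `σ` is the minimal `ρ > 0` such that `y(x,t) = λ x` for `|x| > ρ t`. -/
  front : IsLeast {ρ : ℝ | 0 < ρ ∧ ∀ s, ρ < s → r s = lam * s} σ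
  contDiffOn : ContDiffOn ℝ 2 r (Ioo 0 σ)
  deriv_pos : ∀ s ∈ Ioo 0 σ, 0 < deriv r s
  /-- The one-sided derivative `r'(σ-)` at the front exists and is positive. -/
  deriv_front : ∃ a : ℝ, 0 < a ∧ Tendsto (deriv r) (𝓝[<] σ) (𝓝 a)
  /-- The Cauchy stress exerts no traction on the surface of the cavity, whose normal is
  `x/|x|`. -/
  stress_free : ∀ t, 0 < t →
    Tendsto (fun x : Space d =>
        cauchyStress h (gradMatrix (radialMotion d (selfSimilarAmplitude lam r) t) x) *ᵥ
          fun i => x i / ‖x‖)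
      (𝓝[≠] 0) (𝓝 0)
  weak_solution : IsWeakSolution h (radialMotion d (selfSimilarAmplitude lam r))

/-- The symmetric mollifiers that detect the cavity (`φ(0) > 0`). -/
structure IsMollifier (φ : ℝ → ℝ) : Prop where
  contDiff : ContDiff ℝ ∞ φ
  nonneg : ∀ x, 0 ≤ φ x
  integral_eq_one : ∫ x, φ x = 1
  tsupport_subset : tsupport φ ⊆ Icc (-1) 1
  symm : ∀ x, φ (-x) = φ x
  pos_zero : 0 < φ 0

/-- `φ_n(R) = n φ(n R)`. -/
def scaledMollifier (φ : ℝ → ℝ) (n : ℕ) (R : ℝ) : ℝ := n * φ (n * R)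

/-- The radial mollification `w^n` of the odd extension of `w`. -/
def mollifiedAmplitude (φ : ℝ → ℝ) (n : ℕ) (w : ℝ → ℝ → ℝ) (R t : ℝ) : ℝ :=
  (∫ ρ in Ioi 0, scaledMollifier φ n (R - ρ) * w ρ t)
    - ∫ ρ in Ioi 0, scaledMollifier φ n (R + ρ) * w ρ t

/-- The mechanical energy density `½ |y_t|² + W(∇y)`. -/
def energyDensity {d : ℕ} (h : ℝ → ℝ) (y : ℝ → Space d → Space d) (t : ℝ) (x : Space d) : ℝ :=
  (1 / 2) * ‖deriv (fun τ => y τ x) t‖ ^ 2 + storedEnergy h (gradMatrix (y t) x)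

/-- The slic-energy `E[y,B](t)` of the radial motion `y` with amplitude `w` exists and equals `e`:
for every admissible mollifier the energies in `B` of the mollified motions `y^n`, `n ≥ 1`, are
well defined and converge to `e`. -/
def HasSlicEnergy (d : ℕ) (h : ℝ → ℝ) (w : ℝ → ℝ → ℝ) (B : Set (Space d)) (t e : ℝ) : Prop :=
  ∀ φ : ℝ → ℝ, IsMollifier φ →
    (∀ n : ℕ, 1 ≤ n →
      IntegrableOn (energyDensity h (radialMotion d (mollifiedAmplitude φ n w)) t) B) ∧
    Tendsto
      (fun n : ℕ => ∫ x in B, energyDensity h (radialMotion d (mollifiedAmplitude φ n w)) t x)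
      atTop (𝓝 e)

/-- The surface area `ω_d` of the unit sphere of `ℝ^d`. -/
def sphereArea (d : ℕ) : ℝ := ((volume : Measure (Space d)).toSphere).real univ

/-- The energy dissipation `J` of the outgoing shock, where `a` is the value of `w_R` behind the
shock. -/
def shockDissipation (d : ℕ) (h : ℝ → ℝ) (lam a : ℝ) : ℝ :=
  (1 / 2) * a ^ 2 + h (a * lam ^ (d - 1)) - (1 / 2) * lam ^ 2 - h (lam ^ d)
    + (1 / 2) * (a + deriv h (a * lam ^ (d - 1)) * lam ^ (d - 1)
        + lam + deriv h (lam ^ d) * lam ^ (d - 1)) * (lam - a)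

end SlicElasticity

end

noncomputable section

namespace SlicElasticity

/-! ### Matrices -/

section Matrices

variable {d : ℕ}

/-! Radial symmetry makes everything one-dimensional. At a radial map with amplitude `w` the
gradient has the stretch `p = w_R` along `x/|x|` and `q = w/R` in the `d - 1` orthogonal directions,
so energy, stress and traction are explicit in `p`, `q` and the Jacobian `p q^(d-1)`. The identity
then splits into the energy of the fan and a concentration at the cavity.

Energy of the fan. Testing the weak form with `θ(t) κ(|x|/t) x` gives, in `s = R/t`, an ordinary
differential equation `A' = B` in the sense of distributions, where `A` is the momentum flux. Hence
`A` is a primitive of `B`: it is differentiable behind the front and has no jump there, which is the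
Rankine–Hugoniot condition. With the energy density `e`, the velocity `u = r - s r'` and the radial
traction, `s^d e + traction * u` is a primitive of `d s^(d-1) e` on `(0,σ)`. It vanishes at the
cavity because the surface is stress free. At the front the Rankine–Hugoniot condition turns its
limit into `σ^d` times the undisturbed energy density plus `J` (`integral_fan_energy`).

Bounds at the cavity. The stress-free condition and the monotonicity of `h'` confine the Jacobian to
a compact subset of `(0,∞)` (`exists_jacobian_bounds`). Since `r ≥ r(0) > 0`, this bounds `r'` from
above and bounds it from below by a multiple of `min(s,σ)^(d-1)`.

Concentration. The amplitude on `R > 0` is the constant `t r(0)` plus a function with a Lipschitz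
odd extension. Mollified, the constant contributes `2 t r(0)` times the mass of `φ_n` on `(0,R)`, so
the stretch is of order `n` in the core `R < 1/n` and bounded outside. Outside the core dominated
convergence yields the energy of the fan (`tendsto_integral_outer`). In the core the kinetic and
quadratic terms are bounded per unit radius because `d ≥ 3`, hence disappear, while `h(v)` behaves
like `L v`. Since `R^(d-1) v = p q^(d-1)` is the derivative of `q^d/d`, the core contributes `L
q(1/n)^d/d`, which tends to `L (t r(0))^d/d` for every mollifier (`tendsto_integral_core`). Both
estimates need the mollified Jacobian to stay away from `0`, where `h` blows up; this is
`exists_le_mollified_jacobian`. -/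

theorem posSemidef_self_mul_conjTranspose (F : Matrix (Fin d) (Fin d) ℝ) :
    (F * Fᴴ).PosSemidef := Matrix.posSemidef_self_mul_conjTranspose F

theorem sum_stretch_sq (F : Matrix (Fin d) (Fin d) ℝ) :
    ∑ i, stretch F i ^ 2 = ∑ i, ∑ j, F i j ^ 2 := by
  have hpos := (posSemidef_self_mul_conjTranspose F).eigenvalues_nonneg
  have h1 : ∑ i, stretch F i ^ 2
      = ∑ i, (Matrix.isHermitian_mul_conjTranspose_self F).eigenvalues i :=
    Finset.sum_congr rfl fun i _ => Real.sq_sqrt (hpos i)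
  have h2 := (Matrix.isHermitian_mul_conjTranspose_self F).trace_eq_sum_eigenvalues
  simp only [RCLike.ofReal_real_eq_id, id] at h2
  rw [h1, ← h2, Matrix.trace]
  refine Finset.sum_congr rfl fun i _ => ?_
  simp [Matrix.mul_apply, sq]

theorem prod_stretch (F : Matrix (Fin d) (Fin d) ℝ) : ∏ i, stretch F i = |F.det| := by
  have hpos := (posSemidef_self_mul_conjTranspose F).eigenvalues_nonneg
  have h2 := (Matrix.isHermitian_mul_conjTranspose_self F).det_eq_prod_eigenvalues
  simp only [RCLike.ofReal_real_eq_id, id] at h2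
  have h3 : (F * Fᴴ).det = F.det ^ 2 := by
    rw [Matrix.det_mul, Matrix.det_conjTranspose]; simp [sq]
  unfold stretch
  rw [← Real.sqrt_sq_eq_abs, ← h3, h2, Real.sqrt_prod _ fun i _ => hpos i]

theorem storedEnergy_eq (h : ℝ → ℝ) (F : Matrix (Fin d) (Fin d) ℝ) :
    storedEnergy h F = 1 / 2 * ∑ i, ∑ j, F i j ^ 2 + h |F.det| := by
  rw [storedEnergy, sum_stretch_sq, prod_stretch]

/-- One entry occurs in one row only, so the determinant is affine in it and its slope is the
cofactor. This supplies the derivative of the determinant in the stress. -/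
theorem det_add_smul_single (F : Matrix (Fin d) (Fin d) ℝ) (i j : Fin d) (s : ℝ) :
    (F + s • Matrix.single i j (1 : ℝ)).det = F.det + s * F.adjugate j i := by
  have h1 : F + s • Matrix.single i j (1 : ℝ) = F.updateRow i (F i + s • Pi.single j 1) := by
    ext a b
    by_cases ha : a = i
    · subst ha
      simp [Matrix.single_apply, Pi.single_apply, eq_comm]
    · simp [ha, Ne.symm ha]
  rw [h1, Matrix.det_updateRow_add, Matrix.updateRow_eq_self, Matrix.det_updateRow_smul,
    Matrix.adjugate_apply]

theorem sum_sq_add_smul_single (F : Matrix (Fin d) (Fin d) ℝ) (i j : Fin d) (s : ℝ) :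
    ∑ a, ∑ b, (F + s • Matrix.single i j (1 : ℝ)) a b ^ 2
      = ∑ a, ∑ b, F a b ^ 2 + (2 * s * F i j + s ^ 2) := by
  have h1 : ∀ a b, (F + s • Matrix.single i j (1 : ℝ)) a b ^ 2
      = F a b ^ 2 + if i = a then (if j = b then 2 * s * F i j + s ^ 2 else 0) else 0 := by
    intro a b
    by_cases ha : i = a
    · by_cases hb : j = b
      · subst ha hb; simp; ring
      · simp [hb]
    · simp [ha]
  simp_rw [h1, Finset.sum_add_distrib]
  simp

theorem piolaStress_apply {h : ℝ → ℝ} {F : Matrix (Fin d) (Fin d) ℝ} (hF : 0 < F.det)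
    (hh : DifferentiableAt ℝ h F.det) (i j : Fin d) :
    piolaStress h F i j = F i j + deriv h F.det * F.adjugate j i := by
  have hlin : HasDerivAt (fun s : ℝ => F.det + s * F.adjugate j i) (F.adjugate j i) 0 := by
    simpa using ((hasDerivAt_id (0 : ℝ)).mul_const (F.adjugate j i)).const_add F.det
  have hcomp : HasDerivAt (fun s : ℝ => h (F.det + s * F.adjugate j i))
      (deriv h F.det * F.adjugate j i) 0 := by
    have h0 : HasDerivAt h (deriv h F.det) (F.det + 0 * F.adjugate j i) := by
      simpa using hh.hasDerivAt
    exact h0.comp (0 : ℝ) hlin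
  have hquad : HasDerivAt
      (fun s : ℝ => 1 / 2 * (∑ a, ∑ b, F a b ^ 2 + (2 * s * F i j + s ^ 2))) (F i j) 0 := by
    have := (((((hasDerivAt_id' (0 : ℝ)).const_mul 2).mul_const (F i j)).fun_add
      ((hasDerivAt_id' (0 : ℝ)).fun_pow 2)).const_add (∑ a, ∑ b, F a b ^ 2)).const_mul (1 / 2)
    simpa using this
  have hev : (fun s : ℝ => storedEnergy h (F + s • Matrix.single i j (1 : ℝ)))
      =ᶠ[𝓝 0] fun s : ℝ => 1 / 2 * (∑ a, ∑ b, F a b ^ 2 + (2 * s * F i j + s ^ 2))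
        + h (F.det + s * F.adjugate j i) := by
    -- The stored energy sees `|det|`; near a matrix of positive determinant the absolute value can
    -- be dropped.
    have hpos : ∀ᶠ s : ℝ in 𝓝 0, 0 < F.det + s * F.adjugate j i :=
      hlin.continuousAt.eventually_const_lt (by simpa using hF)
    filter_upwards [hpos] with s hs
    rw [storedEnergy_eq, sum_sq_add_smul_single, det_add_smul_single, abs_of_pos hs]
  rw [piolaStress, Matrix.of_apply, hev.deriv_eq, (hquad.fun_add hcomp).deriv]

theorem piolaStress_eq {h : ℝ → ℝ} {F : Matrix (Fin d) (Fin d) ℝ} (hF : 0 < F.det)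
    (hh : DifferentiableAt ℝ h F.det) :
    piolaStress h F = F + deriv h F.det • F.adjugateᵀ := by
  ext i j
  simp [piolaStress_apply hF hh]

theorem cauchyStress_eq {h : ℝ → ℝ} {F : Matrix (Fin d) (Fin d) ℝ} (hF : 0 < F.det)
    (hh : DifferentiableAt ℝ h F.det) :
    cauchyStress h F = (F.det)⁻¹ • (F * Fᵀ) + deriv h F.det • 1 := by
  rw [cauchyStress, piolaStress_eq hF hh, add_mul, smul_add, Matrix.smul_mul,
    ← Matrix.transpose_mul, Matrix.mul_adjugate, Matrix.transpose_smul, Matrix.transpose_one,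
    smul_comm, smul_smul (F.det)⁻¹, inv_mul_cancel₀ hF.ne', one_smul]

/-- The matrix with the stretch `p` in the direction `n` and `q` in the orthogonal directions. -/
def radialMatrix (p q : ℝ) (n : Fin d → ℝ) : Matrix (Fin d) (Fin d) ℝ :=
  q • 1 + (p - q) • Matrix.vecMulVec n n

theorem radialMatrix_mul {n : Fin d → ℝ} (hn : n ⬝ᵥ n = 1) (p q p' q' : ℝ) :
    radialMatrix p q n * radialMatrix p' q' n = radialMatrix (p * p') (q * q') n := by
  have hv : Matrix.vecMulVec n n * Matrix.vecMulVec n n = Matrix.vecMulVec n n := by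
    rw [Matrix.vecMulVec_mul_vecMulVec, hn, one_smul]
  simp only [radialMatrix, add_mul, mul_add, Matrix.smul_mul, Matrix.mul_smul, one_mul, mul_one,
    hv]
  module

theorem radialMatrix_self (q : ℝ) (n : Fin d → ℝ) : radialMatrix q q n = q • 1 := by
  simp [radialMatrix]

theorem radialMatrix_transpose (p q : ℝ) (n : Fin d → ℝ) :
    (radialMatrix p q n)ᵀ = radialMatrix p q n := by
  simp [radialMatrix, Matrix.transpose_vecMulVec]

theorem radialMatrix_mulVec {n : Fin d → ℝ} (hn : n ⬝ᵥ n = 1) (p q : ℝ) :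
    radialMatrix p q n *ᵥ n = p • n := by
  rw [radialMatrix, Matrix.add_mulVec, Matrix.smul_mulVec, Matrix.smul_mulVec,
    Matrix.vecMulVec_mulVec, hn]
  simp [sub_smul]

theorem trace_radialMatrix {n : Fin d → ℝ} (hn : n ⬝ᵥ n = 1) (p q : ℝ) :
    (radialMatrix p q n).trace = p + (d - 1) * q := by
  have h1 : (Matrix.vecMulVec n n).trace = 1 := by rw [Matrix.trace_vecMulVec, hn]
  simp only [radialMatrix, Matrix.trace_add, Matrix.trace_smul, h1, Matrix.trace_one,
    Fintype.card_fin, smul_eq_mul]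
  ring

/-- The matrix is a rank-one perturbation of `q • 1`, so the matrix determinant lemma applies. -/
theorem det_radialMatrix (hd : 1 ≤ d) {n : Fin d → ℝ} (hn : n ⬝ᵥ n = 1) (p : ℝ) {q : ℝ}
    (hq : q ≠ 0) : (radialMatrix p q n).det = p * q ^ (d - 1) := by
  have h1 : radialMatrix p q n
      = q • (1 + Matrix.replicateCol Unit (((p - q) / q) • n) * Matrix.replicateRow Unit n) := by
    rw [← Matrix.vecMulVec_eq, Matrix.smul_vecMulVec, smul_add, smul_smul, mul_div_cancel₀ _ hq]
    rfl
  rw [h1, Matrix.det_smul, Matrix.det_one_add_replicateCol_mul_replicateRow, dotProduct_smul, hn,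
    Fintype.card_fin]
  obtain ⟨k, rfl⟩ := Nat.exists_eq_add_of_le' hd
  simp only [Nat.add_sub_cancel, pow_succ, smul_eq_mul]
  field_simp
  ring

theorem adjugate_radialMatrix (hd : 2 ≤ d) {n : Fin d → ℝ} (hn : n ⬝ᵥ n = 1) {p q : ℝ}
    (hp : p ≠ 0) (hq : q ≠ 0) :
    (radialMatrix p q n).adjugate = radialMatrix (q ^ (d - 1)) (p * q ^ (d - 2)) n := by
  have hdet := det_radialMatrix (by lia) hn p hq
  have hne : p * q ^ (d - 1) ≠ 0 := mul_ne_zero hp (pow_ne_zero _ hq)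
  have hprod : radialMatrix p q n * radialMatrix (q ^ (d - 1)) (p * q ^ (d - 2)) n
      = (p * q ^ (d - 1)) • 1 := by
    rw [radialMatrix_mul hn, ← radialMatrix_self _ n]
    obtain ⟨k, rfl⟩ := Nat.exists_eq_add_of_le' hd
    congr 1
    simp only [Nat.add_sub_cancel, show k + 2 - 1 = k + 1 by lia, pow_succ]
    ring
  -- Multiplying the product identity by the adjugate turns it into an identity between multiples of
  -- the same nonzero determinant, which cancels.
  have h1 := congrArg ((radialMatrix p q n).adjugate * ·) hprod
  simp only [← mul_assoc, Matrix.adjugate_mul, hdet, Matrix.smul_mul, one_mul, Matrix.mul_smul,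
    mul_one] at h1
  exact (smul_right_injective _ hne h1).symm

theorem frobeniusProduct_eq_trace (A B : Matrix (Fin d) (Fin d) ℝ) :
    frobeniusProduct A B = (A * Bᵀ).trace := by
  simp [frobeniusProduct, Matrix.trace, Matrix.mul_apply]

theorem frobeniusProduct_radialMatrix {n : Fin d → ℝ} (hn : n ⬝ᵥ n = 1) (p q p' q' : ℝ) :
    frobeniusProduct (radialMatrix p q n) (radialMatrix p' q' n) = p * p' + (d - 1) * (q * q') := by
  rw [frobeniusProduct_eq_trace, radialMatrix_transpose, radialMatrix_mul hn, trace_radialMatrix hn]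

theorem storedEnergy_radialMatrix (hd : 1 ≤ d) (h : ℝ → ℝ) {n : Fin d → ℝ} (hn : n ⬝ᵥ n = 1)
    {p q : ℝ} (hp : 0 < p) (hq : 0 < q) :
    storedEnergy h (radialMatrix p q n)
      = 1 / 2 * (p ^ 2 + (d - 1) * q ^ 2) + h (p * q ^ (d - 1)) := by
  have h1 : ∑ i, ∑ j, radialMatrix p q n i j ^ 2 = p * p + (d - 1) * (q * q) := by
    rw [← frobeniusProduct_radialMatrix hn]
    simp [frobeniusProduct, sq]
  rw [storedEnergy_eq, h1, det_radialMatrix hd hn p hq.ne', abs_of_pos (by positivity)]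
  ring

theorem piolaStress_radialMatrix (hd : 2 ≤ d) {h : ℝ → ℝ} {n : Fin d → ℝ} (hn : n ⬝ᵥ n = 1)
    {p q : ℝ} (hp : 0 < p) (hq : 0 < q) (hh : DifferentiableAt ℝ h (p * q ^ (d - 1))) :
    piolaStress h (radialMatrix p q n)
      = radialMatrix (p + deriv h (p * q ^ (d - 1)) * q ^ (d - 1))
          (q + deriv h (p * q ^ (d - 1)) * (p * q ^ (d - 2))) n := by
  have hdet := det_radialMatrix (by lia) hn p hq.ne'
  rw [piolaStress_eq (by rw [hdet]; positivity) (by rwa [hdet]), hdet,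
    adjugate_radialMatrix hd hn hp.ne' hq.ne', radialMatrix_transpose]
  simp only [radialMatrix]
  module

theorem cauchyStress_radialMatrix_mulVec (hd : 1 ≤ d) {h : ℝ → ℝ} {n : Fin d → ℝ}
    (hn : n ⬝ᵥ n = 1) {p q : ℝ} (hp : 0 < p) (hq : 0 < q)
    (hh : DifferentiableAt ℝ h (p * q ^ (d - 1))) :
    cauchyStress h (radialMatrix p q n) *ᵥ n
      = (p / q ^ (d - 1) + deriv h (p * q ^ (d - 1))) • n := by
  have hdet := det_radialMatrix hd hn p hq.ne'
  rw [cauchyStress_eq (by rw [hdet]; positivity) (by rwa [hdet]), hdet, radialMatrix_transpose,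
    radialMatrix_mul hn, Matrix.add_mulVec, Matrix.smul_mulVec, Matrix.smul_mulVec,
    radialMatrix_mulVec hn, Matrix.one_mulVec, smul_smul, ← add_smul]
  congr 2
  field_simp

end Matrices

/-! ### Gradients of radial maps -/

section Radial

variable {d : ℕ}

/-- The unit outward normal `x/|x|`. -/
def normal (x : Space d) : Fin d → ℝ := fun i => x i / ‖x‖

theorem normal_dotProduct_self {x : Space d} (hx : x ≠ 0) : normal x ⬝ᵥ normal x = 1 := by
  have h1 : ∑ i, x i ^ 2 = ‖x‖ ^ 2 := by rw [EuclideanSpace.real_norm_sq_eq]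
  have h2 : ‖x‖ ≠ 0 := norm_ne_zero_iff.2 hx
  calc normal x ⬝ᵥ normal x = (∑ i, x i ^ 2) / ‖x‖ ^ 2 := by
        simp only [normal, dotProduct, Finset.sum_div]
        exact Finset.sum_congr rfl fun i _ => by ring
    _ = 1 := by rw [h1, div_self (pow_ne_zero 2 h2)]

theorem hasFDerivAt_norm {x : Space d} (hx : x ≠ 0) :
    HasFDerivAt (fun z : Space d => ‖z‖) (‖x‖⁻¹ • innerSL ℝ x) x := by
  have h2 : ‖x‖ ≠ 0 := norm_ne_zero_iff.2 hx
  have h3 := ((hasStrictFDerivAt_norm_sq x).hasFDerivAt).sqrt (pow_ne_zero 2 h2)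
  simp only [Real.sqrt_sq (norm_nonneg _)] at h3
  refine h3.congr_fderiv ?_
  ext v
  simp
  field_simp

theorem gradMatrix_norm_smul {g : ℝ → ℝ} {g' : ℝ} {x : Space d} (hx : x ≠ 0)
    (hg : HasDerivAt g g' ‖x‖) :
    gradMatrix (fun z => g ‖z‖ • z) x
      = radialMatrix (g ‖x‖ + ‖x‖ * g') (g ‖x‖) (normal x) := by
  have h2 : ‖x‖ ≠ 0 := norm_ne_zero_iff.2 hx
  have h3 := (hg.comp_hasFDerivAt x (hasFDerivAt_norm hx)).smul (hasFDerivAt_id x)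
  have h4 : fderiv ℝ (fun z : Space d => g ‖z‖ • z) x = _ := h3.fderiv
  ext i j
  rw [gradMatrix, Matrix.of_apply, h4]
  by_cases hij : i = j
  · subst hij
    simp [radialMatrix, normal, Matrix.vecMulVec_apply, EuclideanSpace.inner_single_right]
    field_simp
  · simp [radialMatrix, normal, Matrix.vecMulVec_apply, EuclideanSpace.inner_single_right, hij,
      Matrix.one_apply_ne hij]
    field_simp

theorem gradMatrix_radialMotion {w : ℝ → ℝ → ℝ} {t p : ℝ} {x : Space d} (hx : x ≠ 0)
    (hw : HasDerivAt (fun R => w R t) p ‖x‖) :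
    gradMatrix (radialMotion d w t) x = radialMatrix p (w ‖x‖ t / ‖x‖) (normal x) := by
  have h2 : ‖x‖ ≠ 0 := norm_ne_zero_iff.2 hx
  have h3 := gradMatrix_norm_smul hx (hw.fun_div (hasDerivAt_id' ‖x‖) h2)
  have h4 : radialMotion d w t = fun z => (w ‖z‖ t / ‖z‖) • z := rfl
  rw [h4, h3]
  congr 1
  field_simp
  ring

theorem hasDerivAt_radialMotion {w : ℝ → ℝ → ℝ} {t u : ℝ} {x : Space d}
    (hw : HasDerivAt (fun τ => w ‖x‖ τ) u t) :
    HasDerivAt (fun τ => radialMotion d w τ x) ((u / ‖x‖) • x) t :=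
  (hw.div_const ‖x‖).smul_const x

theorem energyDensity_radialMotion (hd : 1 ≤ d) (h : ℝ → ℝ) {w : ℝ → ℝ → ℝ} {t p u : ℝ}
    {x : Space d} (hx : x ≠ 0) (hR : HasDerivAt (fun R => w R t) p ‖x‖)
    (ht : HasDerivAt (fun τ => w ‖x‖ τ) u t) (hp : 0 < p) (hw : 0 < w ‖x‖ t) :
    energyDensity h (radialMotion d w) t x
      = 1 / 2 * u ^ 2 + (1 / 2 * (p ^ 2 + (d - 1) * (w ‖x‖ t / ‖x‖) ^ 2)
          + h (p * (w ‖x‖ t / ‖x‖) ^ (d - 1))) := by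
  have h2 : 0 < ‖x‖ := norm_pos_iff.2 hx
  rw [energyDensity, (hasDerivAt_radialMotion ht).deriv, gradMatrix_radialMotion hx hR,
    storedEnergy_radialMatrix hd h (normal_dotProduct_self hx) hp (by positivity), norm_smul,
    norm_div, norm_norm, div_mul_cancel₀ _ h2.ne', Real.norm_eq_abs, sq_abs]

end Radial

/-! ### The constitutive function -/

section Constitutive

variable {h : ℝ → ℝ}

theorem IsEnergyFunction.hasDerivAt (hh : IsEnergyFunction h) {v : ℝ} (hv : 0 < v) :
    HasDerivAt h (deriv h v) v :=
  ((hh.contDiffOn.contDiffAt (Ioi_mem_nhds hv)).differentiableAt (by norm_num)).hasDerivAt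

theorem IsEnergyFunction.contDiffOn_deriv (hh : IsEnergyFunction h) :
    ContDiffOn ℝ 2 (deriv h) (Ioi 0) :=
  hh.contDiffOn.deriv_of_isOpen isOpen_Ioi (by norm_num)

theorem IsEnergyFunction.continuousOn_deriv (hh : IsEnergyFunction h) :
    ContinuousOn (deriv h) (Ioi 0) := hh.contDiffOn_deriv.continuousOn

theorem IsEnergyFunction.strictMonoOn_deriv (hh : IsEnergyFunction h) :
    StrictMonoOn (deriv h) (Ioi 0) := by
  refine strictMonoOn_of_deriv_pos (convex_Ioi 0) hh.continuousOn_deriv fun v hv => ?_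
  rw [interior_Ioi] at hv
  have := hh.second_deriv_pos v hv
  rwa [iteratedDeriv_succ, iteratedDeriv_one] at this

/-- Mean value theorem between `1` and a point where `h` exceeds `h 1`. Together with
`exists_deriv_neg` it provides barriers on both sides of the zero of `h'`, between which the
stress-free condition traps the Jacobian. -/
theorem IsEnergyFunction.exists_deriv_pos (hh : IsEnergyFunction h) :
    ∃ v, 0 < v ∧ 0 < deriv h v := by
  obtain ⟨b, hb1, hb⟩ :=
    ((eventually_gt_atTop (1 : ℝ)).and (hh.tendsto_top.eventually_gt_atTop (h 1))).exists
  obtain ⟨c, hc, hc'⟩ := exists_deriv_eq_slope h hb1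
    (hh.contDiffOn.continuousOn.mono fun x hx => zero_lt_one.trans_le hx.1)
    (fun x hx => (hh.hasDerivAt (zero_lt_one.trans hx.1)).differentiableAt.differentiableWithinAt)
  exact ⟨c, zero_lt_one.trans hc.1, hc' ▸ div_pos (sub_pos.2 hb) (sub_pos.2 hb1)⟩

theorem IsEnergyFunction.exists_deriv_neg (hh : IsEnergyFunction h) :
    ∃ v, 0 < v ∧ deriv h v < 0 := by
  obtain ⟨b, ⟨hb0, hb1⟩, hb⟩ :=
    ((show ∀ᶠ x in 𝓝[>] (0 : ℝ), x ∈ Ioo 0 1 from Ioo_mem_nhdsGT zero_lt_one).and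
      (hh.tendsto_zero.eventually_gt_atTop (h 1))).exists
  obtain ⟨c, hc, hc'⟩ := exists_deriv_eq_slope h hb1
    (hh.contDiffOn.continuousOn.mono fun x hx => hb0.trans_le hx.1)
    (fun x hx => (hh.hasDerivAt (hb0.trans hx.1)).differentiableAt.differentiableWithinAt)
  exact ⟨c, hb0.trans hc.1, hc' ▸ div_neg_of_neg_of_pos (sub_neg.2 hb) (sub_pos.2 hb1)⟩

end Constitutive

/-! ### The profile of a cavitating solution -/

section Profile

theorem exists_bound_of_continuousOn_Ioo {f : ℝ → ℝ} {a b : ℝ} (hf : ContinuousOn f (Ioo a b))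
    (ha : ∃ C, ∀ᶠ x in 𝓝[>] a, |f x| ≤ C) (hb : ∃ C, ∀ᶠ x in 𝓝[<] b, |f x| ≤ C) :
    ∃ C, ∀ x ∈ Ioo a b, |f x| ≤ C := by
  rcases le_or_gt b a with hab | hab
  · exact ⟨0, fun x hx => absurd (hx.1.trans hx.2) hab.not_gt⟩
  obtain ⟨C₁, hC₁⟩ := ha
  obtain ⟨C₂, hC₂⟩ := hb
  obtain ⟨a', ha', hC₁⟩ := mem_nhdsGT_iff_exists_Ioo_subset.1 hC₁
  obtain ⟨b', hb', hC₂⟩ := mem_nhdsLT_iff_exists_Ioo_subset.1 hC₂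
  obtain ⟨C₃, hC₃⟩ := isCompact_Icc.exists_bound_of_continuousOn
    (hf.mono (Icc_subset_Ioo ha' hb'))
  refine ⟨max C₁ (max C₂ C₃), fun x hx => ?_⟩
  rcases lt_or_ge x a' with h1 | h1
  · exact (hC₁ ⟨hx.1, h1⟩).trans (le_max_left _ _)
  rcases lt_or_ge b' x with h2 | h2
  · exact (hC₂ ⟨h2, hx.2⟩).trans ((le_max_left _ _).trans (le_max_right _ _))
  · exact (hC₃ x ⟨h1, h2⟩).trans ((le_max_right _ _).trans (le_max_right _ _))

/-- The radial stretch `r'`, with the value `lam` at the front. -/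
def radialStretch (lam σ : ℝ) (r : ℝ → ℝ) (s : ℝ) : ℝ := if s < σ then deriv r s else lam

/-- The Jacobian `r' (r/s)^(d-1)` of the deformation. -/
def jacobian (d : ℕ) (lam σ : ℝ) (r : ℝ → ℝ) (s : ℝ) : ℝ :=
  radialStretch lam σ r s * (r s / s) ^ (d - 1)

variable {d : ℕ} {h : ℝ → ℝ} {lam σ : ℝ} {r : ℝ → ℝ}

namespace IsCavitatingSolution

theorem sigma_pos (hr : IsCavitatingSolution d h lam σ r) : 0 < σ := hr.front.1.1

theorem eq_of_ge (hr : IsCavitatingSolution d h lam σ r) {s : ℝ} (hs : σ ≤ s) :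
    r s = lam * s := by
  rcases hs.eq_or_lt with rfl | hs
  · have h1 : Tendsto r (𝓝[>] σ) (𝓝 (r σ)) :=
      ((hr.continuousOn.continuousAt (Ici_mem_nhds hr.sigma_pos)).tendsto).mono_left
        nhdsWithin_le_nhds
    have h2 : Tendsto r (𝓝[>] σ) (𝓝 (lam * σ)) := by
      refine Tendsto.congr' ?_ (((continuous_const_mul lam).tendsto σ).mono_left nhdsWithin_le_nhds)
      filter_upwards [self_mem_nhdsWithin] with s hs using (hr.front.1.2 s hs).symm
    exact tendsto_nhds_unique h1 h2
  · exact hr.front.1.2 s hs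

theorem hasDerivAt (hr : IsCavitatingSolution d h lam σ r) {s : ℝ} (hs : 0 < s) (hsσ : s ≠ σ) :
    HasDerivAt r (radialStretch lam σ r s) s := by
  rcases hsσ.lt_or_gt with h1 | h1
  · rw [radialStretch, if_pos h1]
    exact ((hr.contDiffOn.contDiffAt (Ioo_mem_nhds hs h1)).differentiableAt
      (by norm_num)).hasDerivAt
  · rw [radialStretch, if_neg h1.not_gt]
    refine HasDerivAt.congr_of_eventuallyEq (f := fun s => lam * s)
      (by simpa using (hasDerivAt_id' s).const_mul lam) ?_
    filter_upwards [Ioi_mem_nhds h1] with z hz using hr.eq_of_ge (mem_Ioi.1 hz).le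

theorem radialStretch_of_lt {s : ℝ} (hs : s < σ) : radialStretch lam σ r s = deriv r s :=
  if_pos hs

theorem radialStretch_of_ge {s : ℝ} (hs : σ ≤ s) : radialStretch lam σ r s = lam :=
  if_neg hs.not_gt

theorem radialStretch_pos (hr : IsCavitatingSolution d h lam σ r) (hlam : 0 < lam) {s : ℝ}
    (hs : 0 < s) : 0 < radialStretch lam σ r s := by
  rcases lt_or_ge s σ with h1 | h1
  · rw [radialStretch_of_lt h1]; exact hr.deriv_pos s ⟨hs, h1⟩
  · rwa [radialStretch_of_ge h1]

theorem monotoneOn (hr : IsCavitatingSolution d h lam σ r) (hlam : 0 < lam) :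
    MonotoneOn r (Ici 0) := by
  have h1 : MonotoneOn r (Icc 0 σ) := by
    refine (strictMonoOn_of_deriv_pos (convex_Icc 0 σ)
      (hr.continuousOn.mono fun x hx => hx.1) fun x hx => ?_).monotoneOn
    rw [interior_Icc] at hx
    exact hr.deriv_pos x hx
  have h2 : MonotoneOn r (Ici σ) := by
    intro x hx y hy hxy
    rw [hr.eq_of_ge hx, hr.eq_of_ge hy]
    gcongr
  have := h1.union_right h2 (isGreatest_Icc hr.sigma_pos.le) isLeast_Ici
  rwa [Icc_union_Ici_eq_Ici hr.sigma_pos.le] at this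

theorem cavity_le (hr : IsCavitatingSolution d h lam σ r) (hlam : 0 < lam) {s : ℝ}
    (hs : 0 ≤ s) : r 0 ≤ r s := hr.monotoneOn hlam self_mem_Ici hs hs

theorem pos (hr : IsCavitatingSolution d h lam σ r) (hlam : 0 < lam) {s : ℝ}
    (hs : 0 ≤ s) : 0 < r s := hr.cavity.trans_le (hr.cavity_le hlam hs)

theorem jacobian_pos (hr : IsCavitatingSolution d h lam σ r) (hlam : 0 < lam) {s : ℝ}
    (hs : 0 < s) : 0 < jacobian d lam σ r s :=
  mul_pos (hr.radialStretch_pos hlam hs) (pow_pos (div_pos (hr.pos hlam hs.le) hs) _)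

theorem jacobian_of_ge (hr : IsCavitatingSolution d h lam σ r) (hd : 1 ≤ d) {s : ℝ}
    (hs : σ ≤ s) : jacobian d lam σ r s = lam ^ d := by
  rw [jacobian, radialStretch_of_ge hs, hr.eq_of_ge hs,
    mul_div_cancel_right₀ _ (hr.sigma_pos.trans_le hs).ne', ← pow_succ', Nat.sub_add_cancel hd]

theorem continuousOn_radialStretch (hr : IsCavitatingSolution d h lam σ r) :
    ContinuousOn (radialStretch lam σ r) (Ioo 0 σ) :=
  (hr.contDiffOn.continuousOn_deriv_of_isOpen isOpen_Ioo (by norm_num)).congr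
    fun _ hs => radialStretch_of_lt hs.2

theorem continuousAt_radialStretch (hr : IsCavitatingSolution d h lam σ r) {s : ℝ} (hs : 0 < s)
    (hsσ : s ≠ σ) : ContinuousAt (radialStretch lam σ r) s := by
  rcases hsσ.lt_or_gt with h1 | h1
  · exact hr.continuousOn_radialStretch.continuousAt (Ioo_mem_nhds hs h1)
  · refine (continuousAt_const (y := lam)).congr ?_
    filter_upwards [Ioi_mem_nhds h1] with z hz using (radialStretch_of_ge (mem_Ioi.1 hz).le).symm

theorem continuousAt (hr : IsCavitatingSolution d h lam σ r) {s : ℝ} (hs : 0 < s) :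
    ContinuousAt r s := hr.continuousOn.continuousAt (Ici_mem_nhds hs)

theorem continuousAt_jacobian (hr : IsCavitatingSolution d h lam σ r) {s : ℝ} (hs : 0 < s)
    (hsσ : s ≠ σ) : ContinuousAt (jacobian d lam σ r) s :=
  (hr.continuousAt_radialStretch hs hsσ).mul
    (((hr.continuousAt hs).div continuousAt_id hs.ne').pow _)

theorem hasDerivAt_amplitude (hr : IsCavitatingSolution d h lam σ r) {R t : ℝ} (ht : 0 < t)
    (hR : 0 < R) (hRt : R / t ≠ σ) :
    HasDerivAt (fun R => selfSimilarAmplitude lam r R t) (radialStretch lam σ r (R / t)) R := by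
  have h1 := ((hr.hasDerivAt (div_pos hR ht) hRt).comp R ((hasDerivAt_id' R).div_const t)).const_mul
    t
  simp only [selfSimilarAmplitude, if_pos ht]
  refine h1.congr_deriv ?_
  field_simp

theorem hasDerivAt_amplitude_time (hr : IsCavitatingSolution d h lam σ r) {R t : ℝ} (ht : 0 < t)
    (hR : 0 < R) (hRt : R / t ≠ σ) :
    HasDerivAt (fun τ => selfSimilarAmplitude lam r R τ)
      (r (R / t) - R / t * radialStretch lam σ r (R / t)) t := by
  have h0 : HasDerivAt (fun τ => R / τ) (-R / t ^ 2) t := by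
    simpa using (hasDerivAt_const t R).fun_div (hasDerivAt_id' t) ht.ne'
  have h1 := (hasDerivAt_id' t).fun_mul ((hr.hasDerivAt (div_pos hR ht) hRt).comp t h0)
  refine (h1.congr_of_eventuallyEq ?_).congr_deriv ?_
  · filter_upwards [Ioi_mem_nhds ht] with τ hτ
    simp [selfSimilarAmplitude, if_pos (mem_Ioi.1 hτ)]
  · simp; field_simp; ring

theorem gradMatrix_eq (hr : IsCavitatingSolution d h lam σ r) {t : ℝ} (ht : 0 < t) {x : Space d}
    (hx : x ≠ 0) (hxt : ‖x‖ / t ≠ σ) :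
    gradMatrix (radialMotion d (selfSimilarAmplitude lam r) t) x
      = radialMatrix (radialStretch lam σ r (‖x‖ / t)) (r (‖x‖ / t) / (‖x‖ / t)) (normal x) := by
  rw [gradMatrix_radialMotion hx (hr.hasDerivAt_amplitude ht (norm_pos_iff.2 hx) hxt)]
  congr 1
  simp only [selfSimilarAmplitude, if_pos ht]
  field_simp

/-- The traction condition at time `1` is restricted to the points `s • e` of one coordinate ray,
where the normal is `e`; the corresponding component is a function of `s` alone. -/
theorem tendsto_traction (hr : IsCavitatingSolution d h lam σ r) (hd : 1 ≤ d)
    (hh : IsEnergyFunction h) (hlam : 0 < lam) :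
    Tendsto (fun s => radialStretch lam σ r s / (r s / s) ^ (d - 1)
      + deriv h (jacobian d lam σ r s)) (𝓝[>] 0) (𝓝 0) := by
  let i₀ : Fin d := ⟨0, hd⟩
  let e : Space d := EuclideanSpace.single i₀ 1
  have he : ‖e‖ = 1 := by simp [e]
  have hmap : Tendsto (fun s : ℝ => s • e) (𝓝[>] 0) (𝓝[≠] 0) := by
    refine tendsto_nhdsWithin_iff.2 ⟨?_, ?_⟩
    · have : Tendsto (fun s : ℝ => s • e) (𝓝 0) (𝓝 ((0 : ℝ) • e)) :=
        (continuous_id.smul continuous_const).tendsto 0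
      rw [zero_smul] at this
      exact this.mono_left nhdsWithin_le_nhds
    · filter_upwards [self_mem_nhdsWithin] with s hs
      rw [mem_compl_singleton_iff, ← norm_pos_iff, norm_smul, he, mul_one]
      exact norm_pos_iff.2 (ne_of_gt hs)
  have h1 := ((tendsto_pi_nhds.1 (hr.stress_free 1 one_pos)) i₀).comp hmap
  refine h1.congr' ?_
  filter_upwards [Ioo_mem_nhdsGT hr.sigma_pos] with s hs
  have hs0 : ‖s • e‖ = s := by rw [norm_smul, he, mul_one, Real.norm_of_nonneg hs.1.le]
  have hx : s • e ≠ 0 := by rw [← norm_pos_iff, hs0]; exact hs.1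
  have hj := hr.jacobian_pos hlam hs.1
  have hn : (fun i => (s • e) i / ‖s • e‖) = normal (s • e) := rfl
  simp only [Function.comp_apply]
  rw [hn, hr.gradMatrix_eq one_pos hx (by rw [hs0, div_one]; exact hs.2.ne),
    cauchyStress_radialMatrix_mulVec hd (normal_dotProduct_self hx)
      (by rw [hs0, div_one]; exact hr.radialStretch_pos hlam hs.1)
      (by rw [hs0, div_one]; exact div_pos (hr.pos hlam hs.1.le) hs.1)
      (by rw [hs0, div_one]; exact (hh.hasDerivAt hj).differentiableAt)]
  have : normal (s • e) i₀ = 1 := by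
    rw [normal, hs0]
    simp [e, hs.1.ne']
  simp [this, hs0, jacobian]

end IsCavitatingSolution

end Profile

/-! ### A priori bounds for the Jacobian and the radial stretch of the profile. -/

section ProfileBounds

variable {d : ℕ} {h : ℝ → ℝ} {lam σ : ℝ} {r : ℝ → ℝ}

theorem abs_log_le_of_mem_Icc {m M v : ℝ} (hm : 0 < m) (hv : v ∈ Icc m M) :
    |Real.log v| ≤ max |Real.log m| |Real.log M| := by
  have hv0 := hm.trans_le hv.1
  exact abs_le_max_abs_abs (Real.log_le_log hm hv.1) (Real.log_le_log hv0 hv.2)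

namespace IsCavitatingSolution

/-- Near the cavity the traction `r'/(r/s)^(d-1) + h'(v)` is small. Its first term is nonnegative,
so `h'(v)` lies below a positive value of `h'` and `v` is bounded above. Then the first term, which
is `v (s/r)^(2(d-1))`, tends to `0`, so `h'(v)` lies above a negative value of `h'`. -/
theorem eventually_jacobian_mem_Icc (hr : IsCavitatingSolution d h lam σ r) (hd : 2 ≤ d)
    (hh : IsEnergyFunction h) (hlam : 0 < lam) :
    ∃ m M, 0 < m ∧ ∀ᶠ s in 𝓝[>] 0, jacobian d lam σ r s ∈ Icc m M := by
  obtain ⟨M, hM, hM'⟩ := hh.exists_deriv_pos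
  obtain ⟨m, hm, hm'⟩ := hh.exists_deriv_neg
  have hT := hr.tendsto_traction (by lia) hh hlam
  refine ⟨m, M, hm, ?_⟩
  -- Majorant of the elastic term once `v < M` is known; it tends to `0` because `r 0 > 0`.
  have hs0 : Tendsto (fun s : ℝ => M * ((s / r 0) ^ (d - 1)) ^ 2) (𝓝[>] 0) (𝓝 0) := by
    have : Continuous fun s : ℝ => M * ((s / r 0) ^ (d - 1)) ^ 2 := by fun_prop
    have h1 := (this.tendsto 0).mono_left (nhdsWithin_le_nhds (s := Ioi 0))
    simpa [show d - 1 ≠ 0 by lia] using h1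
  filter_upwards [hT.eventually_lt_const hM', hT.eventually_const_lt (show deriv h m / 2 < 0 by linarith),
    hs0.eventually_lt_const (show 0 < -(deriv h m / 2) by linarith), self_mem_nhdsWithin]
    with s h1 h2 h3 hs
  have hs : 0 < s := hs
  have hj := hr.jacobian_pos hlam hs
  have hp := hr.radialStretch_pos hlam hs
  have hr0 := hr.pos hlam hs.le
  have hle := hr.cavity_le hlam hs.le
  have hc := hr.cavity
  have hvM : jacobian d lam σ r s < M := by
    refine (hh.strictMonoOn_deriv.lt_iff_lt hj hM).1 ?_
    have : 0 ≤ radialStretch lam σ r s / (r s / s) ^ (d - 1) := by positivity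
    linarith
  have hrw : radialStretch lam σ r s / (r s / s) ^ (d - 1)
      = jacobian d lam σ r s * ((s / r s) ^ (d - 1)) ^ 2 := by
    rw [jacobian, div_pow, div_pow]
    field_simp
  have hle2 : jacobian d lam σ r s * ((s / r s) ^ (d - 1)) ^ 2
      ≤ M * ((s / r 0) ^ (d - 1)) ^ 2 := by gcongr
  have hmv : m < jacobian d lam σ r s := by
    refine (hh.strictMonoOn_deriv.lt_iff_lt hm hj).1 ?_
    rw [hrw] at h2
    linarith
  exact ⟨hmv.le, hvM.le⟩

theorem tendsto_radialStretch {a : ℝ} (ha : Tendsto (deriv r) (𝓝[<] σ) (𝓝 a)) :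
    Tendsto (radialStretch lam σ r) (𝓝[<] σ) (𝓝 a) := by
  refine ha.congr' ?_
  filter_upwards [self_mem_nhdsWithin] with s hs using (radialStretch_of_lt hs).symm

theorem tendsto_div (hr : IsCavitatingSolution d h lam σ r) :
    Tendsto (fun s => r s / s) (𝓝 σ) (𝓝 lam) := by
  have h1 := ((hr.continuousAt hr.sigma_pos).div₀ (continuousAt_id' σ) hr.sigma_pos.ne').tendsto
  simpa [hr.eq_of_ge le_rfl, hr.sigma_pos.ne'] using h1

theorem tendsto_jacobian (hr : IsCavitatingSolution d h lam σ r) {a : ℝ}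
    (ha : Tendsto (deriv r) (𝓝[<] σ) (𝓝 a)) :
    Tendsto (jacobian d lam σ r) (𝓝[<] σ) (𝓝 (a * lam ^ (d - 1))) :=
  (tendsto_radialStretch ha).mul ((hr.tendsto_div.mono_left nhdsWithin_le_nhds).pow _)

/-- Passing to the logarithm of the Jacobian turns the upper bound and the positive lower bound into
a single bound in absolute value, controlled near `0` by the traction condition and near `σ` by the
limit of `r'`. -/
theorem exists_jacobian_bounds (hr : IsCavitatingSolution d h lam σ r) (hd : 2 ≤ d)
    (hh : IsEnergyFunction h) (hlam : 0 < lam) :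
    ∃ m M, 0 < m ∧ ∀ s, 0 < s → jacobian d lam σ r s ∈ Icc m M := by
  obtain ⟨m, M, hm, hmM⟩ := hr.eventually_jacobian_mem_Icc hd hh hlam
  obtain ⟨a, ha, hlim⟩ := hr.deriv_front
  have hlog := (hr.tendsto_jacobian hlim).log (by positivity)
  obtain ⟨C, hC⟩ := exists_bound_of_continuousOn_Ioo
    (f := fun s => Real.log (jacobian d lam σ r s)) (a := 0) (b := σ)
    (fun s hs => ((hr.continuousAt_jacobian hs.1 hs.2.ne).log
      (hr.jacobian_pos hlam hs.1).ne').continuousWithinAt)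
    ⟨_, hmM.mono fun s hs => abs_log_le_of_mem_Icc hm hs⟩
    ⟨_, hlog.abs.eventually_le_const (lt_add_one _)⟩
  refine ⟨min (Real.exp (-C)) (lam ^ d), max (Real.exp C) (lam ^ d), by positivity,
    fun s hs => ?_⟩
  rcases lt_or_ge s σ with h1 | h1
  · have h2 := abs_le.1 (hC s ⟨hs, h1⟩)
    have hj := hr.jacobian_pos hlam hs
    exact ⟨(min_le_left _ _).trans ((Real.le_log_iff_exp_le hj).1 h2.1),
      ((Real.log_le_iff_le_exp hj).1 h2.2).trans (le_max_left _ _)⟩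
  · rw [hr.jacobian_of_ge (by lia) h1]
    exact ⟨min_le_right _ _, le_max_right _ _⟩

theorem radialStretch_eq_jacobian (hr : IsCavitatingSolution d h lam σ r) (hlam : 0 < lam) {s : ℝ}
    (hs : 0 < s) :
    radialStretch lam σ r s = jacobian d lam σ r s * (s / r s) ^ (d - 1) := by
  have := hr.pos hlam hs.le
  rw [jacobian, div_pow, div_pow]
  field_simp

theorem div_le (hr : IsCavitatingSolution d h lam σ r) (hlam : 0 < lam) {s : ℝ} (hs : 0 < s) :
    s / r s ≤ max (σ / r 0) lam⁻¹ := by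
  have hc := hr.cavity
  have hσ := hr.sigma_pos
  rcases lt_or_ge s σ with h1 | h1
  · refine le_max_of_le_left ?_
    have := hr.cavity_le hlam hs.le
    gcongr
  · refine le_max_of_le_right ?_
    rw [hr.eq_of_ge h1]
    field_simp
    rfl

theorem le_div (hr : IsCavitatingSolution d h lam σ r) (hlam : 0 < lam) {s : ℝ} (hs : 0 < s) :
    min s σ / (lam * σ) ≤ s / r s := by
  have hσ := hr.sigma_pos
  rcases lt_or_ge s σ with h1 | h1
  · rw [min_eq_left h1.le, ← hr.eq_of_ge le_rfl]
    have h2 := hr.pos hlam hs.le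
    have h3 := hr.monotoneOn hlam hs.le hσ.le h1.le
    gcongr
  · rw [min_eq_right h1, hr.eq_of_ge h1]
    apply le_of_eq
    field_simp

/-- Nothing is assumed on `r'` near `0`. The bound comes from `r' = v (s/r)^(d-1)`: the Jacobian `v`
is bounded and, the cavity being open, so is `s/r`. -/
theorem exists_radialStretch_le (hr : IsCavitatingSolution d h lam σ r) (hd : 2 ≤ d)
    (hh : IsEnergyFunction h) (hlam : 0 < lam) :
    ∃ C, 0 < C ∧ ∀ s, 0 < s → radialStretch lam σ r s ≤ C := by
  obtain ⟨m, M, hm, hmM⟩ := hr.exists_jacobian_bounds hd hh hlam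
  have hM : 0 < M := hm.trans_le ((hmM 1 one_pos).1.trans (hmM 1 one_pos).2)
  have hc := hr.cavity
  have hσ := hr.sigma_pos
  refine ⟨M * max (σ / r 0) lam⁻¹ ^ (d - 1), by positivity, fun s hs => ?_⟩
  rw [hr.radialStretch_eq_jacobian hlam hs]
  have h1 := hr.pos hlam hs.le
  have h2 := hr.div_le hlam hs
  have h3 := (hmM s hs).2
  gcongr

/-- The same identity from below, with `r ≤ lam * σ` on the fan. The exponent `d - 1` is what later
compensates the factor `(q/R)^(d-1)` in the mollified Jacobian. -/
theorem exists_le_radialStretch (hr : IsCavitatingSolution d h lam σ r) (hd : 2 ≤ d)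
    (hh : IsEnergyFunction h) (hlam : 0 < lam) :
    ∃ c, 0 < c ∧ ∀ s, 0 < s → c * min s σ ^ (d - 1) ≤ radialStretch lam σ r s := by
  obtain ⟨m, M, hm, hmM⟩ := hr.exists_jacobian_bounds hd hh hlam
  have hσ := hr.sigma_pos
  refine ⟨m * (lam * σ)⁻¹ ^ (d - 1), by positivity, fun s hs => ?_⟩
  rw [hr.radialStretch_eq_jacobian hlam hs, mul_assoc, ← mul_pow, inv_mul_eq_div]
  have h2 := hr.le_div hlam hs
  have h3 := (hmM s hs).1
  have h4 : 0 ≤ min s σ := le_min hs.le hσ.le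
  have h5 := hr.jacobian_pos hlam hs
  gcongr

end IsCavitatingSolution

end ProfileBounds

/-! ### Weak ordinary differential equations -/

section WeakODE

theorem setIntegral_Ioi_eq_intervalIntegral {f : ℝ → ℝ} {a b : ℝ} (hab : a ≤ b)
    (hf : ∀ x, b < x → f x = 0) : ∫ x in Ioi a, f x = ∫ x in a..b, f x := by
  rw [intervalIntegral.integral_of_le hab]
  exact setIntegral_eq_of_subset_of_forall_sdiff_eq_zero measurableSet_Ioi Ioc_subset_Ioi_self
    fun x hx => hf x (not_le.1 fun h => hx.2 ⟨hx.1, h⟩)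

theorem exists_Icc_of_tsupport_subset_Ioi {k : ℝ → ℝ} (hc : HasCompactSupport k)
    (hk : tsupport k ⊆ Ioi 0) :
    ∃ α β, 0 < α ∧ α < β ∧ ∀ x, x ∉ Icc α β → k x = 0 := by
  rcases (tsupport k).eq_empty_or_nonempty with he | hne
  · refine ⟨1, 2, one_pos, one_lt_two, fun x _ => ?_⟩
    exact image_eq_zero_of_notMem_tsupport (by simp [he])
  · obtain ⟨α, hα, hα'⟩ := hc.isCompact.exists_isLeast hne
    obtain ⟨β, hβ, hβ'⟩ := hc.isCompact.exists_isGreatest hne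
    refine ⟨α, β + 1, hk hα, (hα' hβ).trans_lt (lt_add_one β), fun x hx => ?_⟩
    refine image_eq_zero_of_notMem_tsupport fun hmem => hx ⟨hα' hmem, (hβ' hmem).trans ?_⟩
    linarith

theorem hasDerivAt_primitive {B : ℝ → ℝ} {σ : ℝ} (hBc : ∀ s, 0 < s → s ≠ σ → ContinuousAt B s)
    (hBi : ∀ M, 0 ≤ M → IntervalIntegrable B volume 0 M) {s : ℝ} (hs : 0 < s) (hsσ : s ≠ σ) :
    HasDerivAt (fun s => ∫ z in (0 : ℝ)..s, B z) (B s) s := by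
  refine intervalIntegral.integral_hasDerivAt_right (hBi s hs.le) ?_ (hBc s hs hsσ)
  refine ContinuousOn.stronglyMeasurableAtFilter (s := Ioi 0 ∩ {σ}ᶜ)
    (isOpen_Ioi.inter isOpen_compl_singleton)
    (fun z hz => (hBc z hz.1 hz.2).continuousWithinAt) s ⟨hs, hsσ⟩

theorem continuousOn_primitive_Ici {B : ℝ → ℝ}
    (hBi : ∀ M, 0 ≤ M → IntervalIntegrable B volume 0 M) :
    ContinuousOn (fun s => ∫ z in (0 : ℝ)..s, B z) (Ici 0) := by
  intro s hs
  have hs : 0 ≤ s := hs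
  have h1 : ContinuousOn (fun s => ∫ z in (0 : ℝ)..s, B z) (uIcc 0 (s + 1)) :=
    intervalIntegral.continuousOn_primitive_interval
      ((intervalIntegrable_iff' ).1 (hBi (s + 1) (by linarith)))
  rw [uIcc_of_le (by linarith)] at h1
  refine (h1 s ⟨hs, by linarith⟩).mono_of_mem_nhdsWithin ?_
  rw [← Ici_inter_Iic]
  exact inter_mem_nhdsWithin _ (Iic_mem_nhds (by linarith))

theorem contDiff_primitive {m : ℝ → ℝ} (hm : ContDiff ℝ ∞ m) :
    ContDiff ℝ ∞ fun x => ∫ z in (0 : ℝ)..x, m z := by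
  have hd : ∀ x, HasDerivAt (fun x => ∫ z in (0 : ℝ)..x, m z) (m x) x := fun x =>
    hm.continuous.integral_hasStrictDerivAt 0 x |>.hasDerivAt
  rw [contDiff_infty_iff_deriv]
  refine ⟨fun x => (hd x).differentiableAt, ?_⟩
  rwa [show deriv (fun x => ∫ z in (0 : ℝ)..x, m z) = m from funext fun x => (hd x).deriv]

/-- A function whose derivative in the sense of distributions on `(0,∞)` is `B` is a primitive
of `B`. -/
theorem eq_primitive_add_const_of_weak {A B : ℝ → ℝ} {σ : ℝ}
    (hAc : ∀ s, 0 < s → s ≠ σ → ContinuousAt A s) (hBc : ∀ s, 0 < s → s ≠ σ → ContinuousAt B s)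
    (hAi : ∀ M, 0 ≤ M → IntervalIntegrable A volume 0 M)
    (hBi : ∀ M, 0 ≤ M → IntervalIntegrable B volume 0 M)
    (hweak : ∀ k : ℝ → ℝ, ContDiff ℝ ∞ k → HasCompactSupport k → tsupport k ⊆ Ioi 0 →
      ∫ s in Ioi 0, (A s * deriv k s + B s * k s) = 0) :
    ∃ c, ∀ s, 0 < s → s ≠ σ → A s = (∫ z in (0 : ℝ)..s, B z) + c := by
  set P : ℝ → ℝ := fun s => ∫ z in (0 : ℝ)..s, B z with hP
  have hPi : ∀ M, 0 ≤ M → IntervalIntegrable P volume 0 M := fun M hM =>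
    ContinuousOn.intervalIntegrable
      ((continuousOn_primitive_Ici hBi).mono (by rw [uIcc_of_le hM]; exact fun x hx => hx.1))
  have hUi : ∀ M, 0 ≤ M → IntervalIntegrable (fun s => A s - P s) volume 0 M := fun M hM =>
    (hAi M hM).sub (hPi M hM)
  have key : ∀ k : ℝ → ℝ, ContDiff ℝ ∞ k → HasCompactSupport k → tsupport k ⊆ Ioi 0 →
      ∫ s in Ioi 0, (A s - P s) * deriv k s = 0 := by
    intro k hk hc hsupp
    obtain ⟨α, β, hα, hαβ, hz⟩ := exists_Icc_of_tsupport_subset_Ioi hc hsupp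
    have hβ : 0 < β + 1 := by linarith
    have hk0 : ∀ x, β < x → k x = 0 := fun x hx => hz x fun h => hx.not_ge h.2
    have hk0' : ∀ x, β + 1 < x → deriv k x = 0 := by
      intro x hx
      have h1 : k =ᶠ[𝓝 x] fun _ => 0 := by
        filter_upwards [Ioi_mem_nhds (show β < x by linarith)] with z hz using hk0 z hz
      rw [h1.deriv_eq, deriv_const]
    have hkc : Continuous (deriv k) := hk.continuous_deriv (by simp)
    have h1 := hweak k hk hc hsupp
    rw [setIntegral_Ioi_eq_intervalIntegral hβ.le
      fun x hx => by rw [hk0' x hx, hk0 x (by linarith)]; ring] at h1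
    rw [setIntegral_Ioi_eq_intervalIntegral hβ.le fun x hx => by rw [hk0' x hx]; ring]
    have hAk := (hAi _ hβ.le).mul_continuousOn (g := deriv k) hkc.continuousOn
    have hBk := (hBi _ hβ.le).mul_continuousOn (g := k) hk.continuous.continuousOn
    have hPk := (hPi _ hβ.le).mul_continuousOn (g := deriv k) hkc.continuousOn
    -- Integration by parts: `P x * k x` is continuous, differentiable off `σ`, and zero at both
    -- ends.
    have h2 : ∫ x in (0 : ℝ)..(β + 1), (B x * k x + P x * deriv k x) = 0 := by
      rw [integral_eq_of_hasDerivAt_off_countable (fun x => P x * k x) _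
        (countable_singleton σ) _ _ (hBk.add hPk), hk0 (β + 1) (by linarith),
        hz 0 (fun h => hα.not_ge h.1)]
      · simp
      · rw [uIcc_of_le hβ.le]
        exact ((continuousOn_primitive_Ici hBi).mono fun x hx => hx.1).mul hk.continuous.continuousOn
      · rw [min_eq_left hβ.le, max_eq_right hβ.le]
        exact fun x hx => (hasDerivAt_primitive hBc hBi hx.1.1 hx.2).mul
          ((hk.differentiable (by simp)).differentiableAt.hasDerivAt)
    rw [intervalIntegral.integral_add hAk hBk] at h1
    rw [intervalIntegral.integral_add hBk hPk] at h2
    simp_rw [sub_mul]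
    rw [intervalIntegral.integral_sub hAk hPk]
    linarith
  -- A fixed density of unit mass inside `(1,3)`; averaging `A - P` against it identifies the
  -- constant.
  let φ : ContDiffBump (2 : ℝ) := ⟨1 / 2, 1, by norm_num, by norm_num⟩
  set ρ : ℝ → ℝ := φ.normed volume with hρ
  have hρs : ∀ x, x ∉ Icc (1 : ℝ) 3 → ρ x = 0 := by
    intro x hx
    have h1 : x ∉ Function.support ρ := by
      rw [hρ, φ.support_normed_eq, Real.ball_eq_Ioo]
      intro h
      exact hx ⟨by have := h.1; norm_num [φ] at this; linarith,
        by have := h.2; norm_num [φ] at this; linarith⟩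
    simpa using h1
  have hρd : ContDiff ℝ ∞ ρ := φ.contDiff_normed
  refine ⟨∫ s in Ioi 0, (A s - P s) * ρ s, ?_⟩
  set c := ∫ s in Ioi 0, (A s - P s) * ρ s with hc
  have hae : ∀ᵐ s : ℝ, s ∈ Ioi (0 : ℝ) → A s - P s - c = 0 := by
    refine isOpen_Ioi.ae_eq_zero_of_integral_contDiff_smul_eq_zero ?_ ?_
    · refine (locallyIntegrableOn_iff isOpen_Ioi.isLocallyClosed).2 fun K hK hKc => ?_
      obtain ⟨M, hM⟩ := hKc.isBounded.bddAbove
      have h1 : IntervalIntegrable (fun s => A s - P s - c) volume 0 (max M 0) :=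
        (hUi _ (le_max_right _ _)).sub intervalIntegrable_const
      rw [intervalIntegrable_iff_integrableOn_Ioc_of_le (le_max_right _ _)] at h1
      exact h1.mono_set fun x hx => ⟨hK hx, (hM hx).trans (le_max_left _ _)⟩
    · intro η hη hηc hηs
      obtain ⟨α, β, hα, hαβ, hz⟩ := exists_Icc_of_tsupport_subset_Ioi hηc hηs
      set b := ∫ x, η x with hb
      -- Subtracting `b * ρ` makes the mean zero, so the primitive of `m` has compact support in
      -- `(0,∞)` and is an admissible test function in `key`.
      set m : ℝ → ℝ := fun x => η x - b * ρ x with hm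
      have hmd : ContDiff ℝ ∞ m := hη.sub (contDiff_const.mul hρd)
      have hm0 : ∀ x, x ∉ Icc (min α 1) (max β 3) → m x = 0 := by
        intro x hx
        have h1 : x ∉ Icc α β := fun h =>
          hx ⟨(min_le_left _ _).trans h.1, h.2.trans (le_max_left _ _)⟩
        have h2 : x ∉ Icc (1 : ℝ) 3 := fun h =>
          hx ⟨(min_le_right _ _).trans h.1, h.2.trans (le_max_right _ _)⟩
        simp [hm, hz x h1, hρs x h2]
      have hηint : Integrable η := hη.continuous.integrable_of_hasCompactSupport hηc
      have hρint : Integrable ρ := hρd.continuous.integrable_of_hasCompactSupport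
        φ.hasCompactSupport_normed
      have hmint : ∫ x, m x = 0 := by
        rw [hm, integral_sub hηint (hρint.const_mul b), integral_const_mul, hρ, φ.integral_normed]
        simp [hb]
      set k : ℝ → ℝ := fun x => ∫ z in (0 : ℝ)..x, m z with hk
      have hkd : ContDiff ℝ ∞ k := contDiff_primitive hmd
      have hkderiv : deriv k = m := funext fun x =>
        (hmd.continuous.integral_hasStrictDerivAt 0 x).hasDerivAt.deriv
      have hα1 : 0 < min α 1 := lt_min hα one_pos
      have hk0 : ∀ x, x ∉ Icc (min α 1) (max β 3) → k x = 0 := by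
        intro x hx
        rw [mem_Icc, not_and_or, not_le, not_le] at hx
        rcases hx with hx | hx
        · rw [hk]
          refine (intervalIntegral.integral_congr (g := fun _ => (0 : ℝ)) fun z hz => ?_).trans
            (by simp)
          refine hm0 z fun h => ?_
          have := hz.2
          rcases max_choice 0 x with h' | h' <;> rw [h'] at this <;> linarith [h.1]
        · have hx0 : 0 < x := (by norm_num : (0 : ℝ) < 3).trans_le ((le_max_right _ _).trans hx.le)
          refine Eq.trans ?_ hmint
          rw [hk]
          simp only
          rw [intervalIntegral.integral_of_le hx0.le]
          refine setIntegral_eq_integral_of_forall_compl_eq_zero fun z hz => hm0 z fun h => hz ?_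
          exact ⟨hα1.trans_le h.1, h.2.trans hx.le⟩
      have hkt : tsupport k ⊆ Icc (min α 1) (max β 3) :=
        closure_minimal (fun x hx => by_contra fun h => hx (hk0 x h)) isClosed_Icc
      have h1 := key k hkd (HasCompactSupport.of_support_subset_isCompact isCompact_Icc
        ((subset_tsupport k).trans hkt)) (hkt.trans fun x hx => hα1.trans_le hx.1)
      have hM : (0 : ℝ) ≤ max β 3 := le_max_of_le_right (by norm_num)
      have hint : ∀ f : ℝ → ℝ, Continuous f → (∀ x, x ∉ Icc (min α 1) (max β 3) → f x = 0) →
          IntegrableOn (fun s => (A s - P s) * f s) (Ioi 0) := by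
        intro f hf hf0
        have h2 := (hUi _ hM).mul_continuousOn (g := f) hf.continuousOn
        rw [intervalIntegrable_iff_integrableOn_Ioc_of_le hM] at h2
        refine h2.of_forall_sdiff_eq_zero measurableSet_Ioi fun x hx => ?_
        rw [hf0 x fun h => hx.2 ⟨hx.1, h.2⟩, mul_zero]
      have hη0 : ∀ x, x ∉ Icc (min α 1) (max β 3) → η x = 0 := fun x hx => hz x fun h =>
          hx ⟨(min_le_left _ _).trans h.1, h.2.trans (le_max_left _ _)⟩
      have hρ0 : ∀ x, x ∉ Icc (min α 1) (max β 3) → ρ x = 0 := fun x hx => hρs x fun h =>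
          hx ⟨(min_le_right _ _).trans h.1, h.2.trans (le_max_right _ _)⟩
      have hi1 := hint η hη.continuous hη0
      have hi2 := hint ρ hρd.continuous hρ0
      have h3 : ∫ s in Ioi 0, (A s - P s) * η s = b * c := by
        have h4 : ∀ s, (A s - P s) * deriv k s
            = (A s - P s) * η s - b * ((A s - P s) * ρ s) := by
          intro s; rw [hkderiv, hm]; ring
        simp_rw [h4] at h1
        rw [integral_sub hi1 (hi2.const_mul b), integral_const_mul] at h1
        linarith
      have h5 : ∫ x in Ioi 0, η x = b := setIntegral_eq_integral_of_forall_compl_eq_zero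
        fun x hx => hz x fun h => hx (hα.trans_le h.1)
      calc ∫ x, η x • (A x - P x - c) = ∫ x in Ioi 0, η x • (A x - P x - c) := by
            refine (setIntegral_eq_integral_of_forall_compl_eq_zero fun x hx => ?_).symm
            rw [hz x fun h => hx (hα.trans_le h.1), zero_smul]
        _ = ∫ x in Ioi 0, ((A x - P x) * η x - c * η x) := by
            refine integral_congr_ae (Eventually.of_forall fun x => ?_)
            simp only [smul_eq_mul]; ring
        _ = 0 := by
            rw [integral_sub hi1 (hηint.integrableOn.const_mul c), h3, integral_const_mul, h5]
            ring
  have hopen : IsOpen (Ioi (0 : ℝ) ∩ {σ}ᶜ) := isOpen_Ioi.inter isOpen_compl_singleton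
  -- Both sides are continuous off `σ`, so equality almost everywhere becomes equality at every such
  -- point.
  have heq : EqOn (fun s => A s - P s - c) (fun _ => 0) (Ioi (0 : ℝ) ∩ {σ}ᶜ) := by
    refine Measure.eqOn_open_of_ae_eq (μ := volume) ?_ hopen (fun s hs => ?_) continuousOn_const
    · refine (ae_restrict_iff' hopen.measurableSet).2 ?_
      filter_upwards [hae] with s hs hs' using hs hs'.1
    · exact (((hAc s hs.1 hs.2).sub
        (hasDerivAt_primitive hBc hBi hs.1 hs.2).continuousAt).sub
          continuousAt_const).continuousWithinAt
  intro s hs hsσ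
  have := heq ⟨hs, hsσ⟩
  simp only at this
  linarith

end WeakODE

/-! ### Functions that are regular up to the front -/

section Tame

/-- Locally bounded functions on `[0,∞)` that are continuous on `(0,∞)` except at `σ`. -/
structure IsTame (σ : ℝ) (f : ℝ → ℝ) : Prop where
  continuousAt : ∀ s, 0 < s → s ≠ σ → ContinuousAt f s
  bounded : ∀ M : ℝ, ∃ C, ∀ s ∈ Ioc 0 M, |f s| ≤ C

namespace IsTame

variable {σ : ℝ} {f g : ℝ → ℝ}

theorem of_continuous (hf : Continuous f) : IsTame σ f :=
  ⟨fun _ _ _ => hf.continuousAt, fun M =>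
    let ⟨C, hC⟩ := (isCompact_Icc (a := 0) (b := M)).exists_bound_of_continuousOn hf.continuousOn
    ⟨C, fun s hs => hC s ⟨hs.1.le, hs.2⟩⟩⟩

theorem add (hf : IsTame σ f) (hg : IsTame σ g) : IsTame σ fun s => f s + g s :=
  ⟨fun s h1 h2 => (hf.continuousAt s h1 h2).add (hg.continuousAt s h1 h2), fun M =>
    let ⟨C, hC⟩ := hf.bounded M
    let ⟨D, hD⟩ := hg.bounded M
    ⟨C + D, fun s hs => (abs_add_le _ _).trans (add_le_add (hC s hs) (hD s hs))⟩⟩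

theorem mul (hf : IsTame σ f) (hg : IsTame σ g) : IsTame σ fun s => f s * g s :=
  ⟨fun s h1 h2 => (hf.continuousAt s h1 h2).mul (hg.continuousAt s h1 h2), fun M =>
    let ⟨C, hC⟩ := hf.bounded M
    let ⟨D, hD⟩ := hg.bounded M
    ⟨C * D, fun s hs => by
      rw [abs_mul]
      exact mul_le_mul (hC s hs) (hD s hs) (abs_nonneg _) ((abs_nonneg _).trans (hC s hs))⟩⟩

theorem const_mul (c : ℝ) (hf : IsTame σ f) : IsTame σ fun s => c * f s :=
  (of_continuous continuous_const).mul hf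

theorem sub (hf : IsTame σ f) (hg : IsTame σ g) : IsTame σ fun s => f s - g s := by
  simpa [sub_eq_add_neg] using hf.add (hg.const_mul (-1))

theorem pow (hf : IsTame σ f) (n : ℕ) : IsTame σ fun s => f s ^ n := by
  induction n with
  | zero => simpa using of_continuous (continuous_const (y := (1 : ℝ)))
  | succ n ih => simpa [pow_succ] using ih.mul hf

theorem integrableOn (hf : IsTame σ f) (M : ℝ) : IntegrableOn f (Ioc 0 M) := by
  obtain ⟨C, hC⟩ := hf.bounded M
  have h1 : (Ioc 0 M ∩ {σ}ᶜ : Set ℝ) =ᵐ[volume] Ioc 0 M :=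
    inter_ae_eq_left_of_ae_eq_univ (by simp)
  rw [← integrableOn_congr_set_ae h1]
  have hfin : volume (Ioc 0 M ∩ {σ}ᶜ : Set ℝ) < ⊤ :=
    (measure_mono inter_subset_left).trans_lt measure_Ioc_lt_top
  have hms : MeasurableSet (Ioc 0 M ∩ {σ}ᶜ : Set ℝ) :=
    measurableSet_Ioc.inter (measurableSet_singleton σ).compl
  refine IntegrableOn.of_bound hfin (ContinuousOn.aestronglyMeasurable (fun s hs =>
    (hf.continuousAt s hs.1.1 hs.2).continuousWithinAt) hms) C ?_
  exact (ae_restrict_iff' hms).2 (Eventually.of_forall fun s hs => hC s hs.1)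

theorem intervalIntegrable (hf : IsTame σ f) {M : ℝ} (hM : 0 ≤ M) :
    IntervalIntegrable f volume 0 M :=
  (intervalIntegrable_iff_integrableOn_Ioc_of_le hM).2 (hf.integrableOn M)

theorem integrableOn_Ioi_mul (hf : IsTame σ f) {k : ℝ → ℝ} (hk : Continuous k)
    (hc : HasCompactSupport k) : IntegrableOn (fun s => f s * k s) (Ioi 0) := by
  obtain ⟨M, hM⟩ := hc.isCompact.isBounded.bddAbove
  refine ((hf.mul (of_continuous hk)).integrableOn M).of_forall_sdiff_eq_zero measurableSet_Ioi
    fun x hx => ?_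
  rw [image_eq_zero_of_notMem_tsupport fun h => hx.2 ⟨hx.1, hM h⟩, mul_zero]

end IsTame

end Tame

/-! ### The balance law in the similarity variable -/

section Balance

/-- The velocity `w_t = r - s r'` in the similarity variable `s = R/t`. -/
def radialVelocity (lam σ : ℝ) (r : ℝ → ℝ) (s : ℝ) : ℝ := r s - s * radialStretch lam σ r s

/-- The radial Piola–Kirchhoff stress, multiplied by `s^(d-1)`. -/
def radialTraction (d : ℕ) (h : ℝ → ℝ) (lam σ : ℝ) (r : ℝ → ℝ) (s : ℝ) : ℝ :=
  s ^ (d - 1) * radialStretch lam σ r s + deriv h (jacobian d lam σ r s) * r s ^ (d - 1)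

/-- The tangential Piola–Kirchhoff stress, multiplied by `s^(d-2)`. -/
def hoopTraction (d : ℕ) (h : ℝ → ℝ) (lam σ : ℝ) (r : ℝ → ℝ) (s : ℝ) : ℝ :=
  s ^ (d - 3) * r s
    + deriv h (jacobian d lam σ r s) * (radialStretch lam σ r s * r s ^ (d - 2))

/-- The flux in the self-similar balance of momentum. -/
def momentumFlux (d : ℕ) (h : ℝ → ℝ) (lam σ : ℝ) (r : ℝ → ℝ) (s : ℝ) : ℝ :=
  s ^ d * radialVelocity lam σ r s + radialTraction d h lam σ r s

/-- The source in the self-similar balance of momentum. -/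
def momentumSource (d : ℕ) (h : ℝ → ℝ) (lam σ : ℝ) (r : ℝ → ℝ) (s : ℝ) : ℝ :=
  d * (s ^ (d - 1) * radialVelocity lam σ r s) + (d - 1) * hoopTraction d h lam σ r s

variable {d : ℕ} {h : ℝ → ℝ} {lam σ : ℝ} {r : ℝ → ℝ}

namespace IsCavitatingSolution

theorem isTame_radialStretch (hr : IsCavitatingSolution d h lam σ r) (hd : 2 ≤ d)
    (hh : IsEnergyFunction h) (hlam : 0 < lam) : IsTame σ (radialStretch lam σ r) :=
  ⟨fun _ h1 h2 => hr.continuousAt_radialStretch h1 h2, fun M =>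
    let ⟨C, _, hC⟩ := hr.exists_radialStretch_le hd hh hlam
    ⟨C, fun s hs => by
      rw [abs_of_pos (hr.radialStretch_pos hlam hs.1)]
      exact hC s hs.1⟩⟩

theorem isTame_profile (hr : IsCavitatingSolution d h lam σ r) : IsTame σ r :=
  ⟨fun _ h1 _ => hr.continuousAt h1, fun M =>
    let ⟨C, hC⟩ := (isCompact_Icc (a := 0) (b := M)).exists_bound_of_continuousOn
      (hr.continuousOn.mono fun _ hx => hx.1)
    ⟨C, fun s hs => hC s ⟨hs.1.le, hs.2⟩⟩⟩

theorem isTame_comp_jacobian (hr : IsCavitatingSolution d h lam σ r) (hd : 2 ≤ d)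
    (hh : IsEnergyFunction h) (hlam : 0 < lam) {f : ℝ → ℝ} (hf : ContinuousOn f (Ioi 0)) :
    IsTame σ fun s => f (jacobian d lam σ r s) :=
  ⟨fun _ h1 h2 => ContinuousAt.comp (g := f)
      (hf.continuousAt (Ioi_mem_nhds (hr.jacobian_pos hlam h1)))
      (hr.continuousAt_jacobian h1 h2), fun _ =>
    let ⟨m, M, hm, hmM⟩ := hr.exists_jacobian_bounds hd hh hlam
    let ⟨C, hC⟩ := (isCompact_Icc (a := m) (b := M)).exists_bound_of_continuousOn
      (hf.mono fun _ hx => hm.trans_le hx.1)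
    ⟨C, fun s hs => hC _ (hmM s hs.1)⟩⟩

theorem isTame_radialVelocity (hr : IsCavitatingSolution d h lam σ r) (hd : 2 ≤ d)
    (hh : IsEnergyFunction h) (hlam : 0 < lam) : IsTame σ (radialVelocity lam σ r) :=
  hr.isTame_profile.sub ((IsTame.of_continuous continuous_id').mul
    (hr.isTame_radialStretch hd hh hlam))

theorem isTame_radialTraction (hr : IsCavitatingSolution d h lam σ r) (hd : 2 ≤ d)
    (hh : IsEnergyFunction h) (hlam : 0 < lam) : IsTame σ (radialTraction d h lam σ r) :=
  ((IsTame.of_continuous (continuous_pow _)).mul (hr.isTame_radialStretch hd hh hlam)).add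
    ((hr.isTame_comp_jacobian hd hh hlam hh.continuousOn_deriv).mul (hr.isTame_profile.pow _))

theorem isTame_hoopTraction (hr : IsCavitatingSolution d h lam σ r) (hd : 2 ≤ d)
    (hh : IsEnergyFunction h) (hlam : 0 < lam) : IsTame σ (hoopTraction d h lam σ r) :=
  ((IsTame.of_continuous (continuous_pow _)).mul hr.isTame_profile).add
    ((hr.isTame_comp_jacobian hd hh hlam hh.continuousOn_deriv).mul
      ((hr.isTame_radialStretch hd hh hlam).mul (hr.isTame_profile.pow _)))

theorem isTame_momentumFlux (hr : IsCavitatingSolution d h lam σ r) (hd : 2 ≤ d)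
    (hh : IsEnergyFunction h) (hlam : 0 < lam) : IsTame σ (momentumFlux d h lam σ r) :=
  ((IsTame.of_continuous (continuous_pow _)).mul (hr.isTame_radialVelocity hd hh hlam)).add
    (hr.isTame_radialTraction hd hh hlam)

theorem isTame_momentumSource (hr : IsCavitatingSolution d h lam σ r) (hd : 2 ≤ d)
    (hh : IsEnergyFunction h) (hlam : 0 < lam) : IsTame σ (momentumSource d h lam σ r) :=
  (((IsTame.of_continuous (continuous_pow _)).mul
    (hr.isTame_radialVelocity hd hh hlam)).const_mul _).add
      ((hr.isTame_hoopTraction hd hh hlam).const_mul _)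

end IsCavitatingSolution

/-- The self-similar radial test function `θ(t) κ(|x|/t) x`. -/
def selfSimilarTest (d : ℕ) (θ κ : ℝ → ℝ) (p : ℝ × Space d) : Space d :=
  (θ p.1 * κ (‖p.2‖ / p.1)) • p.2

/-- The quotient `|x|/t` is singular at `t = 0` and the norm at `x = 0`; near the former `θ`
vanishes, and near the latter, at positive times, `κ` does. -/
theorem contDiff_selfSimilarTest {θ κ : ℝ → ℝ} {a α : ℝ} (ha : 0 < a) (hα : 0 < α)
    (hθ : ContDiff ℝ ∞ θ) (hκ : ContDiff ℝ ∞ κ) (hθ0 : ∀ τ, τ < a → θ τ = 0)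
    (hκ0 : ∀ s, s < α → κ s = 0) : ContDiff ℝ ∞ (selfSimilarTest d θ κ) := by
  rw [contDiff_iff_contDiffAt]
  rintro ⟨τ, x⟩
  rcases lt_or_ge τ a with hτ | hτ
  · refine (contDiffAt_const (c := (0 : Space d))).congr_of_eventuallyEq ?_
    filter_upwards [(continuous_fst.isOpen_preimage _ isOpen_Iio).mem_nhds
      (show (τ, x) ∈ Prod.fst ⁻¹' Iio a from hτ)] with p hp
    rw [selfSimilarTest, hθ0 _ hp, zero_mul, zero_smul]
  have hτ0 : 0 < τ := ha.trans_le hτ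
  by_cases hx : x = 0
  · refine (contDiffAt_const (c := (0 : Space d))).congr_of_eventuallyEq ?_
    have hc : ContinuousAt (fun p : ℝ × Space d => ‖p.2‖ / p.1) (τ, x) :=
      (continuous_snd.norm.continuousAt).div₀ continuous_fst.continuousAt hτ0.ne'
    filter_upwards [hc.eventually_lt_const (show ‖(τ, x).2‖ / (τ, x).1 < α by simpa [hx] using hα)]
      with p hp
    rw [selfSimilarTest, hκ0 _ hp, mul_zero, zero_smul]
  · refine ((hθ.contDiffAt.comp (τ, x) contDiffAt_fst).mul ?_).smul contDiffAt_snd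
    exact hκ.contDiffAt.comp (τ, x) ((contDiffAt_snd.norm ℝ hx).div contDiffAt_fst hτ0.ne')

theorem hasCompactSupport_selfSimilarTest {θ κ : ℝ → ℝ} {a b β : ℝ} (ha : 0 < a) (hβ : 0 ≤ β)
    (hθ0 : ∀ τ, τ ∉ Icc a b → θ τ = 0) (hκ0 : ∀ s, β < s → κ s = 0) :
    HasCompactSupport (selfSimilarTest d θ κ) := by
  refine HasCompactSupport.of_support_subset_isCompact
    (isCompact_Icc (a := a) (b := b) |>.prod (isCompact_closedBall (0 : Space d) (β * b))) ?_
  intro p hp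
  have h1 : p.1 ∈ Icc a b := by
    by_contra h
    exact hp (by rw [selfSimilarTest, hθ0 _ h, zero_mul, zero_smul])
  have h2 : ‖p.2‖ / p.1 ≤ β := by
    by_contra! h
    exact hp (by rw [selfSimilarTest, hκ0 _ h, mul_zero, zero_smul])
  refine ⟨h1, ?_⟩
  rw [mem_closedBall_zero_iff]
  exact ((div_le_iff₀ (ha.trans_le h1.1)).1 h2).trans (mul_le_mul_of_nonneg_left h1.2 hβ)

/-- The time derivative and the gradient of `κ(|x|/t)` are `1/t` times functions of `s`, up to the
direction, and the gradients of the solution depend on `s` only. The integrand therefore separates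
into functions of time times functions of `s`. -/
theorem IsCavitatingSolution.weakIntegrand_eq (hr : IsCavitatingSolution d h lam σ r) (hd : 2 ≤ d)
    (hh : IsEnergyFunction h) (hlam : 0 < lam) {θ κ : ℝ → ℝ} (hθ : Differentiable ℝ θ)
    (hκ : Differentiable ℝ κ) {τ : ℝ} (hτ : 0 < τ) {x : Space d} (hx : x ≠ 0) {s : ℝ}
    (hs : ‖x‖ / τ = s) (hsσ : s ≠ σ) :
    weakIntegrand h (radialMotion d (selfSimilarAmplitude lam r)) (selfSimilarTest d θ κ) (τ, x)
      = τ * deriv θ τ * (radialVelocity lam σ r s * (s * κ s))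
        - θ τ * (radialVelocity lam σ r s * (s ^ 2 * deriv κ s)
          + ((radialStretch lam σ r s + deriv h (jacobian d lam σ r s) * (r s / s) ^ (d - 1))
              * (κ s + s * deriv κ s)
            + (d - 1) * ((r s / s + deriv h (jacobian d lam σ r s)
              * (radialStretch lam σ r s * (r s / s) ^ (d - 2))) * κ s))) := by
  have hR : 0 < ‖x‖ := norm_pos_iff.2 hx
  have hs0 : 0 < s := hs ▸ div_pos hR hτ
  have hRs : ‖x‖ = τ * s := by rw [← hs]; field_simp
  have h1 : HasDerivAt (fun τ => radialMotion d (selfSimilarAmplitude lam r) τ x)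
      ((radialVelocity lam σ r s / ‖x‖) • x) τ := by
    have := hasDerivAt_radialMotion (d := d) (hr.hasDerivAt_amplitude_time hτ hR (hs ▸ hsσ))
    rwa [hs] at this
  have h0 : HasDerivAt (fun τ => ‖x‖ / τ) (-‖x‖ / τ ^ 2) τ := by
    simpa using (hasDerivAt_const τ ‖x‖).fun_div (hasDerivAt_id' τ) hτ.ne'
  have hκs : HasDerivAt κ (deriv κ s) (‖x‖ / τ) := hs ▸ (hκ _).hasDerivAt
  have h2 : HasDerivAt (fun τ => selfSimilarTest d θ κ (τ, x))
      ((deriv θ τ * κ s + θ τ * (deriv κ s * (-‖x‖ / τ ^ 2))) • x) τ := by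
    have := (((hθ τ).hasDerivAt).fun_mul (hκs.comp τ h0)).smul_const x
    simp only [Function.comp_apply, hs] at this
    exact this
  have h3 : gradMatrix (fun z => selfSimilarTest d θ κ (τ, z)) x
      = radialMatrix (θ τ * (κ s + s * deriv κ s)) (θ τ * κ s) (normal x) := by
    have h4 : HasDerivAt (fun R => θ τ * κ (R / τ)) (θ τ * (deriv κ s * (1 / τ))) ‖x‖ :=
      (hκs.comp ‖x‖ ((hasDerivAt_id' ‖x‖).div_const τ)).const_mul _
    have h5 := gradMatrix_norm_smul hx h4
    simp only [hs] at h5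
    refine h5.trans ?_
    congr 1
    rw [hRs]; field_simp
  have hj := hr.jacobian_pos hlam hs0
  rw [weakIntegrand]
  simp only
  rw [h1.deriv, h2.deriv, hr.gradMatrix_eq hτ hx (hs ▸ hsσ), h3, hs,
    piolaStress_radialMatrix hd (normal_dotProduct_self hx) (hr.radialStretch_pos hlam hs0)
      (div_pos (hr.pos hlam hs0.le) hs0) (hh.hasDerivAt hj).differentiableAt,
    frobeniusProduct_radialMatrix (normal_dotProduct_self hx), real_inner_smul_left,
    real_inner_smul_right, real_inner_self_eq_norm_sq, ← jacobian, hRs]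
  field_simp
  ring

end Balance

/-! ### The self-similar balance of momentum and its consequences at the front. -/

section BalanceLaw

variable {d : ℕ} {h : ℝ → ℝ} {lam σ : ℝ} {r : ℝ → ℝ}

/-- Integration by parts in time. With `n = d` it converts the `θ'` term of the weak form into a
multiple of the `θ` term, so that the time integral can be divided out. -/
theorem integral_mul_pow_deriv {θ : ℝ → ℝ} (n : ℕ) (hθ : ContDiff ℝ ∞ θ) {a b : ℝ} (ha : 0 < a)
    (hab : a < b) (hθ0 : ∀ τ, τ ∉ Icc a b → θ τ = 0) :
    ∫ τ in Ioi 0, τ ^ (n + 1) * deriv θ τ = -((n + 1) * ∫ τ in Ioi 0, τ ^ n * θ τ) := by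
  have hb : 0 < b + 1 := by linarith
  have hθb : ∀ x, b < x → θ x = 0 := fun x hx => hθ0 x fun h => hx.not_ge h.2
  have hc' : Continuous (deriv θ) := hθ.continuous_deriv (by simp)
  have hc := hθ.continuous
  have hθb' : ∀ x, b + 1 < x → deriv θ x = 0 := by
    intro x hx
    have h1 : θ =ᶠ[𝓝 x] fun _ => 0 := by
      filter_upwards [Ioi_mem_nhds (show b < x by linarith)] with z hz using hθb z hz
    rw [h1.deriv_eq, deriv_const]
  rw [setIntegral_Ioi_eq_intervalIntegral hb.le fun x hx => by rw [hθb' x hx, mul_zero],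
    setIntegral_Ioi_eq_intervalIntegral hb.le fun x hx => by
      rw [hθb x (by linarith), mul_zero]]
  have h1 : ∫ τ in (0 : ℝ)..(b + 1), ((n + 1) * (τ ^ n * θ τ) + τ ^ (n + 1) * deriv θ τ) = 0 := by
    rw [intervalIntegral.integral_eq_sub_of_hasDerivAt (f := fun τ => τ ^ (n + 1) * θ τ)]
    · rw [hθb (b + 1) (by linarith), hθ0 0 fun h => ha.not_ge h.1]; simp
    · intro τ _
      have := (hasDerivAt_pow (n + 1) τ).fun_mul
        ((hθ.differentiable (by simp)).differentiableAt.hasDerivAt (x := τ))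
      refine this.congr_deriv ?_
      simp only [Nat.add_sub_cancel]; push_cast; ring
    · exact Continuous.intervalIntegrable (by fun_prop) _ _
  rw [intervalIntegral.integral_add (Continuous.intervalIntegrable (by fun_prop) _ _)
    (Continuous.intervalIntegrable (by fun_prop) _ _), intervalIntegral.integral_const_mul] at h1
  linarith

/-- The balance of momentum in the similarity variable, in the sense of distributions. -/
theorem IsCavitatingSolution.weak_balance (hr : IsCavitatingSolution d h lam σ r) (hd : 3 ≤ d)
    (hh : IsEnergyFunction h) (hlam : 0 < lam) {k : ℝ → ℝ} (hk : ContDiff ℝ ∞ k)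
    (hkc : HasCompactSupport k) (hks : tsupport k ⊆ Ioi 0) :
    ∫ s in Ioi 0, (momentumFlux d h lam σ r s * deriv k s + momentumSource d h lam σ r s * k s)
      = 0 := by
  have hd2 : 2 ≤ d := by lia
  have : Nonempty (Fin d) := ⟨⟨0, by lia⟩⟩
  obtain ⟨α, β, hα, hαβ, hz⟩ := exists_Icc_of_tsupport_subset_Ioi hkc hks
  -- The field `κ(|x|/t) x` has amplitude `t * (s * κ s) = t * k s`, so `k` is the one-dimensional
  -- test function.
  set κ : ℝ → ℝ := fun s => k s / s with hκ
  have hkκ : ∀ s, k s = s * κ s := by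
    intro s
    by_cases hs : s = 0
    · rw [hs, zero_mul, hz 0 fun h => hα.not_ge h.1]
    · simp only [hκ]; field_simp
  have hκ0 : ∀ s, s ∉ Icc α β → κ s = 0 := fun s hs => by simp [hκ, hz s hs]
  have hκd : ContDiff ℝ ∞ κ := by
    rw [contDiff_iff_contDiffAt]
    intro s
    rcases lt_or_ge s α with hs | hs
    · refine (contDiffAt_const (c := (0 : ℝ))).congr_of_eventuallyEq ?_
      filter_upwards [Iio_mem_nhds hs] with z hz' using hκ0 z fun h => (mem_Iio.1 hz').not_ge h.1
    · exact hk.contDiffAt.div contDiffAt_id (hα.trans_le hs).ne'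
  have hκc : HasCompactSupport κ := HasCompactSupport.of_support_subset_isCompact
    (isCompact_Icc (a := α) (b := β)) fun s hs => by_contra fun h => hs (hκ0 s h)
  have hkd : ∀ s, deriv k s = κ s + s * deriv κ s := by
    intro s
    have h1 : HasDerivAt (fun s => s * κ s) (1 * κ s + s * deriv κ s) s :=
      (hasDerivAt_id' s).fun_mul (hκd.differentiable (by simp)).differentiableAt.hasDerivAt
    rw [show k = fun s => s * κ s from funext hkκ, h1.deriv, one_mul]
  let φ : ContDiffBump (2 : ℝ) := ⟨1 / 2, 1, by norm_num, by norm_num⟩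
  set θ : ℝ → ℝ := ⇑φ with hθ
  have hθd : ContDiff ℝ ∞ θ := φ.contDiff
  have hθ0 : ∀ τ, τ ∉ Icc (1 : ℝ) 3 → θ τ = 0 := by
    intro τ hτ
    have h1 : τ ∉ Function.support θ := by
      rw [hθ, φ.support_eq, Real.ball_eq_Ioo]
      intro h
      exact hτ ⟨by have := h.1; norm_num [φ] at this; linarith,
        by have := h.2; norm_num [φ] at this; linarith⟩
    simpa using h1
  set u := radialVelocity lam σ r with hu
  set F₁ : ℝ → ℝ := fun s => u s * (s * κ s) with hF₁
  set F₂ : ℝ → ℝ := fun s => u s * (s ^ 2 * deriv κ s)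
    + ((radialStretch lam σ r s + deriv h (jacobian d lam σ r s) * (r s / s) ^ (d - 1))
        * (κ s + s * deriv κ s)
      + (d - 1) * ((r s / s + deriv h (jacobian d lam σ r s)
          * (radialStretch lam σ r s * (r s / s) ^ (d - 2))) * κ s)) with hF₂
  have e₁ : ∀ s, s ^ (d - 1) * F₁ s = s ^ (d - 1) * u s * k s := fun s => by
    rw [hkκ s, hF₁]; ring
  -- The polar weight `s^(d-1)` removes all negative powers of `s`; the worst one, in the tangential
  -- stress, leaves `s^(d-3)`.
  have e₂ : ∀ s, 0 < s → s ^ (d - 1) * F₂ s = momentumFlux d h lam σ r s * deriv k s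
      - s ^ d * u s * κ s + (d - 1) * hoopTraction d h lam σ r s * k s := by
    intro s hs
    rw [hkd, hkκ s, momentumFlux, radialTraction, hoopTraction, hF₂]
    obtain ⟨e, rfl⟩ := Nat.exists_eq_add_of_le' hd
    simp only [show e + 3 - 1 = e + 2 by lia, show e + 3 - 2 = e + 1 by lia, Nat.add_sub_cancel,
      div_pow]
    field_simp
    ring
  have htu := hr.isTame_radialVelocity hd2 hh hlam
  have htA := hr.isTame_momentumFlux hd2 hh hlam
  have i₁ : IntegrableOn (fun s => s ^ (d - 1) * u s * k s) (Ioi 0) :=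
    ((IsTame.of_continuous (continuous_pow _)).mul htu).integrableOn_Ioi_mul hk.continuous hkc
  have i₁' : IntegrableOn (fun s => s ^ d * u s * κ s) (Ioi 0) :=
    ((IsTame.of_continuous (continuous_pow _)).mul htu).integrableOn_Ioi_mul hκd.continuous hκc
  have i₂ : IntegrableOn (fun s => momentumFlux d h lam σ r s * deriv k s) (Ioi 0) :=
    htA.integrableOn_Ioi_mul (hk.continuous_deriv (by simp)) hkc.deriv
  have i₃ : IntegrableOn (fun s => (d - 1) * hoopTraction d h lam σ r s * k s) (Ioi 0) :=
    ((hr.isTame_hoopTraction hd2 hh hlam).const_mul _).integrableOn_Ioi_mul hk.continuous hkc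
  have I₁ : IntegrableOn (fun s => s ^ (d - 1) * F₁ s) (Ioi 0) := by simpa only [e₁] using i₁
  have I₂ : IntegrableOn (fun s => s ^ (d - 1) * F₂ s) (Ioi 0) :=
    ((i₂.sub i₁').add i₃).congr_fun (fun s hs => (e₂ s hs).symm) measurableSet_Ioi
  have hfin : Module.finrank ℝ (Space d) = d := finrank_euclideanSpace_fin
  have N₁ : Integrable fun x : Space d => F₁ ‖x‖ := by
    refine (integrable_fun_norm_addHaar volume).2 ?_
    simpa only [hfin, smul_eq_mul] using I₁
  have N₂ : Integrable fun x : Space d => F₂ ‖x‖ := by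
    refine (integrable_fun_norm_addHaar volume).2 ?_
    simpa only [hfin, smul_eq_mul] using I₂
  -- The substitution `x = τ z` contributes `τ^d` and separates the two variables. The origin and
  -- the front sphere are null sets.
  have hinner : ∀ τ, 0 < τ → ∫ x, weakIntegrand h (radialMotion d (selfSimilarAmplitude lam r))
      (selfSimilarTest d θ κ) (τ, x) = τ ^ (d + 1) * deriv θ τ * (∫ x : Space d, F₁ ‖x‖)
        - τ ^ d * θ τ * ∫ x : Space d, F₂ ‖x‖ := by
    intro τ hτ
    have hae : (fun x => weakIntegrand h (radialMotion d (selfSimilarAmplitude lam r))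
        (selfSimilarTest d θ κ) (τ, x)) =ᵐ[volume] fun x : Space d =>
          (fun z : Space d => τ * deriv θ τ * F₁ ‖z‖ - θ τ * F₂ ‖z‖) (τ⁻¹ • x) := by
      have n1 : ∀ᵐ x : Space d, x ≠ 0 := by
        simp [ae_iff, measure_singleton]
      have n2 : ∀ᵐ x : Space d, ‖x‖ ≠ σ * τ := by
        rw [ae_iff]
        have := Measure.addHaar_sphere (volume : Measure (Space d)) 0 (σ * τ)
        convert this using 2
        ext x; simp
      filter_upwards [n1, n2] with x hx hx'
      have hs : ‖τ⁻¹ • x‖ = ‖x‖ / τ := by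
        rw [norm_smul, Real.norm_of_nonneg (inv_nonneg.2 hτ.le), inv_mul_eq_div]
      rw [hr.weakIntegrand_eq hd2 hh hlam (hθd.differentiable (by simp))
        (hκd.differentiable (by simp)) hτ hx hs.symm fun h => hx' ?_]
      rw [← h, hs]; field_simp
    refine (integral_congr_ae hae).trans ((Measure.integral_comp_inv_smul_of_nonneg volume
      (fun z : Space d => τ * deriv θ τ * F₁ ‖z‖ - θ τ * F₂ ‖z‖) hτ.le).trans ?_)
    rw [hfin, integral_sub (N₁.const_mul _) (N₂.const_mul _), integral_const_mul, integral_const_mul,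
      smul_eq_mul]
    ring
  obtain ⟨w₁, w₂⟩ := hr.weak_solution (selfSimilarTest d θ κ)
    (contDiff_selfSimilarTest one_pos hα hθd hκd (fun τ hτ => hθ0 τ fun h => hτ.not_ge h.1)
      fun s hs => hκ0 s fun h => hs.not_ge h.1)
    (hasCompactSupport_selfSimilarTest one_pos (hα.trans hαβ).le hθ0
      fun s hs => hκ0 s fun h => hs.not_ge h.2)
  rw [Measure.volume_eq_prod, setIntegral_prod _ w₁, setIntegral_congr_fun measurableSet_Ioi
    fun τ hτ => by rw [Measure.restrict_univ, hinner τ hτ]] at w₂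
  have hθc : HasCompactSupport θ := φ.hasCompactSupport
  have j₁ : IntegrableOn (fun τ => τ ^ (d + 1) * deriv θ τ) (Ioi 0) :=
    (IsTame.of_continuous (σ := 0) (continuous_pow _)).integrableOn_Ioi_mul
      (hθd.continuous_deriv (by simp)) hθc.deriv
  have j₂ : IntegrableOn (fun τ => τ ^ d * θ τ) (Ioi 0) :=
    (IsTame.of_continuous (σ := 0) (continuous_pow _)).integrableOn_Ioi_mul
      hθd.continuous hθc
  rw [integral_sub (j₁.mul_const _) (j₂.mul_const _), integral_mul_const, integral_mul_const,
    integral_mul_pow_deriv d hθd one_pos (by norm_num) hθ0] at w₂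
  have hpos : 0 < ∫ τ in Ioi 0, τ ^ d * θ τ := by
    rw [setIntegral_pos_iff_support_of_nonneg_ae _ j₂]
    · have hsub : Ioo (3 / 2 : ℝ) (5 / 2) ⊆ Function.support (fun τ => τ ^ d * θ τ) ∩ Ioi 0 := by
        intro τ hτ
        have h0 : 0 < τ := by linarith [hτ.1]
        have h1 : τ ∈ Function.support θ := by
          rw [hθ, φ.support_eq, Real.ball_eq_Ioo]
          constructor <;> norm_num [φ] <;> linarith [hτ.1, hτ.2]
        exact ⟨mul_ne_zero (pow_ne_zero _ h0.ne') h1, h0⟩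
      refine lt_of_lt_of_le ?_ (measure_mono hsub)
      rw [Real.volume_Ioo]
      norm_num
    · refine (ae_restrict_iff' measurableSet_Ioi).2 (Eventually.of_forall fun τ hτ => ?_)
      exact mul_nonneg (pow_nonneg (le_of_lt hτ) _) φ.nonneg
  -- The common time factor is positive and cancels. The coefficient `d + 1` becomes the `d` of the
  -- source, because the flux includes `s^d u` and `s^d u κ = s^(d-1) u k` is subtracted once in
  -- `e₂`.
  have hJ : (d + 1) * (∫ x : Space d, F₁ ‖x‖) + ∫ x : Space d, F₂ ‖x‖ = 0 := by
    refine (mul_eq_zero_iff_left hpos.ne').1 ?_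
    linarith
  rw [integral_fun_norm_addHaar, integral_fun_norm_addHaar, hfin] at hJ
  simp only [smul_eq_mul, nsmul_eq_mul] at hJ
  have hv : 0 < d * (volume : Measure (Space d)).real (Metric.ball 0 1) := by
    have : 0 < (volume : Measure (Space d)).real (Metric.ball 0 1) :=
      ENNReal.toReal_pos (Metric.measure_ball_pos _ _ one_pos).ne' measure_ball_lt_top.ne
    have : (0 : ℝ) < d := by exact_mod_cast (show 0 < d by lia)
    positivity
  have hJ' : (d + 1) * (∫ s in Ioi 0, s ^ (d - 1) * F₁ s) + ∫ s in Ioi 0, s ^ (d - 1) * F₂ s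
      = 0 := by
    refine (mul_eq_zero_iff_left hv.ne').1 ?_
    linarith
  refine Eq.trans ?_ hJ'
  rw [← integral_const_mul, ← integral_add (I₁.const_mul _) I₂]
  refine setIntegral_congr_fun measurableSet_Ioi fun s hs => ?_
  rw [e₁, e₂ s hs, momentumSource, hkκ s]
  have : s ^ d = s ^ (d - 1) * s := by rw [← pow_succ, Nat.sub_add_cancel (by lia)]
  rw [this]
  ring

/-- The integrated balance of momentum across and behind the front. -/
theorem IsCavitatingSolution.exists_momentumFlux_eq (hr : IsCavitatingSolution d h lam σ r)
    (hd : 3 ≤ d) (hh : IsEnergyFunction h) (hlam : 0 < lam) :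
    ∃ c, ∀ s, 0 < s → s ≠ σ →
      momentumFlux d h lam σ r s = (∫ z in (0 : ℝ)..s, momentumSource d h lam σ r z) + c := by
  have hA := hr.isTame_momentumFlux (by lia) hh hlam
  have hB := hr.isTame_momentumSource (by lia) hh hlam
  exact eq_primitive_add_const_of_weak hA.continuousAt hB.continuousAt
    (fun _ hM => hA.intervalIntegrable hM) (fun _ hM => hB.intervalIntegrable hM)
    fun k hk hkc hks => hr.weak_balance hd hh hlam hk hkc hks

theorem IsCavitatingSolution.hasDerivAt_momentumFlux (hr : IsCavitatingSolution d h lam σ r)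
    (hd : 3 ≤ d) (hh : IsEnergyFunction h) (hlam : 0 < lam) {s : ℝ} (hs : s ∈ Ioo 0 σ) :
    HasDerivAt (momentumFlux d h lam σ r) (momentumSource d h lam σ r s) s := by
  obtain ⟨c, hc⟩ := hr.exists_momentumFlux_eq hd hh hlam
  have hB := hr.isTame_momentumSource (by lia) hh hlam
  refine ((hasDerivAt_primitive hB.continuousAt (fun _ hM => hB.intervalIntegrable hM) hs.1
    hs.2.ne).add_const c).congr_of_eventuallyEq ?_
  filter_upwards [Ioo_mem_nhds hs.1 hs.2] with z hz using hc z hz.1 hz.2.ne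

/-- The flux agrees off the front with a continuous primitive, so its one-sided limits coincide.
Ahead of the front the velocity is zero and the flux is explicit. -/
theorem IsCavitatingSolution.tendsto_momentumFlux (hr : IsCavitatingSolution d h lam σ r)
    (hd : 3 ≤ d) (hh : IsEnergyFunction h) (hlam : 0 < lam) :
    Tendsto (momentumFlux d h lam σ r) (𝓝[<] σ)
      (𝓝 (σ ^ (d - 1) * (lam + deriv h (lam ^ d) * lam ^ (d - 1)))) := by
  obtain ⟨c, hc⟩ := hr.exists_momentumFlux_eq hd hh hlam
  have hB := hr.isTame_momentumSource (by lia) hh hlam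
  have hσ := hr.sigma_pos
  have hP : ContinuousAt
      (fun s => (∫ z in (0 : ℝ)..s, momentumSource d h lam σ r z) + c) σ :=
    ((continuousOn_primitive_Ici fun _ hM => hB.intervalIntegrable hM).continuousAt
      (Ici_mem_nhds hσ)).add_const c
  have hl : Tendsto (momentumFlux d h lam σ r) (𝓝[<] σ)
      (𝓝 ((∫ z in (0 : ℝ)..σ, momentumSource d h lam σ r z) + c)) := by
    refine (hP.tendsto.mono_left nhdsWithin_le_nhds).congr' ?_
    filter_upwards [Ioo_mem_nhdsLT hσ] with s hs using (hc s hs.1 hs.2.ne).symm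
  have hg : Tendsto (momentumFlux d h lam σ r) (𝓝[>] σ)
      (𝓝 ((∫ z in (0 : ℝ)..σ, momentumSource d h lam σ r z) + c)) := by
    refine (hP.tendsto.mono_left nhdsWithin_le_nhds).congr' ?_
    filter_upwards [self_mem_nhdsWithin] with s hs using (hc s (hσ.trans hs) (ne_of_gt hs)).symm
  have hg' : Tendsto (momentumFlux d h lam σ r) (𝓝[>] σ)
      (𝓝 (σ ^ (d - 1) * (lam + deriv h (lam ^ d) * lam ^ (d - 1)))) := by
    have hcont : Continuous fun s : ℝ => s ^ (d - 1) * (lam + deriv h (lam ^ d) * lam ^ (d - 1)) :=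
      by fun_prop
    refine ((hcont.tendsto σ).mono_left nhdsWithin_le_nhds).congr' ?_
    filter_upwards [self_mem_nhdsWithin] with s hs
    have hs : σ ≤ s := le_of_lt hs
    rw [momentumFlux, radialVelocity, radialTraction, hr.jacobian_of_ge (by lia) hs,
      radialStretch_of_ge hs, hr.eq_of_ge hs]
    ring
  rwa [tendsto_nhds_unique hg' hg]

end BalanceLaw

/-! ### The energy of the fan -/

section Energy

/-- The stored energy of the radial deformation with stretches `p` and `q`. -/
def radialStoredEnergy (d : ℕ) (h : ℝ → ℝ) (p q : ℝ) : ℝ :=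
  1 / 2 * (p ^ 2 + (d - 1) * q ^ 2) + h (p * q ^ (d - 1))

/-- The energy density in the similarity variable. -/
def radialEnergy (d : ℕ) (h : ℝ → ℝ) (lam σ : ℝ) (r : ℝ → ℝ) (s : ℝ) : ℝ :=
  1 / 2 * radialVelocity lam σ r s ^ 2
    + radialStoredEnergy d h (radialStretch lam σ r s) (r s / s)

/-- A primitive of `d s^(d-1)` times the energy density. -/
def energyPrimitive (d : ℕ) (h : ℝ → ℝ) (lam σ : ℝ) (r : ℝ → ℝ) (s : ℝ) : ℝ :=
  s ^ d * radialStoredEnergy d h (radialStretch lam σ r s) (r s / s)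
    + momentumFlux d h lam σ r s * radialVelocity lam σ r s
    - 1 / 2 * (s ^ d * radialVelocity lam σ r s ^ 2)

theorem IsTame.congr {σ : ℝ} {f g : ℝ → ℝ} (hf : IsTame σ f) (hfg : ∀ s, 0 < s → g s = f s) :
    IsTame σ g :=
  ⟨fun s h1 h2 => (hf.continuousAt s h1 h2).congr (by
      filter_upwards [Ioi_mem_nhds h1] with z hz using (hfg z hz).symm), fun M =>
    let ⟨C, hC⟩ := hf.bounded M
    ⟨C, fun s hs => by rw [hfg s hs.1]; exact hC s hs⟩⟩

theorem IsTame.tendsto_pow_mul {σ : ℝ} {f : ℝ → ℝ} (hf : IsTame σ f) {n : ℕ} (hn : n ≠ 0) :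
    Tendsto (fun s => s ^ n * f s) (𝓝[>] 0) (𝓝 0) := by
  obtain ⟨C, hC⟩ := hf.bounded 1
  have h1 : Tendsto (fun s : ℝ => s ^ n) (𝓝[>] 0) (𝓝 0) := by
    have := ((continuous_pow n).tendsto (0 : ℝ)).mono_left (nhdsWithin_le_nhds (s := Ioi 0))
    simpa [hn] using this
  refine h1.zero_mul_isBoundedUnder_le ⟨C, ?_⟩
  rw [eventually_map]
  filter_upwards [Ioo_mem_nhdsGT one_pos] with s hs using hC s ⟨hs.1, hs.2.le⟩

variable {d : ℕ} {h : ℝ → ℝ} {lam σ : ℝ} {r : ℝ → ℝ}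

namespace IsCavitatingSolution

/-- The tangential term grows like `s^(-2)` at the cavity and is absorbed by `s^(d-1)` because `d ≥
3`; the `h` term is bounded because the Jacobian stays in a compact subset of `(0,∞)`. -/
theorem isTame_pow_mul_storedEnergy (hr : IsCavitatingSolution d h lam σ r) (hd : 3 ≤ d)
    (hh : IsEnergyFunction h) (hlam : 0 < lam) :
    IsTame σ fun s => s ^ (d - 1)
      * radialStoredEnergy d h (radialStretch lam σ r s) (r s / s) := by
  have hp := hr.isTame_radialStretch (by lia) hh hlam
  have hv := hr.isTame_comp_jacobian (by lia) hh hlam hh.contDiffOn.continuousOn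
  have hmono : ∀ n : ℕ, IsTame σ fun s : ℝ => s ^ n := fun n =>
    IsTame.of_continuous (continuous_pow n)
  refine IsTame.congr ((((hmono (d - 1)).mul (hp.pow 2)).const_mul (1 / 2)).add
    ((((hmono (d - 3)).mul (hr.isTame_profile.pow 2)).const_mul (1 / 2 * (d - 1))).add
      ((hmono (d - 1)).mul hv))) fun s hs => ?_
  rw [radialStoredEnergy, jacobian]
  have : s ^ (d - 1) = s ^ (d - 3) * s ^ 2 := by rw [← pow_add]; congr 1; lia
  rw [this]
  field_simp
  ring

theorem isTame_pow_mul_radialEnergy (hr : IsCavitatingSolution d h lam σ r) (hd : 3 ≤ d)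
    (hh : IsEnergyFunction h) (hlam : 0 < lam) :
    IsTame σ fun s => s ^ (d - 1) * radialEnergy d h lam σ r s := by
  refine IsTame.congr ((((IsTame.of_continuous (continuous_pow (d - 1))).mul
    ((hr.isTame_radialVelocity (by lia) hh hlam).pow 2)).const_mul (1 / 2)).add
      (hr.isTame_pow_mul_storedEnergy hd hh hlam)) fun s _ => ?_
  rw [radialEnergy]; ring

theorem radialEnergy_of_ge (hr : IsCavitatingSolution d h lam σ r) (hd : 1 ≤ d) {s : ℝ}
    (hs : σ ≤ s) : radialEnergy d h lam σ r s = d / 2 * lam ^ 2 + h (lam ^ d) := by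
  rw [radialEnergy, radialStoredEnergy, ← jacobian, hr.jacobian_of_ge hd hs, radialVelocity,
    radialStretch_of_ge hs, hr.eq_of_ge hs,
    mul_div_cancel_right₀ _ (hr.sigma_pos.trans_le hs).ne']
  ring

theorem hasDerivAt_radialStretch (hr : IsCavitatingSolution d h lam σ r) {s : ℝ}
    (hs : s ∈ Ioo 0 σ) :
    HasDerivAt (radialStretch lam σ r) (deriv (deriv r) s) s := by
  have h1 : ContDiffOn ℝ 1 (deriv r) (Ioo 0 σ) :=
    hr.contDiffOn.deriv_of_isOpen isOpen_Ioo (by norm_num)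
  refine (((h1.contDiffAt (Ioo_mem_nhds hs.1 hs.2)).differentiableAt
    (by norm_num)).hasDerivAt).congr_of_eventuallyEq ?_
  filter_upwards [Iio_mem_nhds hs.2] with z hz using radialStretch_of_lt hz

/-- Conservation of energy for smooth self-similar motions. The primitive is `s^d e + radialTraction
* u`; writing it through the momentum flux lets the equation of motion enter only as `A' = B`, and
the remaining terms cancel by the chain rule. -/
theorem hasDerivAt_energyPrimitive (hr : IsCavitatingSolution d h lam σ r) (hd : 3 ≤ d)
    (hh : IsEnergyFunction h) (hlam : 0 < lam) {s : ℝ} (hs : s ∈ Ioo 0 σ) :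
    HasDerivAt (energyPrimitive d h lam σ r) (d * (s ^ (d - 1) * radialEnergy d h lam σ r s))
      s := by
  have hA := hr.hasDerivAt_momentumFlux hd hh hlam hs
  have hp := hr.hasDerivAt_radialStretch hs
  have hrr := hr.hasDerivAt hs.1 hs.2.ne
  have hu : HasDerivAt (radialVelocity lam σ r) _ s := hrr.fun_sub ((hasDerivAt_id' s).fun_mul hp)
  have hq := hrr.fun_div (hasDerivAt_id' s) hs.1.ne'
  have hv := hp.fun_mul (hq.fun_pow (d - 1))
  have hhv := (hh.hasDerivAt (hr.jacobian_pos hlam hs.1)).comp s hv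
  have hW := (((hp.fun_pow 2).fun_add ((hq.fun_pow 2).const_mul ((d : ℝ) - 1))).const_mul
    (1 / 2)).fun_add hhv
  have hQ := (((hasDerivAt_pow d s).fun_mul hW).fun_add (hA.fun_mul hu)).fun_sub
    (((hasDerivAt_pow d s).fun_mul (hu.fun_pow 2)).const_mul (1 / 2))
  refine HasDerivAt.congr_deriv (f := energyPrimitive d h lam σ r) hQ ?_
  have hs0 := hs.1.ne'
  simp only [Function.comp_apply, momentumFlux, momentumSource, radialTraction, hoopTraction,
    radialEnergy, radialStoredEnergy]
  rw [show radialStretch lam σ r s * (r s / s) ^ (d - 1) = jacobian d lam σ r s from rfl]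
  generalize deriv h (jacobian d lam σ r s) = η
  generalize h (jacobian d lam σ r s) = η₀
  obtain ⟨e, rfl⟩ := Nat.exists_eq_add_of_le' hd
  simp only [radialVelocity, show e + 3 - 1 = e + 2 by lia, show e + 2 - 1 = e + 1 by lia,
    show e + 3 - 2 = e + 1 by lia, Nat.add_sub_cancel, div_pow]
  push_cast
  field_simp
  ring

/-- The radial traction is `r^(d-1)` times the Cauchy traction, which vanishes at the cavity while
the velocity stays bounded: a stress-free surface does no work. All other terms carry a positive
power of `s` times a bounded function. -/
theorem tendsto_energyPrimitive_zero (hr : IsCavitatingSolution d h lam σ r) (hd : 3 ≤ d)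
    (hh : IsEnergyFunction h) (hlam : 0 < lam) :
    Tendsto (energyPrimitive d h lam σ r) (𝓝[>] 0) (𝓝 0) := by
  have hut := hr.isTame_radialVelocity (by lia) hh hlam
  have h1 := (hr.isTame_pow_mul_storedEnergy hd hh hlam).tendsto_pow_mul one_ne_zero
  have h2 := (hut.pow 2).tendsto_pow_mul (n := d) (by lia)
  have h3 : Tendsto (radialTraction d h lam σ r) (𝓝[>] 0) (𝓝 0) := by
    have hr0 : Tendsto (fun s => r s ^ (d - 1)) (𝓝[>] 0) (𝓝 (r 0 ^ (d - 1))) :=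
      (((hr.continuousOn 0 self_mem_Ici).mono Ioi_subset_Ici_self).tendsto).pow _
    have := hr0.mul (hr.tendsto_traction (by lia) hh hlam)
    rw [mul_zero] at this
    refine this.congr' ?_
    filter_upwards [self_mem_nhdsWithin] with s hs
    have hrs := hr.pos hlam (le_of_lt hs)
    have hs : 0 < s := hs
    rw [radialTraction, div_pow]
    field_simp
  have h4 : Tendsto (fun s => radialTraction d h lam σ r s * radialVelocity lam σ r s)
      (𝓝[>] 0) (𝓝 0) := by
    obtain ⟨C, hC⟩ := hut.bounded 1
    refine h3.zero_mul_isBoundedUnder_le ⟨C, ?_⟩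
    rw [eventually_map]
    filter_upwards [Ioo_mem_nhdsGT one_pos] with s hs using hC s ⟨hs.1, hs.2.le⟩
  have h5 := (h1.add h4).add (h2.const_mul (1 / 2))
  simp only [mul_zero, add_zero] at h5
  refine h5.congr fun s => ?_
  rw [energyPrimitive, momentumFlux]
  have : s ^ d = s ^ 1 * s ^ (d - 1) := by rw [← pow_add]; congr 1; lia
  rw [this]
  ring

theorem tendsto_radialVelocity (hr : IsCavitatingSolution d h lam σ r) {a : ℝ}
    (ha : Tendsto (deriv r) (𝓝[<] σ) (𝓝 a)) :
    Tendsto (radialVelocity lam σ r) (𝓝[<] σ) (𝓝 (lam * σ - σ * a)) := by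
  rw [← hr.eq_of_ge le_rfl]
  exact ((hr.continuousAt hr.sigma_pos).tendsto.mono_left nhdsWithin_le_nhds).sub
    ((tendsto_id.mono_left nhdsWithin_le_nhds).mul (tendsto_radialStretch ha))

/-- The Rankine–Hugoniot condition. -/
theorem rankine_hugoniot (hr : IsCavitatingSolution d h lam σ r) (hd : 3 ≤ d)
    (hh : IsEnergyFunction h) (hlam : 0 < lam) {a : ℝ} (ha0 : 0 < a)
    (ha : Tendsto (deriv r) (𝓝[<] σ) (𝓝 a)) :
    σ ^ 2 * (lam - a) = lam + deriv h (lam ^ d) * lam ^ (d - 1)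
      - (a + deriv h (a * lam ^ (d - 1)) * lam ^ (d - 1)) := by
  have hσ := hr.sigma_pos
  have hrσ : Tendsto r (𝓝[<] σ) (𝓝 (lam * σ)) := by
    rw [← hr.eq_of_ge le_rfl]
    exact (hr.continuousAt hσ).tendsto.mono_left nhdsWithin_le_nhds
  have hid : Tendsto (fun s : ℝ => s) (𝓝[<] σ) (𝓝 σ) := nhdsWithin_le_nhds
  have hη := (hh.continuousOn_deriv.continuousAt
    (Ioi_mem_nhds (show 0 < a * lam ^ (d - 1) by positivity))).tendsto.comp (hr.tendsto_jacobian ha)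
  have h1 : Tendsto (momentumFlux d h lam σ r) (𝓝[<] σ)
      (𝓝 (σ ^ d * (lam * σ - σ * a) + (σ ^ (d - 1) * a
        + deriv h (a * lam ^ (d - 1)) * (lam * σ) ^ (d - 1)))) :=
    ((hid.pow d).mul (hr.tendsto_radialVelocity ha)).add
      (((hid.pow (d - 1)).mul (tendsto_radialStretch ha)).add (hη.mul (hrσ.pow (d - 1))))
  -- The limit from behind computed from the profile must equal the one prescribed by the state
  -- ahead of the front.
  have h2 := tendsto_nhds_unique h1 (hr.tendsto_momentumFlux hd hh hlam)
  have hpos : σ ^ (d - 1) ≠ 0 := by positivity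
  have h3 : σ ^ d = σ ^ (d - 1) * σ := by rw [← pow_succ, Nat.sub_add_cancel (by lia)]
  refine mul_left_cancel₀ hpos ?_
  rw [h3, mul_pow] at h2
  linear_combination h2

/-- The fundamental theorem of calculus for the energy primitive leaves only its limit at the front,
since the limit at the cavity is zero. -/
theorem integral_fan_energy (hr : IsCavitatingSolution d h lam σ r) (hd : 3 ≤ d)
    (hh : IsEnergyFunction h) (hlam : 0 < lam) {a : ℝ} (ha0 : 0 < a)
    (ha : Tendsto (deriv r) (𝓝[<] σ) (𝓝 a)) :
    ∫ s in (0 : ℝ)..σ, s ^ (d - 1) * radialEnergy d h lam σ r s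
      = σ ^ d / d * (d / 2 * lam ^ 2 + h (lam ^ d) + shockDissipation d h lam a) := by
  have hσ := hr.sigma_pos
  have hd0 : (d : ℝ) ≠ 0 := by exact_mod_cast (show d ≠ 0 by lia)
  have hlim : Tendsto (energyPrimitive d h lam σ r) (𝓝[<] σ)
      (𝓝 (σ ^ d * radialStoredEnergy d h a lam
        + σ ^ (d - 1) * (lam + deriv h (lam ^ d) * lam ^ (d - 1)) * (lam * σ - σ * a)
        - 1 / 2 * (σ ^ d * (lam * σ - σ * a) ^ 2))) := by
    have hid : Tendsto (fun s : ℝ => s) (𝓝[<] σ) (𝓝 σ) := nhdsWithin_le_nhds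
    have hη := (hh.contDiffOn.continuousOn.continuousAt
      (Ioi_mem_nhds (show 0 < a * lam ^ (d - 1) by positivity))).tendsto.comp
        (hr.tendsto_jacobian ha)
    have hu := hr.tendsto_radialVelocity ha
    have hW : Tendsto
        (fun s => radialStoredEnergy d h (radialStretch lam σ r s) (r s / s)) (𝓝[<] σ)
        (𝓝 (radialStoredEnergy d h a lam)) :=
      ((((tendsto_radialStretch ha).pow 2).add (((hr.tendsto_div.mono_left
        nhdsWithin_le_nhds).pow 2).const_mul ((d : ℝ) - 1))).const_mul (1 / 2)).add hη
    exact (((hid.pow d).mul hW).add ((hr.tendsto_momentumFlux hd hh hlam).mul hu)).sub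
      (((hid.pow d).mul (hu.pow 2)).const_mul (1 / 2))
  have hint := (hr.isTame_pow_mul_radialEnergy hd hh hlam).intervalIntegrable hσ.le
  have hftc := intervalIntegral.integral_eq_sub_of_hasDerivAt_of_tendsto hσ
    (fun s hs => hr.hasDerivAt_energyPrimitive hd hh hlam hs) (hint.const_mul _)
    (hr.tendsto_energyPrimitive_zero hd hh hlam) hlim
  rw [intervalIntegral.integral_const_mul] at hftc
  have hrh := hr.rankine_hugoniot hd hh hlam ha0 ha
  have h3 : σ ^ (d - 1) = σ ^ d / σ := by
    rw [eq_div_iff hσ.ne', ← pow_succ, Nat.sub_add_cancel (by lia)]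
  rw [div_mul_eq_mul_div, eq_div_iff hd0, mul_comm, hftc, shockDissipation, radialStoredEnergy, h3]
  field_simp
  -- The Rankine–Hugoniot condition replaces `σ^2 (lam - a)` by the jump of the stress. Half of this
  -- jump is subtracted from the stress ahead, which leaves the mean of the two stresses appearing
  -- in `J`.
  linear_combination (- (σ ^ d * (lam - a))) * hrh

theorem integral_radialEnergy (hr : IsCavitatingSolution d h lam σ r) (hd : 3 ≤ d)
    (hh : IsEnergyFunction h) (hlam : 0 < lam) {a : ℝ} (ha0 : 0 < a)
    (ha : Tendsto (deriv r) (𝓝[<] σ) (𝓝 a)) {M : ℝ} (hM : σ ≤ M) :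
    ∫ s in (0 : ℝ)..M, s ^ (d - 1) * radialEnergy d h lam σ r s
      = M ^ d / d * (d / 2 * lam ^ 2 + h (lam ^ d)) + σ ^ d / d * shockDissipation d h lam a := by
  have hσ := hr.sigma_pos
  have hd0 : (d : ℝ) ≠ 0 := by exact_mod_cast (show d ≠ 0 by lia)
  have hE := hr.isTame_pow_mul_radialEnergy hd hh hlam
  have hi := hE.intervalIntegrable (hσ.le.trans hM)
  have h1 : ∫ s in σ..M, s ^ (d - 1) * radialEnergy d h lam σ r s
      = (M ^ d - σ ^ d) / d * (d / 2 * lam ^ 2 + h (lam ^ d)) := by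
    rw [intervalIntegral.integral_congr
      (g := fun s => s ^ (d - 1) * (d / 2 * lam ^ 2 + h (lam ^ d))) fun s hs => ?_]
    · rw [intervalIntegral.integral_mul_const, integral_pow]
      rw [show d - 1 + 1 = d by lia, Nat.cast_sub (by lia)]
      simp
    · rw [uIcc_of_le hM] at hs
      simp only
      rw [hr.radialEnergy_of_ge (by lia) hs.1]
  rw [← intervalIntegral.integral_add_adjacent_intervals (hE.intervalIntegrable hσ.le)
    ((hE.intervalIntegrable hσ.le).symm.trans hi), h1, hr.integral_fan_energy hd hh hlam ha0 ha]
  field_simp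
  ring

end IsCavitatingSolution

end Energy

/-! ### Concentration of the energy at the cavity -/

section Concentration

/-- The limit gives the `ε v` part for large `v`, and compactness the constant `K` on the rest. The
cut-off `c > 0` keeps away from `0`, where `h` is unbounded. -/
theorem exists_abs_sub_linear_le {h : ℝ → ℝ} (hc : ContinuousOn h (Ioi 0)) {L : ℝ}
    (hL : Tendsto (fun v => h v / v) atTop (𝓝 L)) {c : ℝ} (hc0 : 0 < c) {ε : ℝ} (hε : 0 < ε) :
    ∃ K, 0 ≤ K ∧ ∀ v, c ≤ v → |h v - L * v| ≤ ε * v + K := by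
  obtain ⟨N, hN⟩ := eventually_atTop.1 (Metric.tendsto_nhds.1 hL ε hε)
  obtain ⟨K, hK⟩ := (isCompact_Icc (a := c) (b := N)).exists_bound_of_continuousOn
    (f := fun v => h v - L * v)
    ((hc.mono fun v hv => hc0.trans_le hv.1).sub (continuous_const_mul L).continuousOn)
  refine ⟨max K 0, le_max_right _ _, fun v hv => ?_⟩
  have hv0 := hc0.trans_le hv
  rcases le_total v N with h1 | h1
  · have h2 : |h v - L * v| ≤ K := hK v ⟨hv, h1⟩
    have h3 : 0 ≤ ε * v := by positivity
    linarith [le_max_left K 0]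
  · have h2 := hN v h1
    rw [Real.dist_eq] at h2
    have h3 : h v - L * v = (h v / v - L) * v := by field_simp
    rw [h3, abs_mul, abs_of_pos hv0]
    have := mul_le_mul_of_nonneg_right h2.le hv0.le
    linarith [le_max_right K 0]

/-- The energy of a radial motion per unit radius. -/
def shellEnergy (d : ℕ) (h : ℝ → ℝ) (p q u R : ℝ) : ℝ :=
  R ^ (d - 1) * (1 / 2 * u ^ 2 + radialStoredEnergy d h p (q / R))

theorem shellEnergy_eq {d : ℕ} (hd : 3 ≤ d) (h : ℝ → ℝ) (p q u : ℝ) {R : ℝ} (hR : 0 < R) :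
    shellEnergy d h p q u R = 1 / 2 * (R ^ (d - 1) * u ^ 2) + 1 / 2 * (R ^ (d - 1) * p ^ 2)
      + (d - 1) / 2 * (R ^ (d - 3) * q ^ 2) + R ^ (d - 1) * h (p * (q / R) ^ (d - 1)) := by
  have : R ^ (d - 1) = R ^ (d - 3) * R ^ 2 := by rw [← pow_add]; congr 1; lia
  rw [shellEnergy, radialStoredEnergy]
  generalize h (p * (q / R) ^ (d - 1)) = η
  rw [this]
  field_simp
  ring

theorem pow_mul_jacobian {d : ℕ} (p q : ℝ) {R : ℝ} (hR : 0 < R) :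
    R ^ (d - 1) * (p * (q / R) ^ (d - 1)) = p * q ^ (d - 1) := by
  rw [div_pow]; field_simp

variable {d : ℕ} {h : ℝ → ℝ} {L Rbar C c : ℝ} {p q u : ℕ → ℝ → ℝ}

/-- The bounds satisfied by the mollifications of a cavitating radial motion on `(0, Rbar)`. -/
structure IsConcentrating (d : ℕ) (Rbar C c : ℝ) (p q u : ℕ → ℝ → ℝ) : Prop where
  hasDerivAt : ∀ n, 1 ≤ n → ∀ R, HasDerivAt (q n) (p n R) R
  continuous_stretch : ∀ n, 1 ≤ n → Continuous (p n)
  continuous_velocity : ∀ n, 1 ≤ n → Continuous (u n)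
  map_zero : ∀ n, 1 ≤ n → q n 0 = 0
  amplitude_pos : ∀ n, 1 ≤ n → ∀ R ∈ Ioo 0 Rbar, 0 < q n R
  amplitude_le : ∀ n, 1 ≤ n → ∀ R ∈ Ioo 0 Rbar, q n R ≤ C
  velocity_le : ∀ n, 1 ≤ n → ∀ R ∈ Ioo 0 Rbar, |u n R| ≤ C
  stretch_pos : ∀ n, 1 ≤ n → ∀ R ∈ Ioo 0 Rbar, 0 < p n R
  stretch_le : ∀ n, 1 ≤ n → ∀ R ∈ Ioo 0 Rbar, p n R ≤ C * n
  stretch_le_of_le : ∀ n : ℕ, 1 ≤ n → ∀ R ∈ Ioo 0 Rbar, (n : ℝ)⁻¹ < R → p n R ≤ C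
  le_jacobian : ∀ n, 1 ≤ n → ∀ R ∈ Ioo 0 Rbar, c ≤ p n R * (q n R / R) ^ (d - 1)

namespace IsConcentrating

theorem continuous_amplitude (H : IsConcentrating d Rbar C c p q u) {n : ℕ} (hn : 1 ≤ n) :
    Continuous (q n) :=
  continuous_iff_continuousAt.2 fun R => (H.hasDerivAt n hn R).continuousAt

theorem jacobian_pos (H : IsConcentrating d Rbar C c p q u) {n : ℕ} (hn : 1 ≤ n) {R : ℝ}
    (hR : R ∈ Ioo 0 Rbar) : 0 < p n R * (q n R / R) ^ (d - 1) :=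
  mul_pos (H.stretch_pos n hn R hR) (pow_pos (div_pos (H.amplitude_pos n hn R hR) hR.1) _)

theorem continuousOn_shellEnergy (H : IsConcentrating d Rbar C c p q u)
    (hh : ContinuousOn h (Ioi 0)) {n : ℕ} (hn : 1 ≤ n) :
    ContinuousOn (fun R => shellEnergy d h (p n R) (q n R) (u n R) R) (Ioo 0 Rbar) := by
  have hp := (H.continuous_stretch n hn).continuousOn (s := Ioo 0 Rbar)
  have hu := (H.continuous_velocity n hn).continuousOn (s := Ioo 0 Rbar)
  have hq : ContinuousOn (fun R => q n R / R) (Ioo 0 Rbar) :=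
    (H.continuous_amplitude hn).continuousOn.div₀ continuousOn_id fun R hR => hR.1.ne'
  refine ((continuous_pow (d - 1)).continuousOn).mul (((hu.pow 2).const_mul _).add ?_)
  exact (((hp.pow 2).add ((hq.pow 2).const_mul _)).const_mul _).add
    (hh.comp (hp.mul (hq.pow _)) fun R hR => H.jacobian_pos hn hR)

/-- The integrand is the derivative of `q^d/d`, the volume swept by the deformation up to a
constant. Hence the leading part of the core energy depends only on the amplitude at the edge of the
core and not on the shape of the mollifier. -/
theorem integral_stretch_mul_pow (H : IsConcentrating d Rbar C c p q u) (hd : 1 ≤ d) {n : ℕ}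
    (hn : 1 ≤ n) {b : ℝ} (hb : 0 ≤ b) :
    ∫ R in Ioo 0 b, p n R * q n R ^ (d - 1) = q n b ^ d / d := by
  have hd0 : (d : ℝ) ≠ 0 := by exact_mod_cast (show d ≠ 0 by lia)
  have hqc := H.continuous_amplitude hn
  have hpc := H.continuous_stretch n hn
  rw [← integral_Ioc_eq_integral_Ioo, ← intervalIntegral.integral_of_le hb,
    intervalIntegral.integral_eq_sub_of_hasDerivAt (f := fun R => q n R ^ d / d)]
  · rw [H.map_zero n hn, zero_pow (by lia)]; simp
  · intro R _
    refine (((H.hasDerivAt n hn R).fun_pow d).div_const (d : ℝ)).congr_deriv ?_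
    field_simp
  · exact (hpc.mul (hqc.pow _)).intervalIntegrable _ _

theorem const_nonneg (H : IsConcentrating d Rbar C c p q u) (hR : 0 < Rbar) : 0 ≤ C :=
  (abs_nonneg _).trans (H.velocity_le 1 le_rfl (Rbar / 2) ⟨by linarith, by linarith⟩)

theorem pow_mul_jacobian_le (H : IsConcentrating d Rbar C c p q u) {n : ℕ} (hn : 1 ≤ n)
    {R : ℝ} (hR : R ∈ Ioo 0 Rbar) {B : ℝ} (hB : p n R ≤ B) :
    p n R * q n R ^ (d - 1) ≤ B * C ^ (d - 1) := by
  have h1 := H.stretch_pos n hn R hR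
  have h2 := H.amplitude_pos n hn R hR
  have h3 := H.amplitude_le n hn R hR
  have : 0 ≤ B := h1.le.trans hB
  gcongr

/-- The shell energy is compared with `L` times the volume rate `p q^(d-1) = R^(d-1) v`. The lower
bound `c` on the Jacobian is what permits replacing `h(v)` by `L v`. -/
theorem abs_shellEnergy_sub_le (H : IsConcentrating d Rbar C c p q u) (hd : 3 ≤ d)
    {ε K : ℝ} (hK : ∀ v, c ≤ v → |h v - L * v| ≤ ε * v + K) {n : ℕ} (hn : 1 ≤ n) {R : ℝ}
    (hR : R ∈ Ioo 0 Rbar) :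
    |shellEnergy d h (p n R) (q n R) (u n R) R - L * (p n R * q n R ^ (d - 1))|
      ≤ 1 / 2 * (R ^ (d - 1) * C ^ 2) + 1 / 2 * (R ^ (d - 1) * p n R ^ 2)
        + (d - 1) / 2 * (R ^ (d - 3) * C ^ 2)
        + (ε * (p n R * q n R ^ (d - 1)) + K * R ^ (d - 1)) := by
  have h0 := hR.1
  have hd1 : (0 : ℝ) ≤ ((d : ℝ) - 1) / 2 := by
    have : (3 : ℝ) ≤ d := by exact_mod_cast hd
    linarith
  have hq := H.amplitude_pos n hn R hR
  have hqC := H.amplitude_le n hn R hR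
  have hu2 : u n R ^ 2 ≤ C ^ 2 := sq_le_sq' (abs_le.1 (H.velocity_le n hn R hR)).1
    (abs_le.1 (H.velocity_le n hn R hR)).2
  have hv := hK _ (H.le_jacobian n hn R hR)
  set v := p n R * (q n R / R) ^ (d - 1) with hvdef
  have hpq : p n R * q n R ^ (d - 1) = R ^ (d - 1) * v := (pow_mul_jacobian _ _ h0).symm
  rw [shellEnergy_eq hd h _ _ _ h0, hpq]
  have e : 1 / 2 * (R ^ (d - 1) * u n R ^ 2) + 1 / 2 * (R ^ (d - 1) * p n R ^ 2)
      + (d - 1) / 2 * (R ^ (d - 3) * q n R ^ 2) + R ^ (d - 1) * h v - L * (R ^ (d - 1) * v)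
      = (1 / 2 * (R ^ (d - 1) * u n R ^ 2) + 1 / 2 * (R ^ (d - 1) * p n R ^ 2)
      + (d - 1) / 2 * (R ^ (d - 3) * q n R ^ 2)) + R ^ (d - 1) * (h v - L * v) := by ring
  rw [e]
  refine (abs_add_le _ _).trans (add_le_add ?_ ?_)
  · rw [abs_of_nonneg (by positivity)]
    gcongr
  · rw [abs_mul, abs_of_pos (by positivity : (0 : ℝ) < R ^ (d - 1))]
    have := mul_le_mul_of_nonneg_left hv (by positivity : (0 : ℝ) ≤ R ^ (d - 1))
    linarith

/-- Used twice: with `B = C * n` for integrability at fixed `n`, and with `B = C` outside the core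
for a bound uniform in `n`. -/
theorem exists_abs_shellEnergy_le (H : IsConcentrating d Rbar C c p q u) (hd : 3 ≤ d)
    (hRbar : 0 < Rbar) (hc : 0 < c) (hh : ContinuousOn h (Ioi 0))
    (hL : Tendsto (fun v => h v / v) atTop (𝓝 L)) (B : ℝ) :
    ∃ D, ∀ n, 1 ≤ n → ∀ R ∈ Ioo 0 Rbar, p n R ≤ B →
      |shellEnergy d h (p n R) (q n R) (u n R) R| ≤ D := by
  obtain ⟨K, hK0, hK⟩ := exists_abs_sub_linear_le hh hL hc one_pos
  have hd1 : (0 : ℝ) ≤ ((d : ℝ) - 1) / 2 := by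
    have : (3 : ℝ) ≤ d := by exact_mod_cast hd
    linarith
  have hC := H.const_nonneg hRbar
  refine ⟨1 / 2 * (Rbar ^ (d - 1) * C ^ 2) + 1 / 2 * (Rbar ^ (d - 1) * B ^ 2)
        + (d - 1) / 2 * (Rbar ^ (d - 3) * C ^ 2)
        + (1 * (B * C ^ (d - 1)) + K * Rbar ^ (d - 1)) + |L| * (B * C ^ (d - 1)),
    fun n hn R hR hB => ?_⟩
  have h0 := hR.1
  have h1 := hR.2.le
  have hp := H.stretch_pos n hn R hR
  have hq := H.amplitude_pos n hn R hR
  have h2 := H.abs_shellEnergy_sub_le hd hK hn hR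
  have h3 := H.pow_mul_jacobian_le hn hR hB
  have h4 : |L * (p n R * q n R ^ (d - 1))| ≤ |L| * (B * C ^ (d - 1)) := by
    rw [abs_mul, abs_of_pos (by positivity : 0 < p n R * q n R ^ (d - 1))]
    gcongr
  have h5 := abs_add_le (shellEnergy d h (p n R) (q n R) (u n R) R
    - L * (p n R * q n R ^ (d - 1))) (L * (p n R * q n R ^ (d - 1)))
  rw [sub_add_cancel] at h5
  refine h5.trans (add_le_add (h2.trans ?_) h4)
  gcongr

theorem integrableOn_shellEnergy (H : IsConcentrating d Rbar C c p q u) (hd : 3 ≤ d)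
    (hRbar : 0 < Rbar) (hc : 0 < c) (hh : ContinuousOn h (Ioi 0))
    (hL : Tendsto (fun v => h v / v) atTop (𝓝 L)) {n : ℕ} (hn : 1 ≤ n) :
    IntegrableOn (fun R => shellEnergy d h (p n R) (q n R) (u n R) R) (Ioo 0 Rbar) := by
  obtain ⟨D, hD⟩ := H.exists_abs_shellEnergy_le hd hRbar hc hh hL (C * n)
  refine IntegrableOn.of_bound measure_Ioo_lt_top
    ((H.continuousOn_shellEnergy hh hn).aestronglyMeasurable measurableSet_Ioo) D ?_
  exact (ae_restrict_iff' measurableSet_Ioo).2 (Eventually.of_forall fun R hR =>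
    hD n hn R hR (H.stretch_le n hn R hR))

/-- On the core the energy differs from `L * p * q^(d-1)` by at most a constant plus `ε * p *
q^(d-1)`. The constant integrates to a multiple of `1/n`, the other term to at most `ε * C^d/d`. -/
theorem tendsto_integral_core (H : IsConcentrating d Rbar C c p q u) (hd : 3 ≤ d)
    (hRbar : 0 < Rbar) (hc : 0 < c) (hh : ContinuousOn h (Ioi 0))
    (hL : Tendsto (fun v => h v / v) atTop (𝓝 L)) {q₀ : ℝ}
    (hq₀ : Tendsto (fun n : ℕ => q n (n : ℝ)⁻¹) atTop (𝓝 q₀)) :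
    Tendsto (fun n : ℕ => ∫ R in Ioo 0 (n : ℝ)⁻¹, shellEnergy d h (p n R) (q n R) (u n R) R) atTop
      (𝓝 (L * (q₀ ^ d / d))) := by
  have hd0 : (0 : ℝ) < d := by exact_mod_cast (show 0 < d by lia)
  have hd1 : (0 : ℝ) ≤ ((d : ℝ) - 1) / 2 := by
    have : (3 : ℝ) ≤ d := by exact_mod_cast hd
    linarith
  have hC := H.const_nonneg hRbar
  have hlim : Tendsto (fun n : ℕ => L * (q n (n : ℝ)⁻¹ ^ d / d)) atTop (𝓝 (L * (q₀ ^ d / d))) :=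
    ((hq₀.pow d).div_const _).const_mul L
  refine hlim.congr_dist ?_
  have hinv : Tendsto (fun n : ℕ => (n : ℝ)⁻¹) atTop (𝓝 0) := tendsto_inv_atTop_nhds_zero_nat
  rw [Metric.tendsto_nhds]
  intro δ hδ
  -- Chosen so that the concentrating error is at most `δ / 2`; the summand `1` avoids division by
  -- zero when `C = 0`.
  set ε : ℝ := δ / 2 / (C ^ d / d + 1) with hεdef
  have hε : 0 < ε := by positivity
  obtain ⟨K, hK0, hK⟩ := exists_abs_sub_linear_le hh hL hc hε
  set D : ℝ := 1 / 2 * C ^ 2 + 1 / 2 * C ^ 2 + (d - 1) / 2 * C ^ 2 + K with hD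
  have hsmall : Tendsto (fun n : ℕ => D * (n : ℝ)⁻¹) atTop (𝓝 0) := by
    simpa using hinv.const_mul D
  filter_upwards [eventually_ge_atTop 1, hinv.eventually_lt_const hRbar,
    hsmall.eventually_lt_const (half_pos hδ)] with n hn hnR hnD
  have hn0 : (0 : ℝ) < (n : ℝ) := by exact_mod_cast hn
  have hn1 : (n : ℝ)⁻¹ ≤ 1 := inv_le_one_of_one_le₀ (by exact_mod_cast hn)
  have hsub : Ioo 0 (n : ℝ)⁻¹ ⊆ Ioo 0 Rbar := Ioo_subset_Ioo_right hnR.le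
  have hi := (H.integrableOn_shellEnergy hd hRbar hc hh hL hn).mono_set hsub
  have hcont : Continuous fun R => p n R * q n R ^ (d - 1) :=
    (H.continuous_stretch n hn).mul ((H.continuous_amplitude hn).pow _)
  have hi2 : IntegrableOn (fun R => p n R * q n R ^ (d - 1)) (Ioo 0 (n : ℝ)⁻¹) :=
    (hcont.integrableOn_Icc (a := 0) (b := (n : ℝ)⁻¹)).mono_set Ioo_subset_Icc_self
  have hFTC := H.integral_stretch_mul_pow (by lia) hn (inv_nonneg.2 hn0.le)
  have hbound : ∀ R ∈ Ioo 0 (n : ℝ)⁻¹,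
      |shellEnergy d h (p n R) (q n R) (u n R) R - L * (p n R * q n R ^ (d - 1))|
        ≤ D + ε * (p n R * q n R ^ (d - 1)) := by
    intro R hR
    have h0 := hR.1
    have hR1 : R ≤ 1 := hR.2.le.trans hn1
    refine (H.abs_shellEnergy_sub_le hd hK hn (hsub hR)).trans ?_
    have e1 : R ^ (d - 1) * C ^ 2 ≤ C ^ 2 :=
      mul_le_of_le_one_left (by positivity) (pow_le_one₀ h0.le hR1)
    have e2 : R ^ (d - 3) * C ^ 2 ≤ C ^ 2 :=
      mul_le_of_le_one_left (by positivity) (pow_le_one₀ h0.le hR1)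
    have e3 : K * R ^ (d - 1) ≤ K := mul_le_of_le_one_right hK0 (pow_le_one₀ h0.le hR1)
    -- In the core `R * p ≤ C` because `R < 1/n` and `p ≤ C * n`. The remaining factor `R^(d-3)` is
    -- at most `1`, so the quadratic term does not concentrate.
    have e4 : R ^ (d - 1) * p n R ^ 2 ≤ C ^ 2 := by
      have hp := H.stretch_pos n hn R (hsub hR)
      have hpn := H.stretch_le n hn R (hsub hR)
      have h5 : R * p n R ≤ C := by
        calc R * p n R ≤ (n : ℝ)⁻¹ * (C * n) := by
              have := hR.2.le
              gcongr
          _ = C := by field_simp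
      have h6 : R ^ (d - 1) = R ^ (d - 3) * R ^ 2 := by rw [← pow_add]; congr 1; lia
      rw [h6, mul_assoc, ← mul_pow]
      refine (mul_le_of_le_one_left (by positivity) (pow_le_one₀ h0.le hR1)).trans ?_
      gcongr
    have e5 := mul_le_mul_of_nonneg_left e2 hd1
    rw [hD]
    linarith
  rw [dist_zero_right, Real.norm_of_nonneg dist_nonneg, dist_comm, Real.dist_eq, ← hFTC,
    ← integral_const_mul, ← integral_sub hi (hi2.const_mul L)]
  calc |∫ R in Ioo 0 (n : ℝ)⁻¹, (shellEnergy d h (p n R) (q n R) (u n R) R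
        - L * (p n R * q n R ^ (d - 1)))|
      ≤ ∫ R in Ioo 0 (n : ℝ)⁻¹, (D + ε * (p n R * q n R ^ (d - 1))) := by
        rw [← Real.norm_eq_abs]
        refine norm_integral_le_of_norm_le ((integrable_const D).add (hi2.const_mul ε)) ?_
        exact (ae_restrict_iff' measurableSet_Ioo).2 (Eventually.of_forall hbound)
    _ = D * (n : ℝ)⁻¹ + ε * (q n (n : ℝ)⁻¹ ^ d / d) := by
        rw [integral_add (integrable_const D) (hi2.const_mul ε), integral_const_mul, hFTC]
        simp [mul_comm, hn0.le]
    _ < δ / 2 + δ / 2 := by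
        refine add_lt_add_of_lt_of_le hnD ?_
        have h7 : q n (n : ℝ)⁻¹ ^ d ≤ C ^ d := by
          have := H.amplitude_pos n hn _ ⟨inv_pos.2 hn0, hnR⟩
          have := H.amplitude_le n hn _ ⟨inv_pos.2 hn0, hnR⟩
          gcongr
        calc ε * (q n (n : ℝ)⁻¹ ^ d / d) ≤ ε * (C ^ d / d + 1) := by
              gcongr
              exact (div_le_div_of_nonneg_right h7 hd0.le).trans (le_add_of_nonneg_right zero_le_one)
          _ = δ / 2 := by rw [hεdef]; field_simp
    _ = δ := by ring

/-- Cutting off the core leaves a uniformly bounded integrand, and each fixed `R > 0` eventually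
lies outside the core, so dominated convergence applies. -/
theorem tendsto_integral_outer (H : IsConcentrating d Rbar C c p q u) (hd : 3 ≤ d)
    (hRbar : 0 < Rbar) (hc : 0 < c) (hh : ContinuousOn h (Ioi 0))
    (hL : Tendsto (fun v => h v / v) atTop (𝓝 L)) {P Q U : ℝ → ℝ}
    (hP : ∀ R ∈ Ioo 0 Rbar, 0 < P R) (hQ : ∀ R ∈ Ioo 0 Rbar, 0 < Q R)
    (hlim : ∀ᵐ R : ℝ, R ∈ Ioo 0 Rbar → Tendsto (fun n => p n R) atTop (𝓝 (P R)) ∧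
      Tendsto (fun n => q n R) atTop (𝓝 (Q R)) ∧ Tendsto (fun n => u n R) atTop (𝓝 (U R))) :
    Tendsto (fun n : ℕ => ∫ R in Ioo 0 Rbar, (Ioi (n : ℝ)⁻¹).indicator
        (fun R => shellEnergy d h (p n R) (q n R) (u n R) R) R) atTop
      (𝓝 (∫ R in Ioo 0 Rbar, shellEnergy d h (P R) (Q R) (U R) R)) := by
  obtain ⟨D, hD⟩ := H.exists_abs_shellEnergy_le hd hRbar hc hh hL C
  have hinv : Tendsto (fun n : ℕ => (n : ℝ)⁻¹) atTop (𝓝 0) := tendsto_inv_atTop_nhds_zero_nat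
  refine tendsto_integral_filter_of_dominated_convergence (fun _ => |D|) ?_ ?_
    (integrable_const _) ?_
  · filter_upwards [eventually_ge_atTop 1] with n hn
    exact ((H.continuousOn_shellEnergy hh hn).aestronglyMeasurable
      measurableSet_Ioo).indicator measurableSet_Ioi
  · filter_upwards [eventually_ge_atTop 1] with n hn
    refine (ae_restrict_iff' measurableSet_Ioo).2 (Eventually.of_forall fun R hR => ?_)
    by_cases hRn : R ∈ Ioi (n : ℝ)⁻¹
    · rw [indicator_of_mem hRn]
      exact (hD n hn R hR (H.stretch_le_of_le n hn R hR hRn)).trans (le_abs_self D)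
    · rw [indicator_of_notMem hRn, norm_zero]
      exact abs_nonneg D
  · refine (ae_restrict_iff' measurableSet_Ioo).2 ?_
    filter_upwards [hlim] with R hR hmem
    obtain ⟨h1, h2, h3⟩ := hR hmem
    have hv : Tendsto (fun n => p n R * (q n R / R) ^ (d - 1)) atTop
        (𝓝 (P R * (Q R / R) ^ (d - 1))) := h1.mul ((h2.div_const R).pow _)
    have hpos : 0 < P R * (Q R / R) ^ (d - 1) :=
      mul_pos (hP R hmem) (pow_pos (div_pos (hQ R hmem) hmem.1) _)
    have hhv := (hh.continuousAt (Ioi_mem_nhds hpos)).tendsto.comp hv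
    have hE : Tendsto (fun n => shellEnergy d h (p n R) (q n R) (u n R) R) atTop
        (𝓝 (shellEnergy d h (P R) (Q R) (U R) R)) :=
      (((h3.pow 2).const_mul (1 / 2)).add ((((h1.pow 2).add
        (((h2.div_const R).pow 2).const_mul ((d : ℝ) - 1))).const_mul (1 / 2)).add hhv)).const_mul _
    refine hE.congr' ?_
    filter_upwards [hinv.eventually_lt_const hmem.1] with n hn
    rw [indicator_of_mem (mem_Ioi.2 hn)]

/-- The energies converge to the energy of the limit and the energy `L q₀^d / d` of a cavity of
radius `q₀`. -/
theorem tendsto_integral (H : IsConcentrating d Rbar C c p q u) (hd : 3 ≤ d)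
    (hRbar : 0 < Rbar) (hc : 0 < c) (hh : ContinuousOn h (Ioi 0))
    (hL : Tendsto (fun v => h v / v) atTop (𝓝 L)) {P Q U : ℝ → ℝ} {q₀ : ℝ}
    (hP : ∀ R ∈ Ioo 0 Rbar, 0 < P R) (hQ : ∀ R ∈ Ioo 0 Rbar, 0 < Q R)
    (hlim : ∀ᵐ R : ℝ, R ∈ Ioo 0 Rbar → Tendsto (fun n => p n R) atTop (𝓝 (P R)) ∧
      Tendsto (fun n => q n R) atTop (𝓝 (Q R)) ∧ Tendsto (fun n => u n R) atTop (𝓝 (U R)))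
    (hq₀ : Tendsto (fun n : ℕ => q n (n : ℝ)⁻¹) atTop (𝓝 q₀)) :
    Tendsto (fun n : ℕ => ∫ R in Ioo 0 Rbar, shellEnergy d h (p n R) (q n R) (u n R) R) atTop
      (𝓝 ((∫ R in Ioo 0 Rbar, shellEnergy d h (P R) (Q R) (U R) R) + L * (q₀ ^ d / d))) := by
  refine ((H.tendsto_integral_outer hd hRbar hc hh hL hP hQ hlim).add
    (H.tendsto_integral_core hd hRbar hc hh hL hq₀)).congr' ?_
  have hinv : Tendsto (fun n : ℕ => (n : ℝ)⁻¹) atTop (𝓝 0) := tendsto_inv_atTop_nhds_zero_nat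
  filter_upwards [eventually_ge_atTop 1, hinv.eventually_lt_const hRbar] with n hn hnR
  have hi := H.integrableOn_shellEnergy hd hRbar hc hh hL hn
  -- The complement of the outer region contains the endpoint `1/n`, hence the half-open core.
  have h1 : Ioc 0 (n : ℝ)⁻¹ = Ioo 0 Rbar ∩ (Ioi (n : ℝ)⁻¹)ᶜ := by
    rw [compl_Ioi]
    ext R
    exact ⟨fun h => ⟨⟨h.1, h.2.trans_lt hnR⟩, h.2⟩, fun h => ⟨h.1.1, h.2⟩⟩
  rw [setIntegral_indicator measurableSet_Ioi, ← integral_Ioc_eq_integral_Ioo (y := (n : ℝ)⁻¹), h1]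
  exact integral_inter_add_sdiff measurableSet_Ioi hi

end IsConcentrating

end Concentration

/-! ### Mollification -/

section Mollify

theorem locallyIntegrable_of_continuousAt {f : ℝ → ℝ} {S : Set ℝ} (hS : S.Finite)
    (hc : ∀ x, x ∉ S → ContinuousAt f x)
    (hb : ∀ M : ℝ, ∃ C, ∀ x, x ∉ S → |x| ≤ M → |f x| ≤ C) : LocallyIntegrable f := by
  have hae : ∀ᵐ x : ℝ, x ∈ Sᶜ := by
    have : volume S = 0 := hS.measure_zero _
    simpa [ae_iff] using this
  have hm : AEStronglyMeasurable f volume := by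
    rw [← Measure.restrict_eq_self_of_ae_mem hae]
    exact ContinuousOn.aestronglyMeasurable (fun x hx => (hc x hx).continuousWithinAt)
      hS.measurableSet.compl
  intro x
  refine ⟨Metric.ball x 1, Metric.ball_mem_nhds x one_pos, ?_⟩
  obtain ⟨C, hC⟩ := hb (|x| + 1)
  refine IntegrableOn.of_bound measure_ball_lt_top hm.restrict C ?_
  refine (ae_restrict_iff' measurableSet_ball).2 ?_
  filter_upwards [hae] with z hz hzx
  refine hC z hz ?_
  have h1 : |z - x| < 1 := hzx
  have h2 := abs_add_le (z - x) x
  rw [sub_add_cancel] at h2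
  linarith

/-- The mollification of `F`. -/
def mollify (φ : ℝ → ℝ) (n : ℕ) (F : ℝ → ℝ) (R : ℝ) : ℝ :=
  ∫ z, scaledMollifier φ n z * F (R - z)

theorem mollify_eq_convolution (φ : ℝ → ℝ) (n : ℕ) (F : ℝ → ℝ) :
    mollify φ n F
      = convolution (scaledMollifier φ n) F (ContinuousLinearMap.lsmul ℝ ℝ) volume := rfl

variable {φ : ℝ → ℝ} {n : ℕ} {F v g : ℝ → ℝ}

theorem continuous_of_abs_sub_le {K : ℝ} (hv : ∀ x y, |v x - v y| ≤ K * |x - y|) :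
    Continuous v := by
  have : LipschitzWith (Real.toNNReal K) v := LipschitzWith.of_dist_le_mul fun x y => by
    rw [Real.dist_eq, Real.dist_eq]
    exact (hv x y).trans (mul_le_mul_of_nonneg_right (Real.le_coe_toNNReal K) (abs_nonneg _))
  exact this.continuous

namespace IsMollifier

theorem eq_zero (hφ : IsMollifier φ) {x : ℝ} (hx : 1 < |x|) : φ x = 0 :=
  image_eq_zero_of_notMem_tsupport fun h =>
    hx.not_ge (abs_le.2 (hφ.tsupport_subset h))

theorem continuous_scaled (hφ : IsMollifier φ) (n : ℕ) : Continuous (scaledMollifier φ n) :=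
  continuous_const.mul (hφ.contDiff.continuous.comp (continuous_const_mul _))

theorem scaled_nonneg (hφ : IsMollifier φ) (n : ℕ) (z : ℝ) : 0 ≤ scaledMollifier φ n z :=
  mul_nonneg n.cast_nonneg (hφ.nonneg _)

theorem scaled_neg (hφ : IsMollifier φ) (n : ℕ) (z : ℝ) :
    scaledMollifier φ n (-z) = scaledMollifier φ n z := by
  rw [scaledMollifier, scaledMollifier, mul_neg, hφ.symm]

theorem scaled_eq_zero (hφ : IsMollifier φ) (hn : 1 ≤ n) {z : ℝ} (hz : (n : ℝ)⁻¹ < |z|) :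
    scaledMollifier φ n z = 0 := by
  have hn0 : (0 : ℝ) < n := by exact_mod_cast hn
  rw [scaledMollifier, hφ.eq_zero, mul_zero]
  rwa [abs_mul, abs_of_pos hn0, ← div_lt_iff₀' hn0, one_div]

theorem hasCompactSupport_scaled (hφ : IsMollifier φ) (hn : 1 ≤ n) :
    HasCompactSupport (scaledMollifier φ n) :=
  HasCompactSupport.of_support_subset_isCompact
    (isCompact_Icc (a := -(n : ℝ)⁻¹) (b := (n : ℝ)⁻¹)) fun _ hz =>
      abs_le.1 (not_lt.1 fun h => hz (hφ.scaled_eq_zero hn h))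

theorem integrable_scaled (hφ : IsMollifier φ) (hn : 1 ≤ n) :
    Integrable (scaledMollifier φ n) :=
  (hφ.continuous_scaled n).integrable_of_hasCompactSupport (hφ.hasCompactSupport_scaled hn)

theorem integral_scaled (hφ : IsMollifier φ) (hn : 1 ≤ n) : ∫ z, scaledMollifier φ n z = 1 := by
  have hn0 : (0 : ℝ) < n := by exact_mod_cast hn
  simp only [scaledMollifier]
  rw [integral_const_mul, Measure.integral_comp_mul_left, hφ.integral_eq_one,
    abs_of_pos (inv_pos.2 hn0), smul_eq_mul, mul_one, mul_inv_cancel₀ hn0.ne']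

theorem integrable_mollify (hφ : IsMollifier φ) (hn : 1 ≤ n) (hF : LocallyIntegrable F) (R : ℝ) :
    Integrable fun z => scaledMollifier φ n z * F (R - z) :=
  (hφ.hasCompactSupport_scaled hn).convolutionExists_left (ContinuousLinearMap.lsmul ℝ ℝ)
    (hφ.continuous_scaled n) hF R

theorem continuous_mollify (hφ : IsMollifier φ) (hn : 1 ≤ n) (hF : LocallyIntegrable F) :
    Continuous (mollify φ n F) :=
  (hφ.hasCompactSupport_scaled hn).continuous_convolution_left (ContinuousLinearMap.lsmul ℝ ℝ)
    (hφ.continuous_scaled n) hF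

/-- The evaluation point may move with `n`; this is needed at the edge `1/n` of the core. -/
theorem tendsto_mollify (hφ : IsMollifier φ) (hF : LocallyIntegrable F) {x : ℝ}
    (hx : ContinuousAt F x) {k : ℕ → ℝ} (hk : Tendsto k atTop (𝓝 x)) :
    Tendsto (fun n => mollify φ n F (k n)) atTop (𝓝 (F x)) := by
  simp only [mollify_eq_convolution]
  refine convolution_tendsto_right (φ := fun n => scaledMollifier φ n) (g := fun _ => F)
    (Eventually.of_forall fun n => hφ.scaled_nonneg n) ?_ ?_
    (Eventually.of_forall fun _ => hF.aestronglyMeasurable) (hx.tendsto.comp tendsto_snd) hk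
  · filter_upwards [eventually_ge_atTop 1] with n hn using hφ.integral_scaled hn
  · rw [tendsto_smallSets_iff]
    intro U hU
    obtain ⟨ε, hε, hεU⟩ := Metric.mem_nhds_iff.1 hU
    filter_upwards [eventually_ge_atTop 1,
      tendsto_inv_atTop_nhds_zero_nat.eventually_lt_const hε] with n hn hnε _ hz
    refine hεU ?_
    rw [mem_ball_zero_iff, Real.norm_eq_abs]
    exact (not_lt.1 fun h => hz (hφ.scaled_eq_zero hn h)).trans_lt hnε

theorem abs_mollify_le (hφ : IsMollifier φ) (hn : 1 ≤ n) {C R : ℝ}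
    (hF : ∀ᵐ z : ℝ, |z| ≤ 1 → |F (R - z)| ≤ C) : |mollify φ n F R| ≤ C := by
  have hn1 : (n : ℝ)⁻¹ ≤ 1 := inv_le_one_of_one_le₀ (by exact_mod_cast hn)
  calc |mollify φ n F R| ≤ ∫ z, scaledMollifier φ n z * C := by
        rw [← Real.norm_eq_abs]
        refine norm_integral_le_of_norm_le ((hφ.integrable_scaled hn).mul_const C) ?_
        filter_upwards [hF] with z hz
        rw [norm_mul, Real.norm_of_nonneg (hφ.scaled_nonneg n z)]
        rcases le_or_gt |z| 1 with h1 | h1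
        · exact mul_le_mul_of_nonneg_left (hz h1) (hφ.scaled_nonneg n z)
        · rw [hφ.scaled_eq_zero hn (hn1.trans_lt h1), zero_mul, zero_mul]
    _ = C := by rw [integral_mul_const, hφ.integral_scaled hn, one_mul]

theorem mollify_eq_reflect (hφ : IsMollifier φ) (R : ℝ) :
    mollify φ n F R = ∫ z, scaledMollifier φ n z * F (R + z) := by
  rw [mollify, ← integral_neg_eq_self]
  simp only [hφ.scaled_neg, sub_neg_eq_add]

/-- As the mollifier is even, only the symmetric average of `F` about `R` matters. This gives lower
bounds where `F (R - z)` alone admits none. -/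
theorem le_mollify (hφ : IsMollifier φ) (hn : 1 ≤ n) (hF : LocallyIntegrable F) {b R : ℝ}
    (hb : ∀ᵐ z : ℝ, 2 * b ≤ F (R - z) + F (R + z)) : b ≤ mollify φ n F R := by
  have hi := hφ.integrable_mollify hn hF R
  have hi' : Integrable fun z => scaledMollifier φ n z * F (R + z) := by
    refine (hi.comp_neg).congr (Eventually.of_forall fun z => ?_)
    simp only [hφ.scaled_neg, sub_neg_eq_add]
  have h1 : 2 * mollify φ n F R
      = ∫ z, (scaledMollifier φ n z * F (R - z) + scaledMollifier φ n z * F (R + z)) := by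
    rw [integral_add hi hi', ← hφ.mollify_eq_reflect, two_mul]
    rfl
  have h2 : ∫ z, scaledMollifier φ n z * (2 * b)
      ≤ ∫ z, (scaledMollifier φ n z * F (R - z) + scaledMollifier φ n z * F (R + z)) := by
    refine integral_mono_ae ((hφ.integrable_scaled hn).mul_const _) (hi.add hi') ?_
    filter_upwards [hb] with z hz
    have := mul_le_mul_of_nonneg_left hz (hφ.scaled_nonneg n z)
    linarith
  rw [integral_mul_const, hφ.integral_scaled hn, one_mul, ← h1] at h2
  linarith

/-- The derivative is put on the Lipschitz factor rather than on the mollifier, so it becomes the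
mollification of the almost everywhere derivative. -/
theorem hasDerivAt_mollify (hφ : IsMollifier φ) (hn : 1 ≤ n) {K : ℝ} (hK : 0 ≤ K)
    (hv : ∀ x y, |v x - v y| ≤ K * |x - y|) {S : Set ℝ} (hS : S.Countable)
    (hd : ∀ x, x ∉ S → HasDerivAt v (g x) x) (hg : LocallyIntegrable g) (R : ℝ) :
    HasDerivAt (mollify φ n v) (mollify φ n g R) R := by
  have hvc := continuous_of_abs_sub_le hv
  refine (hasDerivAt_integral_of_dominated_loc_of_lip (s := univ)
    (bound := fun z => scaledMollifier φ n z * K) univ_mem ?_ ?_ ?_ ?_ ?_ ?_).2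
  · exact Eventually.of_forall fun R =>
      (hφ.integrable_mollify hn hvc.locallyIntegrable R).aestronglyMeasurable
  · exact hφ.integrable_mollify hn hvc.locallyIntegrable R
  · exact (hφ.integrable_mollify hn hg R).aestronglyMeasurable
  · refine Eventually.of_forall fun z => LipschitzOnWith.of_dist_le_mul fun x _ y _ => ?_
    have h0 := hφ.scaled_nonneg n z
    rw [Real.dist_eq, Real.dist_eq, Real.coe_nnabs, abs_of_nonneg (mul_nonneg h0 hK), ← mul_sub,
      abs_mul, abs_of_nonneg h0, mul_assoc]
    have := hv (x - z) (y - z)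
    rw [sub_sub_sub_cancel_right] at this
    exact mul_le_mul_of_nonneg_left this h0
  · exact (hφ.integrable_scaled hn).mul_const K
  · have hS' : ((fun z => R - z) ⁻¹' S).Countable :=
      hS.preimage (sub_right_injective)
    filter_upwards [hS'.ae_notMem volume] with z hz
    have := (hd (R - z) hz).comp R ((hasDerivAt_id' R).sub_const z)
    rw [mul_one] at this
    exact this.const_mul _

/-- The mass of the mollifier on `[0,R]`. -/
theorem hasDerivAt_mass (hφ : IsMollifier φ) (n : ℕ) (R : ℝ) :
    HasDerivAt (fun R => ∫ z in (0 : ℝ)..R, scaledMollifier φ n z) (scaledMollifier φ n R) R :=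
  ((hφ.continuous_scaled n).integral_hasStrictDerivAt 0 R).hasDerivAt

theorem mass_neg (hφ : IsMollifier φ) (n : ℕ) (R : ℝ) :
    ∫ z in (-R)..0, scaledMollifier φ n z = ∫ z in (0 : ℝ)..R, scaledMollifier φ n z := by
  have h1 := intervalIntegral.integral_comp_neg (scaledMollifier φ n) (a := 0) (b := R)
  rw [neg_zero] at h1
  rw [← h1]
  simp only [hφ.scaled_neg]

theorem two_mul_mass (hφ : IsMollifier φ) (n : ℕ) (R : ℝ) :
    ∫ z in (-R)..R, scaledMollifier φ n z = 2 * ∫ z in (0 : ℝ)..R, scaledMollifier φ n z := by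
  have hi : ∀ a b, IntervalIntegrable (scaledMollifier φ n) volume a b := fun a b =>
    (hφ.continuous_scaled n).intervalIntegrable a b
  rw [← intervalIntegral.integral_add_adjacent_intervals (hi (-R) 0) (hi 0 R), hφ.mass_neg, two_mul]

theorem mass_mono (hφ : IsMollifier φ) (n : ℕ) :
    Monotone fun R => ∫ z in (0 : ℝ)..R, scaledMollifier φ n z :=
  monotone_of_deriv_nonneg (fun R => (hφ.hasDerivAt_mass n R).differentiableAt) fun R => by
    rw [(hφ.hasDerivAt_mass n R).deriv]; exact hφ.scaled_nonneg n R

theorem mass_eq_half (hφ : IsMollifier φ) (hn : 1 ≤ n) {R : ℝ} (hR : (n : ℝ)⁻¹ ≤ R) :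
    ∫ z in (0 : ℝ)..R, scaledMollifier φ n z = 1 / 2 := by
  have hn0 : (0 : ℝ) < n := by exact_mod_cast hn
  have hR0 : 0 < R := (inv_pos.2 hn0).trans_le hR
  have h1 := hφ.two_mul_mass n R
  have h2 : ∫ z in (-R)..R, scaledMollifier φ n z = 1 := by
    rw [← hφ.integral_scaled hn, intervalIntegral.integral_of_le (by linarith)]
    rw [integral_Ioc_eq_integral_Ioo, ← integral_Icc_eq_integral_Ioo]
    refine setIntegral_eq_integral_of_forall_compl_eq_zero fun z hz => ?_
    refine hφ.scaled_eq_zero hn (hR.trans_lt ?_)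
    by_contra! h
    exact hz (abs_le.1 h)
  linarith

theorem mass_le_half (hφ : IsMollifier φ) (hn : 1 ≤ n) (R : ℝ) :
    ∫ z in (0 : ℝ)..R, scaledMollifier φ n z ≤ 1 / 2 := by
  rw [← hφ.mass_eq_half hn (le_max_right R (n : ℝ)⁻¹)]
  exact hφ.mass_mono n (le_max_left _ _)

/-- The condition `φ 0 > 0` enters here. It makes the mollified jump stretch every point near the
origin at a rate of order `n`. -/
theorem exists_pos_near_zero (hφ : IsMollifier φ) :
    ∃ c ε, 0 < c ∧ 0 < ε ∧ ∀ x, |x| ≤ ε → c ≤ φ x := by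
  have h1 := (hφ.contDiff.continuous.tendsto 0).eventually_const_lt (half_lt_self hφ.pos_zero)
  obtain ⟨ε, hε, hε'⟩ := Metric.eventually_nhds_iff.1 h1
  refine ⟨φ 0 / 2, ε / 2, half_pos hφ.pos_zero, half_pos hε, fun x hx => (hε' ?_).le⟩
  rw [Real.dist_eq, sub_zero]
  linarith

theorem exists_le (hφ : IsMollifier φ) : ∃ C, 0 ≤ C ∧ ∀ x, φ x ≤ C := by
  have hc : HasCompactSupport φ :=
    isCompact_Icc.of_isClosed_subset (isClosed_tsupport φ) hφ.tsupport_subset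
  obtain ⟨C, hC⟩ := hc.exists_bound_of_continuous hφ.contDiff.continuous
  exact ⟨C, (norm_nonneg _).trans (hC 0), fun x => (le_abs_self _).trans (hC x)⟩

theorem le_mass (hφ : IsMollifier φ) {c ε : ℝ} (hc : ∀ x, |x| ≤ ε → c ≤ φ x)
    {R : ℝ} (hR : 0 ≤ R) (hRε : n * R ≤ ε) :
    c * (n * R) ≤ ∫ z in (0 : ℝ)..R, scaledMollifier φ n z := by
  have h1 : ∫ _z in (0 : ℝ)..R, n * c ≤ ∫ z in (0 : ℝ)..R, scaledMollifier φ n z := by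
    refine intervalIntegral.integral_mono_on hR (by simp)
      ((hφ.continuous_scaled n).intervalIntegrable _ _) fun z hz => ?_
    refine mul_le_mul_of_nonneg_left (hc _ ?_) n.cast_nonneg
    rw [abs_of_nonneg (mul_nonneg n.cast_nonneg hz.1)]
    exact (mul_le_mul_of_nonneg_left hz.2 n.cast_nonneg).trans hRε
  rw [intervalIntegral.integral_const, smul_eq_mul, sub_zero] at h1
  linarith

theorem integrableOn_shift (hφ : IsMollifier φ) (hn : 1 ≤ n) (a b : ℝ) :
    IntegrableOn (fun ρ => scaledMollifier φ n (ρ + a)) (Ioi b) :=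
  ((hφ.integrable_scaled hn).comp_add_right a).integrableOn

theorem integral_Ioi_shift (φ : ℝ → ℝ) (n : ℕ) (a : ℝ) :
    ∫ ρ in Ioi 0, scaledMollifier φ n (ρ + a) = ∫ z in Ioi a, scaledMollifier φ n z := by
  have := (measurePreserving_add_right (volume : Measure ℝ) a).setIntegral_preimage_emb
    (measurableEmbedding_addRight a) (scaledMollifier φ n) (Ioi a)
  rw [← this]
  congr 2
  ext x; simp

/-- The mollified amplitude of `R ↦ c + v(R)`, where `v` is continuous and odd. -/
theorem mollifiedAmplitude_eq (hφ : IsMollifier φ) (hn : 1 ≤ n) {w : ℝ → ℝ → ℝ} {t c : ℝ}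
    (hv : Continuous v) (hodd : ∀ x, v (-x) = -v x) (hw : ∀ ρ, 0 < ρ → w ρ t = c + v ρ) (R : ℝ) :
    mollifiedAmplitude φ n w R t
      = 2 * c * (∫ z in (0 : ℝ)..R, scaledMollifier φ n z) + mollify φ n v R := by
  have hi : Integrable fun ρ => scaledMollifier φ n (R - ρ) * v ρ := by
    have := (hφ.integrable_mollify hn hv.locallyIntegrable R).comp_sub_left R
    simpa using this
  have hflip : ∀ ρ, scaledMollifier φ n (R - ρ) = scaledMollifier φ n (ρ + -R) := fun ρ => by
    rw [← hφ.scaled_neg]; congr 1; ring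
  have hadd : ∀ ρ, scaledMollifier φ n (R + ρ) = scaledMollifier φ n (ρ + R) := fun ρ => by
    rw [add_comm]
  have hi1 : IntegrableOn (fun ρ => scaledMollifier φ n (R - ρ)) (Ioi 0) := by
    simp only [hflip]; exact hφ.integrableOn_shift hn _ _
  have hi2 : IntegrableOn (fun ρ => scaledMollifier φ n (R + ρ)) (Ioi 0) := by
    simp only [hadd]; exact hφ.integrableOn_shift hn _ _
  have hi3 : IntegrableOn (fun ρ => scaledMollifier φ n (R + ρ) * v ρ) (Ioi 0) := by
    have := hi.comp_neg.neg
    refine (this.congr (Eventually.of_forall fun ρ => ?_)).integrableOn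
    simp [hodd]
  have h1 : ∫ ρ in Ioi 0, scaledMollifier φ n (R - ρ) * w ρ t
      = c * (∫ z in Ioi (-R), scaledMollifier φ n z)
        + ∫ ρ in Ioi 0, scaledMollifier φ n (R - ρ) * v ρ := by
    have e : ∫ z in Ioi (-R), scaledMollifier φ n z
        = ∫ ρ in Ioi 0, scaledMollifier φ n (R - ρ) := by
      simp only [hflip, integral_Ioi_shift]
    rw [e, ← integral_const_mul]
    rw [← integral_add (hi1.const_mul c) hi.integrableOn]
    refine setIntegral_congr_fun measurableSet_Ioi fun ρ hρ => ?_
    rw [hw ρ hρ]; ring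
  have h2 : ∫ ρ in Ioi 0, scaledMollifier φ n (R + ρ) * w ρ t
      = c * (∫ z in Ioi R, scaledMollifier φ n z)
        + ∫ ρ in Ioi 0, scaledMollifier φ n (R + ρ) * v ρ := by
    have e : ∫ z in Ioi R, scaledMollifier φ n z
        = ∫ ρ in Ioi 0, scaledMollifier φ n (R + ρ) := by
      simp only [hadd, integral_Ioi_shift]
    rw [e, ← integral_const_mul]
    rw [← integral_add (hi2.const_mul c) hi3]
    refine setIntegral_congr_fun measurableSet_Ioi fun ρ hρ => ?_
    rw [hw ρ hρ]; ring
  -- By oddness, the reflected integral is minus the missing half of the convolution. For the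
  -- constant part the two half-lines differ by `[-R,R]`, which is `h6`.
  have h3 : ∫ ρ in Ioi 0, scaledMollifier φ n (R + ρ) * v ρ
      = -∫ ρ in Iic 0, scaledMollifier φ n (R - ρ) * v ρ := by
    have := integral_comp_neg_Ioi 0 fun ρ => scaledMollifier φ n (R - ρ) * v ρ
    rw [neg_zero] at this
    rw [← this, ← integral_neg]
    simp [hodd]
  have h4 : (∫ ρ in Ioi 0, scaledMollifier φ n (R - ρ) * v ρ)
      + ∫ ρ in Iic 0, scaledMollifier φ n (R - ρ) * v ρ = mollify φ n v R := by
    have h5 := integral_add_compl (measurableSet_Iic (a := (0 : ℝ))) hi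
    rw [compl_Iic] at h5
    rw [add_comm, h5, mollify, ← integral_sub_left_eq_self _ volume R]
    simp
  have h6 := intervalIntegral.integral_Ioi_sub_Ioi' (a := -R) (b := R)
    (hφ.integrable_scaled hn).integrableOn (hφ.integrable_scaled hn).integrableOn
  rw [hφ.two_mul_mass] at h6
  rw [mollifiedAmplitude, h1, h2, h3, ← h4]
  linear_combination c * h6

end IsMollifier

end Mollify

/-! ### The odd extension of the profile -/

section OddExtension

/-- The odd extension of `r - r(0)`. -/
def oddProfile (r : ℝ → ℝ) (s : ℝ) : ℝ := if 0 ≤ s then r |s| - r 0 else -(r |s| - r 0)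

theorem oddProfile_of_pos (r : ℝ → ℝ) {s : ℝ} (hs : 0 < s) : oddProfile r s = r s - r 0 := by
  rw [oddProfile, if_pos hs.le, abs_of_pos hs]

theorem oddProfile_zero (r : ℝ → ℝ) : oddProfile r 0 = 0 := by simp [oddProfile]

theorem oddProfile_neg (r : ℝ → ℝ) (s : ℝ) : oddProfile r (-s) = -oddProfile r s := by
  rcases lt_trichotomy s 0 with h | rfl | h
  · simp [oddProfile, h.le, h.not_ge]
  · simp [oddProfile]
  · simp [oddProfile, h.le, h.not_ge]

/-- The even extension of the radial stretch. -/
def evenStretch (lam σ : ℝ) (r : ℝ → ℝ) (s : ℝ) : ℝ := radialStretch lam σ r |s|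

variable {d : ℕ} {h : ℝ → ℝ} {lam σ : ℝ} {r : ℝ → ℝ}

namespace IsCavitatingSolution

theorem continuous_oddProfile (hr : IsCavitatingSolution d h lam σ r) :
    Continuous (oddProfile r) := by
  have h1 : Continuous fun s : ℝ => r |s| - r 0 :=
    (hr.continuousOn.comp_continuous continuous_abs fun s => abs_nonneg s).sub continuous_const
  refine Continuous.if_le h1 h1.neg continuous_const continuous_id fun s hs => ?_
  have hs : (0 : ℝ) = s := hs
  simp [← hs]

theorem hasDerivAt_oddProfile (hr : IsCavitatingSolution d h lam σ r) {s : ℝ}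
    (hs : s ∉ ({0, σ, -σ} : Set ℝ)) :
    HasDerivAt (oddProfile r) (evenStretch lam σ r s) s := by
  simp only [mem_insert_iff, mem_singleton_iff, not_or] at hs
  obtain ⟨h0, h1, h2⟩ := hs
  rcases lt_or_gt_of_ne h0 with hs | hs
  · have h3 : HasDerivAt (fun z => -(r (-z) - r 0)) (evenStretch lam σ r s) s := by
      have h4 := ((hr.hasDerivAt (neg_pos.2 hs) fun h => h2 (by linarith)).comp s
        (hasDerivAt_neg s)).sub_const (r 0) |>.fun_neg
      rw [evenStretch, abs_of_neg hs]
      simpa using h4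
    refine h3.congr_of_eventuallyEq ?_
    filter_upwards [Iio_mem_nhds hs] with z hz
    rw [oddProfile, if_neg (not_le.2 hz), abs_of_neg hz]
  · rw [evenStretch, abs_of_pos hs]
    refine ((hr.hasDerivAt hs h1).sub_const (r 0)).congr_of_eventuallyEq ?_
    filter_upwards [Ioi_mem_nhds hs] with z hz using oddProfile_of_pos r hz

theorem continuousAt_evenStretch (hr : IsCavitatingSolution d h lam σ r) {s : ℝ}
    (hs : s ∉ ({0, σ, -σ} : Set ℝ)) : ContinuousAt (evenStretch lam σ r) s := by
  simp only [mem_insert_iff, mem_singleton_iff, not_or] at hs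
  refine ContinuousAt.comp (g := radialStretch lam σ r) (f := fun s : ℝ => |s|)
    (hr.continuousAt_radialStretch (abs_pos.2 hs.1) fun h => ?_) continuous_abs.continuousAt
  rcases abs_choice s with h' | h' <;> rw [h'] at h
  · exact hs.2.1 h
  · exact hs.2.2 (by linarith)

theorem continuousAt_evenStretch_div (hr : IsCavitatingSolution d h lam σ r) {t x : ℝ}
    (ht : 0 < t) (hx : x ∉ ({0, t * σ, -(t * σ)} : Set ℝ)) :
    x / t ∉ ({0, σ, -σ} : Set ℝ) ∧ ContinuousAt (fun x => evenStretch lam σ r (x / t)) x := by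
  have h1 : x / t ∉ ({0, σ, -σ} : Set ℝ) := by
    simp only [mem_insert_iff, mem_singleton_iff, not_or, div_eq_iff ht.ne'] at hx ⊢
    exact ⟨by simpa using hx.1, by rw [mul_comm]; exact hx.2.1,
      by rw [neg_mul, mul_comm]; exact hx.2.2⟩
  exact ⟨h1, ContinuousAt.comp (g := evenStretch lam σ r) (f := fun x => x / t)
    (hr.continuousAt_evenStretch h1) (continuous_id.div_const t).continuousAt⟩

theorem locallyIntegrable_evenStretch (hr : IsCavitatingSolution d h lam σ r) {K : ℝ}
    (hK : ∀ s, s ≠ 0 → |evenStretch lam σ r s| ≤ K) {t : ℝ} (ht : 0 < t) :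
    LocallyIntegrable fun x => evenStretch lam σ r (x / t) :=
  locallyIntegrable_of_continuousAt (S := {0, t * σ, -(t * σ)}) (toFinite _)
    (fun _ hx => (hr.continuousAt_evenStretch_div ht hx).2)
    fun _ => ⟨K, fun _ hx _ => hK _ fun h =>
      (hr.continuousAt_evenStretch_div ht hx).1 (Or.inl h)⟩

/-- The derivative is known only off three points, which is harmless for a continuous function with
bounded derivative. Lipschitz continuity and monotonicity across `0` and the front both follow. -/
theorem oddProfile_sub (hr : IsCavitatingSolution d h lam σ r) {K : ℝ}
    (hK : ∀ s, s ≠ 0 → |evenStretch lam σ r s| ≤ K) (x y : ℝ) :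
    ∫ s in x..y, evenStretch lam σ r s = oddProfile r y - oddProfile r x := by
  have hint : LocallyIntegrable (evenStretch lam σ r) := by
    simpa using hr.locallyIntegrable_evenStretch hK one_pos
  exact integral_eq_of_hasDerivAt_off_countable _ _ (toFinite ({0, σ, -σ} : Set ℝ)).countable
    hr.continuous_oddProfile.continuousOn (fun s hs => hr.hasDerivAt_oddProfile hs.2)
    ((hint.integrableOn_isCompact isCompact_uIcc).intervalIntegrable)

theorem abs_oddProfile_sub_le (hr : IsCavitatingSolution d h lam σ r) {K : ℝ}
    (hK : ∀ s, s ≠ 0 → |evenStretch lam σ r s| ≤ K) (x y : ℝ) :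
    |oddProfile r x - oddProfile r y| ≤ K * |x - y| := by
  rw [← hr.oddProfile_sub hK, ← Real.norm_eq_abs]
  refine intervalIntegral.norm_integral_le_of_norm_le_const_ae ?_
  filter_upwards [Measure.ae_ne volume (0 : ℝ)] with s hs _ using hK s hs

theorem monotone_oddProfile (hr : IsCavitatingSolution d h lam σ r) (hlam : 0 < lam) {K : ℝ}
    (hK : ∀ s, s ≠ 0 → |evenStretch lam σ r s| ≤ K) : Monotone (oddProfile r) := by
  intro x y hxy
  rw [← sub_nonneg, ← hr.oddProfile_sub hK]
  refine intervalIntegral.integral_nonneg_of_ae_restrict hxy ?_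
  refine ae_restrict_of_ae ?_
  filter_upwards [Measure.ae_ne volume (0 : ℝ)] with s hs
  exact (hr.radialStretch_pos hlam (abs_pos.2 hs)).le

theorem exists_evenStretch_le (hr : IsCavitatingSolution d h lam σ r) (hd : 2 ≤ d)
    (hh : IsEnergyFunction h) (hlam : 0 < lam) :
    ∃ K, 0 < K ∧ ∀ s, s ≠ 0 → |evenStretch lam σ r s| ≤ K := by
  obtain ⟨K, hK0, hK⟩ := hr.exists_radialStretch_le hd hh hlam
  refine ⟨K, hK0, fun s hs => ?_⟩
  rw [evenStretch, abs_of_pos (hr.radialStretch_pos hlam (abs_pos.2 hs))]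
  exact hK _ (abs_pos.2 hs)

end IsCavitatingSolution

end OddExtension

/-! ### Mollification of the cavitating solution -/

section MollifiedSolution

/-- The mollification `w^n`. -/
def mollifiedPosition (φ : ℝ → ℝ) (r : ℝ → ℝ) (t : ℝ) (n : ℕ) (R : ℝ) : ℝ :=
  2 * (t * r 0) * (∫ z in (0 : ℝ)..R, scaledMollifier φ n z)
    + mollify φ n (fun x => t * oddProfile r (x / t)) R

/-- The radial derivative of the mollification `w^n`. -/
def mollifiedStretch (φ : ℝ → ℝ) (lam σ : ℝ) (r : ℝ → ℝ) (t : ℝ) (n : ℕ) (R : ℝ) : ℝ :=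
  2 * (t * r 0) * scaledMollifier φ n R + mollify φ n (fun x => evenStretch lam σ r (x / t)) R

/-- The odd part of the time derivative of the self-similar amplitude. -/
def oddVelocity (lam σ : ℝ) (r : ℝ → ℝ) (s : ℝ) : ℝ :=
  oddProfile r s - s * evenStretch lam σ r s

/-- The time derivative of the mollification `w^n`. -/
def mollifiedVelocity (φ : ℝ → ℝ) (lam σ : ℝ) (r : ℝ → ℝ) (t : ℝ) (n : ℕ) (R : ℝ) : ℝ :=
  2 * r 0 * (∫ z in (0 : ℝ)..R, scaledMollifier φ n z)
    + mollify φ n (fun x => oddVelocity lam σ r (x / t)) R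

variable {d : ℕ} {h : ℝ → ℝ} {lam σ : ℝ} {r : ℝ → ℝ} {φ : ℝ → ℝ} {n : ℕ} {t K : ℝ}

namespace IsCavitatingSolution

theorem mollifiedAmplitude_eq (hr : IsCavitatingSolution d h lam σ r) (hφ : IsMollifier φ)
    (hn : 1 ≤ n) (ht : 0 < t) (R : ℝ) :
    mollifiedAmplitude φ n (selfSimilarAmplitude lam r) R t = mollifiedPosition φ r t n R := by
  refine hφ.mollifiedAmplitude_eq hn (v := fun x => t * oddProfile r (x / t))
    (continuous_const.mul (hr.continuous_oddProfile.comp (continuous_id.div_const t)))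
    (fun x => ?_) (fun ρ hρ => ?_) R
  · rw [neg_div, oddProfile_neg, mul_neg]
  · rw [selfSimilarAmplitude, if_pos ht, oddProfile_of_pos r (div_pos hρ ht)]
    ring

theorem abs_scaled_sub_le (hr : IsCavitatingSolution d h lam σ r)
    (hK : ∀ s, s ≠ 0 → |evenStretch lam σ r s| ≤ K) (ht : 0 < t) (x y : ℝ) :
    |t * oddProfile r (x / t) - t * oddProfile r (y / t)| ≤ K * |x - y| := by
  have h1 := mul_le_mul_of_nonneg_left (hr.abs_oddProfile_sub_le hK (x / t) (y / t)) ht.le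
  rw [← mul_sub, abs_mul, abs_of_pos ht]
  refine h1.trans_eq ?_
  rw [← sub_div, abs_div, abs_of_pos ht]
  field_simp

/-- The jump `2 t r(0)` of the odd extension produces the spike `2 t r(0) φ_n`; the Lipschitz part
contributes a bounded mollified derivative. -/
theorem hasDerivAt_mollifiedPosition (hr : IsCavitatingSolution d h lam σ r) (hφ : IsMollifier φ)
    (hn : 1 ≤ n) (ht : 0 < t) (hK0 : 0 ≤ K) (hK : ∀ s, s ≠ 0 → |evenStretch lam σ r s| ≤ K)
    (R : ℝ) : HasDerivAt (mollifiedPosition φ r t n) (mollifiedStretch φ lam σ r t n R) R := by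
  refine ((hφ.hasDerivAt_mass n R).const_mul (2 * (t * r 0))).fun_add ?_
  refine hφ.hasDerivAt_mollify hn hK0 (hr.abs_scaled_sub_le hK ht)
    (toFinite ({0, t * σ, -(t * σ)} : Set ℝ)).countable (fun x hx => ?_)
    (hr.locallyIntegrable_evenStretch hK ht) R
  have h1 := ((hr.hasDerivAt_oddProfile (hr.continuousAt_evenStretch_div ht hx).1).comp x
    ((hasDerivAt_id' x).div_const t)).const_mul t
  refine h1.congr_deriv ?_
  field_simp

theorem abs_oddVelocity_le (hr : IsCavitatingSolution d h lam σ r)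
    (hK : ∀ s, s ≠ 0 → |evenStretch lam σ r s| ≤ K) (s : ℝ) :
    |oddVelocity lam σ r s| ≤ 2 * K * |s| := by
  rw [oddVelocity]
  have h1 := hr.abs_oddProfile_sub_le hK s 0
  rw [oddProfile_zero, sub_zero, sub_zero] at h1
  have h2 : |s * evenStretch lam σ r s| ≤ |s| * K := by
    by_cases hs : s = 0
    · simp [hs]
    · rw [abs_mul]; exact mul_le_mul_of_nonneg_left (hK s hs) (abs_nonneg s)
  have h3 := abs_sub (oddProfile r s) (s * evenStretch lam σ r s)
  linarith

theorem continuousAt_oddVelocity (hr : IsCavitatingSolution d h lam σ r) (ht : 0 < t) {x : ℝ}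
    (hx : x ∉ ({0, t * σ, -(t * σ)} : Set ℝ)) :
    ContinuousAt (fun x => oddVelocity lam σ r (x / t)) x :=
  ((hr.continuous_oddProfile.comp (continuous_id.div_const t)).continuousAt).sub
    (((continuous_id.div_const t).continuousAt).mul (hr.continuousAt_evenStretch_div ht hx).2)

theorem locallyIntegrable_oddVelocity (hr : IsCavitatingSolution d h lam σ r) (hK0 : 0 ≤ K)
    (hK : ∀ s, s ≠ 0 → |evenStretch lam σ r s| ≤ K) (ht : 0 < t) :
    LocallyIntegrable fun x => oddVelocity lam σ r (x / t) := by
  refine locallyIntegrable_of_continuousAt (S := {0, t * σ, -(t * σ)}) (toFinite _)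
    (fun x hx => hr.continuousAt_oddVelocity ht hx)
    fun M => ⟨2 * K * (M / t), fun x _ hM => ?_⟩
  refine (hr.abs_oddVelocity_le hK (x / t)).trans ?_
  rw [abs_div, abs_of_pos ht]
  gcongr

/-- Differentiation under the integral needs `τ ↦ τ v(x/τ)` to be Lipschitz near `t`. This holds
with a constant proportional to `|x|`, since `v` is Lipschitz and `v 0 = 0`. -/
theorem hasDerivAt_mollifiedPosition_time (hr : IsCavitatingSolution d h lam σ r)
    (hφ : IsMollifier φ) (hn : 1 ≤ n) (ht : 0 < t) (hK0 : 0 ≤ K)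
    (hK : ∀ s, s ≠ 0 → |evenStretch lam σ r s| ≤ K) (R : ℝ) :
    HasDerivAt (fun τ => mollifiedPosition φ r τ n R) (mollifiedVelocity φ lam σ r t n R) t := by
  have h1 : HasDerivAt
      (fun τ => 2 * (τ * r 0) * ∫ z in (0 : ℝ)..R, scaledMollifier φ n z)
      (2 * r 0 * ∫ z in (0 : ℝ)..R, scaledMollifier φ n z) t := by
    have := (((hasDerivAt_id' t).mul_const (r 0)).const_mul 2).mul_const
      (∫ z in (0 : ℝ)..R, scaledMollifier φ n z)
    simpa using this
  refine h1.fun_add ?_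
  have hcont : ∀ τ, Continuous fun x => τ * oddProfile r (x / τ) := fun τ =>
    continuous_const.mul (hr.continuous_oddProfile.comp (continuous_id.div_const τ))
  refine (hasDerivAt_integral_of_dominated_loc_of_lip (s := Ioo (t / 2) (2 * t))
    (bound := fun z => scaledMollifier φ n z * (4 * K / t * |R - z|))
    (Ioo_mem_nhds (by linarith) (by linarith)) ?_ ?_ ?_ ?_ ?_ ?_).2
  · exact Eventually.of_forall fun τ =>
      (hφ.integrable_mollify hn (hcont τ).locallyIntegrable R).aestronglyMeasurable
  · exact hφ.integrable_mollify hn (hcont t).locallyIntegrable R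
  · exact (hφ.integrable_mollify hn
      (hr.locallyIntegrable_oddVelocity hK0 hK ht) R).aestronglyMeasurable
  · refine Eventually.of_forall fun z => LipschitzOnWith.of_dist_le_mul fun τ hτ τ' hτ' => ?_
    have h0 := hφ.scaled_nonneg n z
    have hτ0 : 0 < τ := (half_pos ht).trans hτ.1
    have hτ0' : 0 < τ' := (half_pos ht).trans hτ'.1
    rw [Real.dist_eq, Real.dist_eq, Real.coe_nnabs,
      abs_of_nonneg (mul_nonneg h0 (by positivity)), ← mul_sub, abs_mul, abs_of_nonneg h0,
      mul_assoc]
    refine mul_le_mul_of_nonneg_left ?_ h0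
    generalize R - z = x
    have e1 := hr.abs_oddProfile_sub_le hK (x / τ) 0
    rw [oddProfile_zero, sub_zero, sub_zero, abs_div, abs_of_pos hτ0] at e1
    have e2 := hr.abs_oddProfile_sub_le hK (x / τ) (x / τ')
    have e3 : |x / τ - x / τ'| = |x| / (τ * τ') * |τ - τ'| := by
      rw [show x / τ - x / τ' = x / (τ * τ') * (τ' - τ) by field_simp, abs_mul, abs_div,
        abs_of_pos (mul_pos hτ0 hτ0'), abs_sub_comm]
    have e4 : τ * oddProfile r (x / τ) - τ' * oddProfile r (x / τ')
        = (τ - τ') * oddProfile r (x / τ)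
          + τ' * (oddProfile r (x / τ) - oddProfile r (x / τ')) := by ring
    -- This uses `τ > t / 2`; the two halves of the difference each contribute `K * |x| / τ`, whence
    -- `4 * K / t`.
    have e5 : |x| / τ ≤ 2 / t * |x| := by
      rw [div_mul_eq_mul_div, div_le_div_iff₀ hτ0 ht]
      have := mul_le_mul_of_nonneg_left hτ.1.le (abs_nonneg x)
      linarith
    rw [e4]
    calc |(τ - τ') * oddProfile r (x / τ) + τ' * (oddProfile r (x / τ) - oddProfile r (x / τ'))|
        ≤ |τ - τ'| * (K * (|x| / τ)) + τ' * (K * (|x| / (τ * τ') * |τ - τ'|)) := by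
          refine (abs_add_le _ _).trans (add_le_add ?_ ?_)
          · rw [abs_mul]; gcongr
          · rw [abs_mul, abs_of_pos hτ0', ← e3]; gcongr
      _ = 2 * K * (|x| / τ) * |τ - τ'| := by field_simp; ring
      _ ≤ 2 * K * (2 / t * |x|) * |τ - τ'| := by gcongr
      _ = 4 * K / t * |x| * |τ - τ'| := by ring
  · have : Continuous fun x : ℝ => 4 * K / t * |x| := by fun_prop
    exact hφ.integrable_mollify hn this.locallyIntegrable R
  · have hS : ((fun z => R - z) ⁻¹' ({0, t * σ, -(t * σ)} : Set ℝ)).Countable :=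
      (toFinite _).countable.preimage (sub_right_injective)
    filter_upwards [hS.ae_notMem volume] with z hz
    have hd0 := hr.hasDerivAt_oddProfile (hr.continuousAt_evenStretch_div ht hz).1
    have h2 : HasDerivAt (fun τ => (R - z) / τ) (-(R - z) / t ^ 2) t := by
      simpa using (hasDerivAt_const t (R - z)).fun_div (hasDerivAt_id' t) ht.ne'
    have h3 := ((hasDerivAt_id' t).fun_mul (hd0.comp t h2)).const_mul (scaledMollifier φ n z)
    refine h3.congr_deriv ?_
    simp only [Function.comp_apply, oddVelocity]
    field_simp
    ring

end IsCavitatingSolution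

end MollifiedSolution

/-! ### Uniform bounds and limits of the mollified cavitating solution. -/

section MollifiedBounds

variable {d : ℕ} {h : ℝ → ℝ} {lam σ : ℝ} {r : ℝ → ℝ} {φ : ℝ → ℝ} {n : ℕ} {t K : ℝ}

namespace IsCavitatingSolution

theorem ae_sub_ne_zero (R : ℝ) : ∀ᵐ z : ℝ, R - z ≠ 0 := by
  filter_upwards [Measure.ae_ne volume R] with z hz using sub_ne_zero.2 hz.symm

theorem ae_add_ne_zero (R : ℝ) : ∀ᵐ z : ℝ, R + z ≠ 0 := by
  filter_upwards [Measure.ae_ne volume (-R)] with z hz h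
  exact hz (by linarith)

/-- The odd increasing part has nonnegative symmetric average about any `R ≥ 0`, since `-(R - z) ≤ R
+ z`; only the contribution of the jump is kept. -/
theorem le_mollifiedPosition (hr : IsCavitatingSolution d h lam σ r) (hφ : IsMollifier φ)
    (hlam : 0 < lam) (hn : 1 ≤ n) (ht : 0 < t) (hK : ∀ s, s ≠ 0 → |evenStretch lam σ r s| ≤ K)
    {R : ℝ} (hR : 0 ≤ R) :
    2 * (t * r 0) * (∫ z in (0 : ℝ)..R, scaledMollifier φ n z) ≤ mollifiedPosition φ r t n R := by
  have hcont : Continuous fun x => t * oddProfile r (x / t) :=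
    continuous_const.mul (hr.continuous_oddProfile.comp (continuous_id.div_const t))
  rw [mollifiedPosition]
  refine le_add_of_nonneg_right (hφ.le_mollify hn hcont.locallyIntegrable
    (Eventually.of_forall fun z => ?_))
  have h1 : oddProfile r (-((R - z) / t)) ≤ oddProfile r ((R + z) / t) := by
    refine hr.monotone_oddProfile hlam hK ?_
    rw [← neg_div]
    gcongr
    linarith
  rw [oddProfile_neg] at h1
  rw [mul_zero, ← mul_add]
  exact mul_nonneg ht.le (by linarith)

theorem mollifiedPosition_le (hr : IsCavitatingSolution d h lam σ r) (hφ : IsMollifier φ)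
    (hn : 1 ≤ n) (ht : 0 < t) (hK0 : 0 ≤ K) (hK : ∀ s, s ≠ 0 → |evenStretch lam σ r s| ≤ K)
    {R Rbar : ℝ} (hR : R ∈ Ioo 0 Rbar) :
    mollifiedPosition φ r t n R ≤ t * r 0 + K * (Rbar + 1) := by
  have hc := hr.cavity
  have h1 : |mollify φ n (fun x => t * oddProfile r (x / t)) R| ≤ K * (Rbar + 1) := by
    refine hφ.abs_mollify_le hn (Eventually.of_forall fun z hz => ?_)
    have h2 := hr.abs_scaled_sub_le hK ht (R - z) 0
    rw [zero_div, oddProfile_zero, mul_zero, sub_zero, sub_zero] at h2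
    refine h2.trans (mul_le_mul_of_nonneg_left ?_ hK0)
    have h3 := abs_sub R z
    rw [abs_of_pos hR.1] at h3
    linarith [hR.2]
  have h2 := mul_le_mul_of_nonneg_left (hφ.mass_le_half hn R)
    (show 0 ≤ 2 * (t * r 0) by positivity)
  rw [mollifiedPosition]
  linarith [(abs_le.1 h1).2]

theorem abs_mollifiedVelocity_le (hr : IsCavitatingSolution d h lam σ r) (hφ : IsMollifier φ)
    (hn : 1 ≤ n) (ht : 0 < t) (hK0 : 0 ≤ K) (hK : ∀ s, s ≠ 0 → |evenStretch lam σ r s| ≤ K)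
    {R Rbar : ℝ} (hR : R ∈ Ioo 0 Rbar) :
    |mollifiedVelocity φ lam σ r t n R| ≤ r 0 + 2 * K * ((Rbar + 1) / t) := by
  have hc := hr.cavity
  have h1 : |mollify φ n (fun x => oddVelocity lam σ r (x / t)) R|
      ≤ 2 * K * ((Rbar + 1) / t) := by
    refine hφ.abs_mollify_le hn (Eventually.of_forall fun z hz => ?_)
    refine (hr.abs_oddVelocity_le hK ((R - z) / t)).trans ?_
    have h3 := abs_sub R z
    rw [abs_of_pos hR.1] at h3
    rw [abs_div, abs_of_pos ht]
    gcongr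
    linarith [hR.2]
  have h2 := mul_le_mul_of_nonneg_left (hφ.mass_le_half hn R) (show 0 ≤ 2 * r 0 by positivity)
  have h3 : 0 ≤ ∫ z in (0 : ℝ)..R, scaledMollifier φ n z := by
    simpa using hφ.mass_mono n hR.1.le
  rw [mollifiedVelocity]
  refine (abs_add_le _ _).trans (add_le_add ?_ h1)
  rw [abs_of_nonneg (by positivity)]
  linarith

theorem abs_mollify_evenStretch_le (hφ : IsMollifier φ) (hn : 1 ≤ n) (ht : 0 < t)
    (hK : ∀ s, s ≠ 0 → |evenStretch lam σ r s| ≤ K) (R : ℝ) :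
    |mollify φ n (fun x => evenStretch lam σ r (x / t)) R| ≤ K := by
  refine hφ.abs_mollify_le hn ?_
  filter_upwards [ae_sub_ne_zero R] with z hz _ using hK _ (div_ne_zero hz ht.ne')

/-- One of `R - z` and `R + z` has modulus at least `R`, and the stretch at the other is
nonnegative. Hence half of the pointwise lower bound at `R` survives mollification. -/
theorem le_mollifiedStretch (hr : IsCavitatingSolution d h lam σ r) (hφ : IsMollifier φ)
    (hn : 1 ≤ n) (ht : 0 < t) (hK : ∀ s, s ≠ 0 → |evenStretch lam σ r s| ≤ K) {k : ℝ} (hk : 0 ≤ k)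
    (hkp : ∀ s, 0 < s → k * min s σ ^ (d - 1) ≤ radialStretch lam σ r s) {R : ℝ} (hR : 0 ≤ R) :
    2 * (t * r 0) * scaledMollifier φ n R + k / 2 * min (R / t) σ ^ (d - 1)
      ≤ mollifiedStretch φ lam σ r t n R := by
  have hσ := hr.sigma_pos
  rw [mollifiedStretch]
  refine add_le_add le_rfl (hφ.le_mollify hn (hr.locallyIntegrable_evenStretch hK ht) ?_)
  have hmin : 0 ≤ min (R / t) σ := le_min (by positivity) hσ.le
  have key : ∀ x, R ≤ |x| → x ≠ 0 →
      k * min (R / t) σ ^ (d - 1) ≤ evenStretch lam σ r (x / t) := by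
    intro x hx hx0
    have h1 : R / t ≤ |x / t| := by rw [abs_div, abs_of_pos ht]; gcongr
    refine le_trans ?_ (hkp _ (abs_pos.2 (div_ne_zero hx0 ht.ne')))
    gcongr
  have hnn : ∀ x, x ≠ 0 → 0 ≤ evenStretch lam σ r (x / t) := fun x hx =>
    (mul_nonneg hk (pow_nonneg (le_min (abs_nonneg _) hσ.le) _)).trans
      (hkp _ (abs_pos.2 (div_ne_zero hx ht.ne')))
  filter_upwards [ae_sub_ne_zero R, ae_add_ne_zero R] with z hz1 hz2
  rw [show 2 * (k / 2 * min (R / t) σ ^ (d - 1)) = k * min (R / t) σ ^ (d - 1) by ring]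
  rcases le_total 0 z with hz | hz
  · have := key (R + z) ((by linarith : R ≤ R + z).trans (le_abs_self _)) hz2
    linarith [hnn _ hz1]
  · have := key (R - z) ((by linarith : R ≤ R - z).trans (le_abs_self _)) hz1
    linarith [hnn _ hz2]

/-- For `n R ≤ ε` the jump alone makes both `p` and `q/R` at least of order `n`. For `n R > ε` the
position is already bounded below, and the possible decay of `p` like `R^(d-1)` is balanced by the
factor `R^(-(d-1))` in `(q/R)^(d-1)`. -/
theorem exists_le_mollified_jacobian (hr : IsCavitatingSolution d h lam σ r)
    (hφ : IsMollifier φ) (hlam : 0 < lam) (ht : 0 < t)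
    (hK : ∀ s, s ≠ 0 → |evenStretch lam σ r s| ≤ K) {k : ℝ} (hk : 0 < k)
    (hkp : ∀ s, 0 < s → k * min s σ ^ (d - 1) ≤ radialStretch lam σ r s) {Rbar : ℝ}
    (hRbar : 0 < Rbar) :
    ∃ c, 0 < c ∧ ∀ n, 1 ≤ n → ∀ R ∈ Ioo 0 Rbar, 0 < mollifiedPosition φ r t n R ∧
      c ≤ mollifiedStretch φ lam σ r t n R
        * (mollifiedPosition φ r t n R / R) ^ (d - 1) := by
  obtain ⟨c₀, ε, hc₀, hε, hφc⟩ := hφ.exists_pos_near_zero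
  have hσ := hr.sigma_pos
  have hr0 := hr.cavity
  set a : ℝ := 2 * (t * r 0) * c₀ with ha
  have ha0 : 0 < a := by positivity
  -- The largest slope for which both arguments give `b * R ≤ min (R / t) σ` up to `Rbar`.
  set b : ℝ := min t⁻¹ (σ / Rbar) with hb
  have hb0 : 0 < b := by positivity
  refine ⟨min (a * a ^ (d - 1)) (k / 2 * (b * (a * ε)) ^ (d - 1)), by positivity,
    fun n hn R hR => ?_⟩
  have hR0 := hR.1
  have hn1 : (1 : ℝ) ≤ n := by exact_mod_cast hn
  have hn0 : (0 : ℝ) < n := zero_lt_one.trans_le hn1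
  have hq := hr.le_mollifiedPosition hφ hlam hn ht hK hR0.le
  have hp := hr.le_mollifiedStretch hφ hn ht hK hk.le hkp hR0.le
  have hmin : 0 < min (R / t) σ := lt_min (by positivity) hσ
  rcases le_or_gt (n * R) ε with hnR | hnR
  · have h1 := hφ.le_mass hφc hR0.le hnR
    have h2 : a * n ≤ mollifiedPosition φ r t n R / R := by
      rw [le_div_iff₀ hR0]
      refine le_trans (le_of_eq ?_) ((mul_le_mul_of_nonneg_left h1
        (show 0 ≤ 2 * (t * r 0) by positivity)).trans hq)
      rw [ha]; ring
    have h3 : n * c₀ ≤ scaledMollifier φ n R :=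
      mul_le_mul_of_nonneg_left (hφc _ (by rwa [abs_of_pos (by positivity)])) hn0.le
    have h4 : a * n ≤ mollifiedStretch φ lam σ r t n R := by
      refine le_trans (le_of_eq ?_) ((add_le_add (mul_le_mul_of_nonneg_left h3
        (show 0 ≤ 2 * (t * r 0) by positivity)) (show (0 : ℝ) ≤ _ by positivity)).trans hp)
      rw [ha]; ring
    have h5 : a ≤ a * n := le_mul_of_one_le_right ha0.le hn1
    refine ⟨(div_pos_iff_of_pos_right hR0).1 (ha0.trans_le (h5.trans h2)),
      (min_le_left _ _).trans ?_⟩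
    have h6 := h5.trans h2
    have h7 := h5.trans h4
    have h8 := ha0.le.trans h7
    gcongr
  · have h1 : c₀ * ε ≤ ∫ z in (0 : ℝ)..R, scaledMollifier φ n z := by
      have h2 := hφ.le_mass (n := n) hφc (R := ε / n) (by positivity)
        (by rw [mul_div_cancel₀ _ hn0.ne'])
      rw [mul_div_cancel₀ _ hn0.ne'] at h2
      exact h2.trans (hφ.mass_mono n (by rw [div_le_iff₀ hn0]; linarith))
    have h2 : a * ε ≤ mollifiedPosition φ r t n R := by
      refine le_trans (le_of_eq ?_) ((mul_le_mul_of_nonneg_left h1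
        (show 0 ≤ 2 * (t * r 0) by positivity)).trans hq)
      rw [ha]; ring
    have hpos := (mul_pos ha0 hε).trans_le h2
    refine ⟨hpos, (min_le_right _ _).trans ?_⟩
    have h3 : k / 2 * min (R / t) σ ^ (d - 1) ≤ mollifiedStretch φ lam σ r t n R :=
      (le_add_of_nonneg_left (mul_nonneg (by positivity) (hφ.scaled_nonneg n R))).trans hp
    have h4 : b * R ≤ min (R / t) σ := by
      refine le_min ?_ ?_
      · rw [div_eq_inv_mul]
        exact mul_le_mul_of_nonneg_right (min_le_left _ _) hR0.le
      · calc b * R ≤ σ / Rbar * Rbar := by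
              have := hR.2.le
              have : b ≤ σ / Rbar := min_le_right _ _
              gcongr
          _ = σ := by field_simp
    -- The powers of `R` cancel here, which makes the bound uniform down to `R = 0`.
    have h5 : b * (a * ε) ≤ min (R / t) σ * (mollifiedPosition φ r t n R / R) := by
      calc b * (a * ε) = b * R * (a * ε / R) := by field_simp
        _ ≤ _ := by gcongr
    calc k / 2 * (b * (a * ε)) ^ (d - 1)
        ≤ k / 2 * (min (R / t) σ * (mollifiedPosition φ r t n R / R)) ^ (d - 1) := by gcongr
      _ = k / 2 * min (R / t) σ ^ (d - 1) * (mollifiedPosition φ r t n R / R) ^ (d - 1) := by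
          rw [mul_pow]; ring
      _ ≤ _ := by gcongr

theorem exists_isConcentrating (hr : IsCavitatingSolution d h lam σ r) (hd : 2 ≤ d)
    (hh : IsEnergyFunction h) (hlam : 0 < lam) (hφ : IsMollifier φ) (ht : 0 < t) {Rbar : ℝ}
    (hRbar : 0 < Rbar) :
    ∃ C c, 0 < c ∧ IsConcentrating d Rbar C c (mollifiedStretch φ lam σ r t)
      (mollifiedPosition φ r t) (mollifiedVelocity φ lam σ r t) := by
  obtain ⟨K, hK0, hK⟩ := hr.exists_evenStretch_le hd hh hlam
  obtain ⟨k, hk, hkp⟩ := hr.exists_le_radialStretch hd hh hlam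
  obtain ⟨c, hc, hcv⟩ := hr.exists_le_mollified_jacobian hφ hlam ht hK hk hkp hRbar
  obtain ⟨Cφ, hCφ0, hCφ⟩ := hφ.exists_le
  have hr0 := hr.cavity
  have hσ := hr.sigma_pos
  set C₁ := t * r 0 + K * (Rbar + 1)
  set C₂ := r 0 + 2 * K * ((Rbar + 1) / t)
  set C₃ := 2 * (t * r 0) * Cφ + K
  have hC₁ : 0 ≤ C₁ := by positivity
  have hC₂ : 0 ≤ C₂ := by positivity
  have hC₃ : 0 ≤ 2 * (t * r 0) * Cφ := by positivity
  have hcont : Continuous fun x => t * oddProfile r (x / t) :=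
    continuous_const.mul (hr.continuous_oddProfile.comp (continuous_id.div_const t))
  have hmass : ∀ n, Continuous fun R => ∫ z in (0 : ℝ)..R, scaledMollifier φ n z := fun n =>
    continuous_iff_continuousAt.2 fun R => (hφ.hasDerivAt_mass n R).continuousAt
  refine ⟨C₁ + C₂ + C₃, c, hc, ?_⟩
  constructor
  · exact fun n hn R => hr.hasDerivAt_mollifiedPosition hφ hn ht hK0.le hK R
  · exact fun n hn => (continuous_const.mul (hφ.continuous_scaled n)).add
      (hφ.continuous_mollify hn (hr.locallyIntegrable_evenStretch hK ht))
  · exact fun n hn => (continuous_const.mul (hmass n)).add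
      (hφ.continuous_mollify hn (hr.locallyIntegrable_oddVelocity hK0.le hK ht))
  · intro n _
    rw [mollifiedPosition, intervalIntegral.integral_same, mul_zero, zero_add]
    -- An even mollifier applied to an odd function gives an odd function, which vanishes at `0`.
    have h1 : mollify φ n (fun x => t * oddProfile r (x / t)) 0
        = -mollify φ n (fun x => t * oddProfile r (x / t)) 0 := by
      conv_lhs => rw [hφ.mollify_eq_reflect]
      rw [mollify, ← integral_neg]
      refine integral_congr_ae (Eventually.of_forall fun z => ?_)
      simp only [zero_add, zero_sub, neg_div, oddProfile_neg]
      ring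
    linarith
  · exact fun n hn R hR => (hcv n hn R hR).1
  · exact fun n hn R hR => (hr.mollifiedPosition_le hφ hn ht hK0.le hK hR).trans (by linarith)
  · exact fun n hn R hR => (hr.abs_mollifiedVelocity_le hφ hn ht hK0.le hK hR).trans (by linarith)
  · intro n hn R hR
    have h1 := hr.le_mollifiedStretch hφ hn ht hK hk.le hkp hR.1.le
    have h2 : 0 < min (R / t) σ := lt_min (div_pos hR.1 ht) hσ
    have h3 := hφ.scaled_nonneg n R
    exact lt_of_lt_of_le (by positivity) h1
  · intro n hn R _
    have hn1 : (1 : ℝ) ≤ n := by exact_mod_cast hn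
    have h1 := (abs_le.1 (abs_mollify_evenStretch_le hφ hn ht hK R)).2
    have h2 : scaledMollifier φ n R ≤ n * Cφ :=
      mul_le_mul_of_nonneg_left (hCφ _) n.cast_nonneg
    calc mollifiedStretch φ lam σ r t n R ≤ 2 * (t * r 0) * (n * Cφ) + K := by
          rw [mollifiedStretch]
          gcongr
      _ ≤ 2 * (t * r 0) * (n * Cφ) + K * n := by
          gcongr
          exact le_mul_of_one_le_right hK0.le hn1
      _ = C₃ * n := by ring
      _ ≤ (C₁ + C₂ + C₃) * n := by gcongr; linarith
  · intro n hn R hR hnR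
    have h1 := (abs_le.1 (abs_mollify_evenStretch_le hφ hn ht hK R)).2
    rw [mollifiedStretch, hφ.scaled_eq_zero hn (by rwa [abs_of_pos hR.1]), mul_zero, zero_add]
    linarith
  · exact fun n hn R hR => (hcv n hn R hR).2

theorem tendsto_mollified (hr : IsCavitatingSolution d h lam σ r) (hφ : IsMollifier φ)
    (ht : 0 < t) (hK0 : 0 ≤ K) (hK : ∀ s, s ≠ 0 → |evenStretch lam σ r s| ≤ K) {R : ℝ}
    (hR : 0 < R) (hRσ : R ≠ t * σ) :
    Tendsto (fun n => mollifiedStretch φ lam σ r t n R) atTop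
        (𝓝 (radialStretch lam σ r (R / t))) ∧
      Tendsto (fun n => mollifiedPosition φ r t n R) atTop (𝓝 (t * r (R / t))) ∧
      Tendsto (fun n => mollifiedVelocity φ lam σ r t n R) atTop
        (𝓝 (radialVelocity lam σ r (R / t))) := by
  have hRt := div_pos hR ht
  have hσ := hr.sigma_pos
  have hRS : R ∉ ({0, t * σ, -(t * σ)} : Set ℝ) := by
    simp only [mem_insert_iff, mem_singleton_iff, not_or]
    refine ⟨hR.ne', hRσ, fun h => ?_⟩
    have : 0 < t * σ := by positivity
    linarith
  have hcont : Continuous fun x => t * oddProfile r (x / t) :=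
    continuous_const.mul (hr.continuous_oddProfile.comp (continuous_id.div_const t))
  have hsmall : ∀ᶠ n : ℕ in atTop, 1 ≤ n ∧ (n : ℝ)⁻¹ < R :=
    (eventually_ge_atTop 1).and (tendsto_inv_atTop_nhds_zero_nat.eventually_lt_const hR)
  have hmass : ∀ᶠ n : ℕ in atTop, ∫ z in (0 : ℝ)..R, scaledMollifier φ n z = 1 / 2 := by
    filter_upwards [hsmall] with n hn using hφ.mass_eq_half hn.1 hn.2.le
  have l1 := hφ.tendsto_mollify (hr.locallyIntegrable_evenStretch hK ht)
    (hr.continuousAt_evenStretch_div ht hRS).2 (tendsto_const_nhds (x := R))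
  have l2 := hφ.tendsto_mollify hcont.locallyIntegrable (x := R) hcont.continuousAt
    (tendsto_const_nhds (x := R))
  have l3 := hφ.tendsto_mollify (hr.locallyIntegrable_oddVelocity hK0 hK ht)
    (hr.continuousAt_oddVelocity ht hRS) (tendsto_const_nhds (x := R))
  refine ⟨?_, ?_, ?_⟩
  · simp only [evenStretch, abs_of_pos hRt] at l1
    refine l1.congr' ?_
    filter_upwards [hsmall] with n hn
    rw [mollifiedStretch, hφ.scaled_eq_zero hn.1 (by rw [abs_of_pos hR]; exact hn.2), mul_zero,
      zero_add]
    rfl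
  · have := l2.const_add (t * r 0)
    rw [oddProfile_of_pos r hRt] at this
    rw [show t * r 0 + t * (r (R / t) - r 0) = t * r (R / t) by ring] at this
    refine this.congr' ?_
    filter_upwards [hmass] with n hn
    rw [mollifiedPosition, hn]
    ring
  · have := l3.const_add (r 0)
    rw [oddVelocity, oddProfile_of_pos r hRt, evenStretch, abs_of_pos hRt] at this
    rw [show r 0 + (r (R / t) - r 0 - R / t * radialStretch lam σ r (R / t))
      = radialVelocity lam σ r (R / t) by rw [radialVelocity]; ring] at this
    refine this.congr' ?_
    filter_upwards [hmass] with n hn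
    rw [mollifiedVelocity, hn]
    ring

/-- At the edge of the core half of the mollifier's mass has been collected, so the whole cavity
radius is present, while the continuous part still tends to its value `0` at the origin. -/
theorem tendsto_mollifiedPosition_cavity (hr : IsCavitatingSolution d h lam σ r)
    (hφ : IsMollifier φ) :
    Tendsto (fun n : ℕ => mollifiedPosition φ r t n (n : ℝ)⁻¹) atTop (𝓝 (t * r 0)) := by
  have hcont : Continuous fun x => t * oddProfile r (x / t) :=
    continuous_const.mul (hr.continuous_oddProfile.comp (continuous_id.div_const t))
  have l1 := (hφ.tendsto_mollify hcont.locallyIntegrable (x := 0) hcont.continuousAt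
    tendsto_inv_atTop_nhds_zero_nat).const_add (t * r 0)
  rw [zero_div, oddProfile_zero, mul_zero, add_zero] at l1
  refine l1.congr' ?_
  filter_upwards [eventually_ge_atTop 1] with n hn
  rw [mollifiedPosition, hφ.mass_eq_half hn le_rfl]
  ring

end IsCavitatingSolution

end MollifiedBounds

/-! ### Energies of radial motions -/

section RadialEnergy

variable {d : ℕ}

theorem setIntegral_ball_radial (hd : 1 ≤ d) (f : ℝ → ℝ) (Rbar : ℝ) :
    ∫ x in Metric.ball (0 : Space d) Rbar, f ‖x‖
      = sphereArea d * ∫ R in Ioo 0 Rbar, R ^ (d - 1) * f R := by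
  have : Nonempty (Fin d) := ⟨⟨0, hd⟩⟩
  have hfin : Module.finrank ℝ (Space d) = d := finrank_euclideanSpace_fin
  have h1 : ∫ x in Metric.ball (0 : Space d) Rbar, f ‖x‖
      = ∫ x : Space d, (Iio Rbar).indicator f ‖x‖ := by
    rw [← integral_indicator Metric.isOpen_ball.measurableSet]
    refine integral_congr_ae (Eventually.of_forall fun x => ?_)
    simp [indicator]
  have h2 : ∫ R in Ioi (0 : ℝ), R ^ (d - 1) * (Iio Rbar).indicator f R
      = ∫ R in Ioo 0 Rbar, R ^ (d - 1) * f R := by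
    rw [← Ioi_inter_Iio, ← setIntegral_indicator measurableSet_Iio]
    refine integral_congr_ae (Eventually.of_forall fun R => ?_)
    by_cases hR : R ∈ Iio Rbar <;> simp [hR]
  rw [h1, integral_fun_norm_addHaar, hfin, sphereArea, Measure.toSphere_real_apply_univ, hfin]
  simp only [smul_eq_mul, nsmul_eq_mul]
  rw [h2, mul_assoc]

theorem energy_radialMotion (hd : 1 ≤ d) (h : ℝ → ℝ) {w : ℝ → ℝ → ℝ} {t Rbar : ℝ}
    {p q u : ℝ → ℝ} (hw : ∀ R, w R t = q R)
    (hR : ∀ R ∈ Ioo 0 Rbar, HasDerivAt (fun R => w R t) (p R) R)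
    (ht : ∀ R ∈ Ioo 0 Rbar, HasDerivAt (fun τ => w R τ) (u R) t)
    (hp : ∀ R ∈ Ioo 0 Rbar, 0 < p R) (hq : ∀ R ∈ Ioo 0 Rbar, 0 < q R)
    (hi : IntegrableOn (fun R => shellEnergy d h (p R) (q R) (u R) R) (Ioo 0 Rbar)) :
    IntegrableOn (energyDensity h (radialMotion d w) t) (Metric.ball (0 : Space d) Rbar) ∧
      ∫ x in Metric.ball (0 : Space d) Rbar, energyDensity h (radialMotion d w) t x
        = sphereArea d * ∫ R in Ioo 0 Rbar, shellEnergy d h (p R) (q R) (u R) R := by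
  have : Nonempty (Fin d) := ⟨⟨0, hd⟩⟩
  have hfin : Module.finrank ℝ (Space d) = d := finrank_euclideanSpace_fin
  set f : ℝ → ℝ := fun R => 1 / 2 * u R ^ 2 + radialStoredEnergy d h (p R) (q R / R) with hf
  have hae : (fun x : Space d => f ‖x‖)
      =ᵐ[volume.restrict (Metric.ball 0 Rbar)] energyDensity h (radialMotion d w) t := by
    refine (ae_restrict_iff' Metric.isOpen_ball.measurableSet).2 ?_
    have n1 : ∀ᵐ x : Space d, x ≠ 0 := by simp [ae_iff, measure_singleton]
    filter_upwards [n1] with x hx hxB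
    have hmem : ‖x‖ ∈ Ioo 0 Rbar := ⟨norm_pos_iff.2 hx, mem_ball_zero_iff.1 hxB⟩
    rw [energyDensity_radialMotion hd h hx (hR _ hmem) (ht _ hmem) (hp _ hmem)
      (by rw [hw]; exact hq _ hmem), hw]
    rfl
  have hi' : IntegrableOn (fun x : Space d => f ‖x‖) (Metric.ball 0 Rbar) := by
    rw [integrableOn_fun_norm_addHaar, hfin]
    exact hi
  refine ⟨hi'.congr hae, ?_⟩
  rw [← integral_congr_ae hae, setIntegral_ball_radial hd]
  rfl

end RadialEnergy

/-! ### The slic-energies -/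

section SlicEnergy

variable {d : ℕ} {h : ℝ → ℝ} {lam σ : ℝ} {r : ℝ → ℝ} {φ : ℝ → ℝ} {t Rbar L : ℝ}

/-- A linear function equals its symmetric averages, so the one-sided bound `le_mollify` for `lam`
and for `-lam` gives equality. -/
theorem IsMollifier.mollify_linear (hφ : IsMollifier φ) {n : ℕ} (hn : 1 ≤ n) (lam R : ℝ) :
    mollify φ n (fun x => lam * x) R = lam * R := by
  have hup := hφ.le_mollify hn (continuous_const_mul lam).locallyIntegrable (b := lam * R) (R := R)
    (Eventually.of_forall fun z => le_of_eq (by ring))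
  have hlo := hφ.le_mollify hn (continuous_const_mul (-lam)).locallyIntegrable (b := -lam * R)
    (R := R) (Eventually.of_forall fun z => le_of_eq (by ring))
  have hneg : mollify φ n (fun x => -lam * x) R = -mollify φ n (fun x => lam * x) R := by
    rw [mollify, mollify, ← integral_neg]
    refine integral_congr_ae (Eventually.of_forall fun z => ?_)
    ring
  rw [hneg] at hlo
  linarith

theorem IsMollifier.mollifiedAmplitude_homogeneous (hφ : IsMollifier φ) {n : ℕ} (hn : 1 ≤ n)
    (lam R t : ℝ) : mollifiedAmplitude φ n (homogeneousAmplitude lam) R t = lam * R := by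
  rw [hφ.mollifiedAmplitude_eq hn (c := 0) (v := fun x => lam * x) (continuous_const_mul lam)
    (fun x => by ring) (fun ρ _ => by rw [homogeneousAmplitude, zero_add]), hφ.mollify_linear hn]
  ring

/-- Mollification reproduces `lam * R` exactly, so the sequence of energies is constant for `n ≥ 1`.
-/
theorem hasSlicEnergy_homogeneous (hd : 1 ≤ d) (h : ℝ → ℝ) (hlam : 0 < lam) (hRbar : 0 < Rbar)
    (t : ℝ) :
    HasSlicEnergy d h (homogeneousAmplitude lam) (Metric.ball 0 Rbar) t
      (sphereArea d * (Rbar ^ d / d * (d / 2 * lam ^ 2 + h (lam ^ d)))) := by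
  intro φ hφ
  have hshell : ∀ R ∈ Ioo 0 Rbar, R ^ (d - 1) * (d / 2 * lam ^ 2 + h (lam ^ d))
      = shellEnergy d h lam (lam * R) 0 R := by
    intro R hR
    rw [shellEnergy, radialStoredEnergy, mul_div_cancel_right₀ _ hR.1.ne', ← pow_succ',
      Nat.sub_add_cancel hd]
    ring
  have hcont : Continuous fun R : ℝ => R ^ (d - 1) * (d / 2 * lam ^ 2 + h (lam ^ d)) := by fun_prop
  have hi : IntegrableOn (fun R => shellEnergy d h lam (lam * R) 0 R) (Ioo 0 Rbar) :=
    ((hcont.integrableOn_Icc (a := 0) (b := Rbar)).mono_set Ioo_subset_Icc_self).congr_fun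
      hshell measurableSet_Ioo
  have key : ∀ n : ℕ, 1 ≤ n → _ := fun n hn =>
    energy_radialMotion hd h (w := mollifiedAmplitude φ n (homogeneousAmplitude lam)) (t := t)
      (Rbar := Rbar) (p := fun _ => lam) (q := fun R => lam * R) (u := fun _ => 0)
      (fun R => hφ.mollifiedAmplitude_homogeneous hn lam R t)
      (fun R _ => by
        simp only [hφ.mollifiedAmplitude_homogeneous hn]
        simpa using (hasDerivAt_id' R).const_mul lam)
      (fun R _ => by
        simp only [hφ.mollifiedAmplitude_homogeneous hn]
        exact hasDerivAt_const t _)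
      (fun _ _ => hlam) (fun R hR => mul_pos hlam hR.1) hi
  refine ⟨fun n hn => (key n hn).1, ?_⟩
  refine tendsto_const_nhds.congr' ?_
  filter_upwards [eventually_ge_atTop 1] with n hn
  rw [(key n hn).2, ← setIntegral_congr_fun measurableSet_Ioo hshell,
    ← integral_Ioc_eq_integral_Ioo, ← intervalIntegral.integral_of_le hRbar.le,
    intervalIntegral.integral_mul_const, integral_pow, Nat.sub_add_cancel hd, Nat.cast_sub hd]
  simp [show d ≠ 0 by lia]

theorem IsCavitatingSolution.integral_shellEnergy (hr : IsCavitatingSolution d h lam σ r)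
    (hd : 3 ≤ d) (hh : IsEnergyFunction h) (hlam : 0 < lam) (ht : 0 < t) {a : ℝ} (ha0 : 0 < a)
    (ha : Tendsto (deriv r) (𝓝[<] σ) (𝓝 a)) (hfan : t * σ ≤ Rbar) :
    ∫ R in Ioo 0 Rbar, shellEnergy d h (radialStretch lam σ r (R / t)) (t * r (R / t))
        (radialVelocity lam σ r (R / t)) R
      = Rbar ^ d / d * (d / 2 * lam ^ 2 + h (lam ^ d))
        + t ^ d * (σ ^ d / d * shockDissipation d h lam a) := by
  have hσ := hr.sigma_pos
  have hRbar : 0 < Rbar := (mul_pos ht hσ).trans_le hfan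
  have h1 : ∀ R ∈ Ioo 0 Rbar, shellEnergy d h (radialStretch lam σ r (R / t)) (t * r (R / t))
      (radialVelocity lam σ r (R / t)) R
        = t ^ (d - 1) * ((R / t) ^ (d - 1) * radialEnergy d h lam σ r (R / t)) := by
    intro R hR
    have hR0 := hR.1
    rw [shellEnergy, radialEnergy, ← mul_assoc, ← mul_pow, mul_div_cancel₀ _ ht.ne',
      show t * r (R / t) / R = r (R / t) / (R / t) by field_simp]
  rw [setIntegral_congr_fun measurableSet_Ioo h1, ← integral_Ioc_eq_integral_Ioo,
    ← intervalIntegral.integral_of_le hRbar.le, intervalIntegral.integral_const_mul,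
    intervalIntegral.integral_comp_div
      (fun s => s ^ (d - 1) * radialEnergy d h lam σ r s) ht.ne', zero_div,
    hr.integral_radialEnergy hd hh hlam ha0 ha (by rw [le_div_iff₀ ht]; linarith), smul_eq_mul,
    ← mul_assoc, ← pow_succ, Nat.sub_add_cancel (by lia), div_pow]
  field_simp

/-- The mollified motions satisfy the concentration hypotheses, with limit the solution itself and
`q₀ = t * r 0`. The constants may depend on the mollifier, but the limit does not. -/
theorem IsCavitatingSolution.hasSlicEnergy (hr : IsCavitatingSolution d h lam σ r)
    (hd : 3 ≤ d) (hh : IsEnergyFunction h) (hlam : 0 < lam)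
    (hL : Tendsto (fun v => h v / v) atTop (𝓝 L)) (ht : 0 < t) {a : ℝ} (ha0 : 0 < a)
    (ha : Tendsto (deriv r) (𝓝[<] σ) (𝓝 a)) (hfan : t * σ ≤ Rbar) :
    HasSlicEnergy d h (selfSimilarAmplitude lam r) (Metric.ball 0 Rbar) t
      (sphereArea d * (Rbar ^ d / d * (d / 2 * lam ^ 2 + h (lam ^ d))
        + t ^ d * (σ ^ d / d * shockDissipation d h lam a) + L * ((t * r 0) ^ d / d))) := by
  intro φ hφ
  have hRbar : 0 < Rbar := (mul_pos ht hr.sigma_pos).trans_le hfan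
  have hhc := hh.contDiffOn.continuousOn
  obtain ⟨K, hK0, hK⟩ := hr.exists_evenStretch_le (by lia) hh hlam
  obtain ⟨C, c, hc, H⟩ := hr.exists_isConcentrating (by lia) hh hlam hφ ht hRbar
  have key : ∀ n : ℕ, 1 ≤ n → _ := fun n hn =>
    energy_radialMotion (by lia) h
      (w := mollifiedAmplitude φ n (selfSimilarAmplitude lam r)) (t := t) (Rbar := Rbar)
      (p := mollifiedStretch φ lam σ r t n) (q := mollifiedPosition φ r t n)
      (u := mollifiedVelocity φ lam σ r t n)
      (fun R => hr.mollifiedAmplitude_eq hφ hn ht R)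
      (fun R _ => by
        simp only [hr.mollifiedAmplitude_eq hφ hn ht]
        exact H.hasDerivAt n hn R)
      -- The closed formula holds at positive times only, which suffices near `t`.
      (fun R _ => (hr.hasDerivAt_mollifiedPosition_time hφ hn ht hK0.le hK
        R).congr_of_eventuallyEq (by
          filter_upwards [Ioi_mem_nhds ht] with τ hτ using hr.mollifiedAmplitude_eq hφ hn hτ R))
      (H.stretch_pos n hn) (H.amplitude_pos n hn)
      (H.integrableOn_shellEnergy hd hRbar hc hhc hL hn)
  refine ⟨fun n hn => (key n hn).1, ?_⟩
  have hlim := H.tendsto_integral hd hRbar hc hhc hL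
    (P := fun R => radialStretch lam σ r (R / t)) (Q := fun R => t * r (R / t))
    (U := fun R => radialVelocity lam σ r (R / t))
    (fun R hR => hr.radialStretch_pos hlam (div_pos hR.1 ht))
    (fun R hR => mul_pos ht (hr.pos hlam (div_pos hR.1 ht).le))
    (by
      filter_upwards [Measure.ae_ne volume (t * σ)] with R hR hmem
      exact hr.tendsto_mollified hφ ht hK0.le hK hmem.1 hR)
    (hr.tendsto_mollifiedPosition_cavity hφ)
  rw [hr.integral_shellEnergy hd hh hlam ht ha0 ha hfan] at hlim
  refine (hlim.const_mul (sphereArea d)).congr' ?_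
  filter_upwards [eventually_ge_atTop 1] with n hn using (key n hn).2.symm

/-- By self-similarity `w_R(R,t) = r'(R/t)`, so the value behind the shock is `r'(σ-)` at every
positive time. -/
theorem IsCavitatingSolution.leftLim_deriv_amplitude (hr : IsCavitatingSolution d h lam σ r)
    (ht : 0 < t) {a : ℝ} (ha : Tendsto (deriv r) (𝓝[<] σ) (𝓝 a)) :
    Function.leftLim (deriv fun R => selfSimilarAmplitude lam r R t) (t * σ) = a := by
  have hσ := hr.sigma_pos
  refine leftLim_eq_of_tendsto ?_
  have hdiv : Tendsto (fun R => R / t) (𝓝[<] (t * σ)) (𝓝[<] σ) := by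
    refine tendsto_nhdsWithin_iff.2 ⟨?_, ?_⟩
    · have := ((continuous_id.div_const t).tendsto (t * σ)).mono_left
        (nhdsWithin_le_nhds (s := Iio (t * σ)))
      simpa [mul_div_cancel_left₀ σ ht.ne'] using this
    · filter_upwards [self_mem_nhdsWithin] with R hR
      rw [mem_Iio, div_lt_iff₀ ht, mul_comm]
      exact hR
  refine ((tendsto_radialStretch (lam := lam) ha).comp hdiv).congr' ?_
  filter_upwards [Ioo_mem_nhdsLT (mul_pos ht hσ)] with R hR
  refine (hr.hasDerivAt_amplitude ht hR.1 fun hR' => ?_).deriv.symm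
  rw [div_eq_iff ht.ne', mul_comm] at hR'
  exact hR.2.ne hR'

end SlicEnergy

end SlicElasticity

end

open SlicElasticity in
theorem proposition3p10 (d : ℕ) (hd : 3 ≤ d) (h : ℝ → ℝ) (hh : IsEnergyFunction h)
    (lam σ : ℝ) (hlam : 0 < lam) (r : ℝ → ℝ) (hr : IsCavitatingSolution d h lam σ r)
    (L : ℝ) (hL : Tendsto (fun v => h v / v) atTop (𝓝 L))
    (t : ℝ) (ht : 0 < t) (Rbar : ℝ) (hfan : t * σ < Rbar) :
    ∃ E₀ : ℝ,
      HasSlicEnergy d h (homogeneousAmplitude lam) (Metric.ball 0 Rbar) t E₀ ∧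
      HasSlicEnergy d h (selfSimilarAmplitude lam r) (Metric.ball 0 Rbar) t
        (E₀
          + t ^ d * σ ^ d * sphereArea d / d
            * shockDissipation d h lam
                (Function.leftLim (deriv fun R => selfSimilarAmplitude lam r R t) (t * σ))
          + t ^ d * sphereArea d / d * r 0 ^ d * L) := by
  obtain ⟨a, ha0, ha⟩ := hr.deriv_front
  have hRbar : 0 < Rbar := (mul_pos ht hr.sigma_pos).trans hfan
  refine ⟨_, hasSlicEnergy_homogeneous (by lia) h hlam hRbar t, ?_⟩
  rw [hr.leftLim_deriv_amplitude ht ha]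
  convert hr.hasSlicEnergy hd hh hlam hL ht ha0 ha hfan.le using 1
  rw [mul_pow]
  ring
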